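/- **Setting.** Let $0<s<1$ and $c_s=\frac{\Gamma(1-s)}{2^{2s}\pi\Gamma(s)}$. Put $\mathbb R^2_+=\{x\in\mathbb R^2: x_1>0\}$, $\bar x=(-x_1,x_2)$, $(a_1,a_2)^\perp=(a_2,-a_1)$, and let $D=\mathbb R^2_+$ if $s>\frac12$, $D=\{x_1\ge 1\}$ if $s\le\frac12$. Functions on $D$ or $\mathbb R^2_+$ are extended by zero, and functions equal almost everywhere are identified. Let $$G_s(z)=\frac{c_s}{|z|^{2-2s}},\quad G_s^+(x,y)=G_s(x-y)-G_s(x-\bar y),\quad \mathcal G_s^+\zeta(x)=\int_{\mathbb R^2_+}G_s^+(x,y)\zeta(y)\,dy,$$ $$E(\zeta)=\frac12\int_D\zeta\,\mathcal G_s^+\zeta\,dx,\qquad I(\zeta)=\int_D x_1\zeta(x)\,dx .$$ For nonnegative $\xi$ let $\mathcal R(\xi)$ be the set of all $0\le\zeta\in L^1(D)$ with $|\{\zeta>\tau\}|=|\{\xi>\tau\}|$ for all $\tau>0$, and let $$\overline{\mathcal R(\xi)^w}=\Big\{\zeta\ge0\text{ measurable on }D:\ \int_D(\zeta-\alpha)_+\,dx\le\int_D(\xi-\alpha)_+\,dx\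 \text{ for all }\alpha>0\Big\}.$$ **Regular solutions.** Let $0\le\xi_0\in L^1\cap L^\infty(\mathbb R^2_+)$ and $0<T\le\infty$. An *$L^\infty$-regular solution* in $(0,T)$ with initial data $\xi_0$ is a nonnegative $\xi\in L^\infty_{loc}([0,T),L^1(\mathbb R^2_+))\cap L^\infty_{loc}([0,T),L^\infty(\mathbb R^2_+))$, defined for every $t\in[0,T)$, with $\xi(0)=\xi_0$, such that (i) $\theta(x,t)=\xi(x,t)-\xi(\bar x,t)$ solves $\partial_t\theta+\mathbf u\cdot\nabla\theta=0$, $\mathbf u=\nabla^\perp(-\Delta)^{-s}\theta=\nabla^\perp G_s*\theta$, in the sense of distributions on $\mathbb R^2\times[0,T)$ with initial data $\theta_0(x)=\xi_0(x)-\xi_0(\bar x)$: for every $\varphi\in C_c^\infty(\mathbb R^2\times[0,T))$, $$\int_0^T\Big(\int\theta\,\partial_t\varphi\,dx+\langle\theta\mathbf u,\nabla\varphi\rangle\Big)dt+\int\theta_0\,\varphi(\cdot,0)\,dx=0,$$ where $\langle\theta\mathbf u,\nabla\varphi\rangle=\frac12\iint\theta(x)\theta(y)\,\nabla^\perp G_s(x-y)\cdot(\nabla\varphi(x)-\nabla\varphi(y))\,dx\,dy$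 (which is $\int\theta\,\mathbf u\cdot\nabla\varphi\,dx$ whenever the integral defining $\mathbf u$ and this integral converge absolutely); (ii) $E(\xi(t))=E(\xi_0)$, $I(\xi(t))=I(\xi_0)$ and $\xi(t)\in\mathcal R(\xi_0)$ for all $t\in[0,T)$; in particular $\xi(t)$ and $\xi_0$ are nonnegative and supported in $D$. A function $\xi_0$ is *admissible* if it is nonnegative, supported in $D$ when $s\le\frac12$, and has an $L^\infty$-regular solution for $T=+\infty$. **Theorem.** Let $\max\{2,s^{-1}\}<q\le\infty$ if $0<s\le\frac12$ and $\frac{2}{2s-1}<q\le\infty$ if $\frac12<s<1$. Let $0\le\zeta_0\in L^q(D)$ with $0<|\{\zeta_0\neq0\}|<\infty$, and let $\mathcal W>0$. Let $\tilde\Sigma$ be the set of maximizers of $\tilde E_{\mathcal W}=E-\mathcal W I$ over $\overline{\mathcal R(\zeta_0)^w}$ (with $\tilde E_{\mathcal W}(\zeta)=-\infty$ if $I(\zeta)=+\infty$). Suppose that $$\emptyset\ne\tilde\Sigma\subset\mathcal R(\zeta_0)$$ and that every element of $\tilde\Sigma$ is admissible. Then for all $\eta>0$ and $M>0$ there is $\delta>0$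 with the following property. Let $0<T\le\infty$, and let $\xi$ be an $L^\infty$-regular solution in $(0,T)$ with initial data $\xi_0$ satisfying $\|\xi_0\|_\infty\le M$ and $$\inf_{\zeta\in\tilde\Sigma}\big\{\|\xi_0-\zeta\|_1+\|\xi_0-\zeta\|_2+|I(\xi_0-\zeta)|\big\}\le\delta$$ (the quantity being $+\infty$ if $x_1(\xi_0-\zeta)$ is not integrable). Then for all $t\in(0,T)$ $$\inf_{\zeta\in\tilde\Sigma}\big\{\|\xi(t)-\zeta\|_1+\|\xi(t)-\zeta\|_2\big\}\le\eta .$$ If in addition $I(\zeta_1)=I(\zeta_2)$ for all $\zeta_1,\zeta_2\in\tilde\Sigma$, then for all $t\in(0,T)$ also $$\inf_{\zeta\in\tilde\Sigma}\big\{\|\xi(t)-\zeta\|_1+\|\xi(t)-\zeta\|_2+I(|\xi(t)-\zeta|)\big\}\le\eta .$$ -/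

import Mathlib

open MeasureTheory Set
open scoped ENNReal ContDiff

noncomputable section

namespace GSQG

/-- Points `x = (x₁, x₂)` of the plane; `volume` is Lebesgue measure. The (sup) norm of the product
is not used: Euclidean lengths are written out as `euclLen`. -/
abbrev Plane : Type := ℝ × ℝ

/-- The Euclidean length `|z|`. -/
def euclLen (z : Plane) : ℝ := Real.sqrt (z.1 ^ 2 + z.2 ^ 2)

/-- The reflection `x ↦ x̄ = (-x₁, x₂)`. -/
def reflect (x : Plane) : Plane := (-x.1, x.2)

/-- The right half plane. -/
def halfPlane : Set Plane := {x | 0 < x.1}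

/-- The domain `D`: the half plane if `s > 1/2`, and `{x₁ ≥ 1}` if `s ≤ 1/2`. -/
def domain (s : ℝ) : Set Plane := {x | if 1 / 2 < s then 0 < x.1 else 1 ≤ x.1}

/-- The constant `c_s = Γ(1-s) / (2^{2s} π Γ(s))`. -/
def cs (s : ℝ) : ℝ := Real.Gamma (1 - s) / (2 ^ (2 * s) * Real.pi * Real.Gamma s)

/-- The fundamental solution `G_s(z) = c_s / |z|^{2-2s}` of `(-Δ)^s`. -/
def green (s : ℝ) (z : Plane) : ℝ := cs s / euclLen z ^ (2 - 2 * s)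

/-- `G_s^+(x, y) = G_s(x - y) - G_s(x - ȳ)`. -/
def greenPlus (s : ℝ) (x y : Plane) : ℝ := green s (x - y) - green s (x - reflect y)

/-- `𝒢_s^+ ζ(x) = ∫_{x₁ > 0} G_s^+(x, y) ζ(y) dy`. -/
def potentialPlus (s : ℝ) (ζ : Plane → ℝ) (x : Plane) : ℝ :=
  ∫ y in halfPlane, greenPlus s x y * ζ y

/-- `f` vanishes almost everywhere outside `S`. Functions on `S` are represented throughout by
functions on the plane with this property (extension by zero). -/
def VanishesOff (S : Set Plane) (f : Plane → ℝ) : Prop := ∀ᵐ x, x ∉ S → f x = 0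

/-- The rearrangement class `ℛ(ξ)` on `D`. -/
def rearrangements (s : ℝ) (ξ : Plane → ℝ) : Set (Plane → ℝ) :=
  {ζ | 0 ≤ᵐ[volume] ζ ∧ VanishesOff (domain s) ζ ∧ Integrable ζ ∧
    ∀ τ : ℝ, 0 < τ → volume {x | τ < ζ x} = volume {x | τ < ξ x}}

/-- The weak closure of the rearrangement class: measurable `ζ ≥ 0` on `D` with
`∫_D (ζ - α)₊ ≤ ∫_D (ξ - α)₊` for all `α > 0` (`ENNReal.ofReal` takes the positive part). -/
def weakClosure (s : ℝ) (ξ : Plane → ℝ) : Set (Plane → ℝ) :=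
  {ζ | AEMeasurable ζ ∧ 0 ≤ᵐ[volume] ζ ∧ VanishesOff (domain s) ζ ∧
    ∀ α : ℝ, 0 < α →
      ∫⁻ x in domain s, ENNReal.ofReal (ζ x - α) ≤ ∫⁻ x in domain s, ENNReal.ofReal (ξ x - α)}

/-- The kinetic energy `E(ζ) = ½ ∫_D ζ 𝒢_s^+ ζ`. -/
def energy (s : ℝ) (ζ : Plane → ℝ) : ℝ :=
  (1 / 2) * ∫ x in domain s, ζ x * potentialPlus s ζ x

/-- The impulse `I(f) = ∫_D x₁ f(x) dx` as an extended real number, positive part minus negative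
part; it is `+∞` for `f ≥ 0` with `x₁ f` not integrable. -/
def impulse (s : ℝ) (f : Plane → ℝ) : EReal :=
  ((∫⁻ x in domain s, ENNReal.ofReal (x.1 * f x) : ℝ≥0∞) : EReal) -
    ((∫⁻ x in domain s, ENNReal.ofReal (-(x.1 * f x)) : ℝ≥0∞) : EReal)

/-- `Ẽ_W = E - W I`, with the value `-∞` at functions of infinite impulse. -/
def energyImpulse (s W : ℝ) (ζ : Plane → ℝ) : EReal :=
  (energy s ζ : EReal) - (W : EReal) * impulse s ζ

/-- The set of maximizers of `E - W I` over the weak closure of the rearrangement class of `ζ₀`. -/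
def maximizers (s W : ℝ) (ζ₀ : Plane → ℝ) : Set (Plane → ℝ) :=
  {ζ | ζ ∈ weakClosure s ζ₀ ∧ IsMaxOn (energyImpulse s W) (weakClosure s ζ₀) ζ}

/-- The velocity kernel `K_s = ∇^⊥ G_s`, where `(a₁, a₂)^⊥ = (a₂, -a₁)`, that is
`K_s(z) = -(2 - 2s) c_s |z|^{2s-4} (z₂, -z₁)`. -/
def velocityKernel (s : ℝ) (z : Plane) : Plane :=
  (-(2 - 2 * s) * cs s * euclLen z ^ (2 * s - 4)) • ((z.2, -z.1) : Plane)

/-- The pairing `⟨θ u, ∇g⟩` of the flux `θ u`, `u = ∇^⊥ (-Δ)^{-s} θ = K_s * θ`, with a test function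
`g`. Since `K_s` is odd, it is the symmetrized integral
`½ ∬ θ(x) θ(y) K_s(x - y) · (∇g(x) - ∇g(y)) dx dy`, which converges absolutely for all `0 < s < 1`
and all integrable bounded `θ`, also when `s ≤ 1/2` and `u` need not be a function. Where `u` is
given by an absolutely convergent integral it is the usual `∫ θ u · ∇g`, see `fluxPairing_eq`. -/
def fluxPairing (s : ℝ) (θ g : Plane → ℝ) : ℝ :=
  (1 / 2) * ∫ p : Plane × Plane, θ p.1 * θ p.2 *
    (fderiv ℝ g p.1 (velocityKernel s (p.1 - p.2)) - fderiv ℝ g p.2 (velocityKernel s (p.1 - p.2)))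

theorem velocityKernel_neg (s : ℝ) (z : Plane) : velocityKernel s (-z) = -velocityKernel s z := by
  simp [velocityKernel, euclLen]

theorem fluxPairing_eq (s : ℝ) (θ g : Plane → ℝ)
    (h : Integrable (fun p : Plane × Plane =>
      θ p.1 * θ p.2 * fderiv ℝ g p.1 (velocityKernel s (p.1 - p.2))))
    (hu : ∀ x, Integrable (fun y => θ y • velocityKernel s (x - y))) :
    fluxPairing s θ g = ∫ x, θ x * fderiv ℝ g x (∫ y, θ y • velocityKernel s (x - y)) := by
  have hswap : Integrable (fun p : Plane × Plane =>
      θ p.2 * θ p.1 * fderiv ℝ g p.2 (velocityKernel s (p.2 - p.1))) := h.swap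
  have e : ∀ p : Plane × Plane, θ p.1 * θ p.2 *
      (fderiv ℝ g p.1 (velocityKernel s (p.1 - p.2))
        - fderiv ℝ g p.2 (velocityKernel s (p.1 - p.2)))
      = θ p.1 * θ p.2 * fderiv ℝ g p.1 (velocityKernel s (p.1 - p.2))
        + θ p.2 * θ p.1 * fderiv ℝ g p.2 (velocityKernel s (p.2 - p.1)) := by
    intro p
    have : velocityKernel s (p.1 - p.2) = - velocityKernel s (p.2 - p.1) := by
      rw [← velocityKernel_neg, neg_sub]
    rw [this, map_neg (fderiv ℝ g p.2)]
    ring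
  have e2 : ∫ p : Plane × Plane, θ p.2 * θ p.1 * fderiv ℝ g p.2 (velocityKernel s (p.2 - p.1))
      = ∫ p : Plane × Plane, θ p.1 * θ p.2 * fderiv ℝ g p.1 (velocityKernel s (p.1 - p.2)) :=
    integral_prod_swap (μ := (volume : Measure Plane)) (ν := (volume : Measure Plane))
      (fun p : Plane × Plane => θ p.1 * θ p.2 * fderiv ℝ g p.1 (velocityKernel s (p.1 - p.2)))
  unfold fluxPairing
  simp_rw [e]
  rw [integral_add h hswap, e2, ← two_mul, ← mul_assoc]
  norm_num
  rw [Measure.volume_eq_prod, integral_prod _ h]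
  congr 1
  funext x
  rw [← ContinuousLinearMap.integral_comp_comm _ (hu x), ← integral_const_mul]
  congr 1
  funext y
  simp [mul_assoc]

/-- The open time interval `(0, T)`, with `T = ⊤` allowed. -/
def timeInterval (T : EReal) : Set ℝ := {t | 0 < t ∧ (t : EReal) < T}

/-- `∂_t θ + u · ∇θ = 0`, `u = ∇^⊥ (-Δ)^{-s} θ`, in the sense of distributions on `ℝ² × [0, T)` with
initial data `θ₀`: for every `φ ∈ C_c^∞([0, T) × ℝ²)`,
`∫₀ᵀ (∫ θ ∂_t φ dx + ⟨θ u, ∇φ⟩) dt + ∫ θ₀ φ(0, ·) dx = 0`. -/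
def IsDistributionalSolution (s : ℝ) (T : EReal) (θ₀ : Plane → ℝ) (θ : ℝ → Plane → ℝ) : Prop :=
  ∀ φ : ℝ × Plane → ℝ, ContDiff ℝ ∞ φ → HasCompactSupport φ →
    tsupport φ ⊆ {p | (p.1 : EReal) < T} →
    (∫ t in timeInterval T,
      ((∫ x, θ t x * deriv (fun τ => φ (τ, x)) t) + fluxPairing s (θ t) (fun x => φ (t, x))))
      + ∫ x, θ₀ x * φ (0, x) = 0

/-- The odd extension `ξ(x) - ξ(x̄)`. -/
def oddExtension (ξ : Plane → ℝ) (x : Plane) : ℝ := ξ x - ξ (reflect x)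

/-- `L^∞`-regular solutions `ξ` in `(0, T)` with initial data `ξ₀`. -/
structure IsRegularSolution (s : ℝ) (T : EReal) (ξ₀ : Plane → ℝ) (ξ : ℝ → Plane → ℝ) : Prop where
  data_one : MemLp ξ₀ 1
  data_top : MemLp ξ₀ ⊤
  data_off : VanishesOff halfPlane ξ₀
  initial : ξ 0 =ᵐ[volume] ξ₀
  measurable : AEStronglyMeasurable (fun p : ℝ × Plane => ξ p.1 p.2)
    ((volume.restrict (timeInterval T)).prod volume)
  vanishes : ∀ t : ℝ, 0 ≤ t → (t : EReal) < T → VanishesOff halfPlane (ξ t)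
  bounded : ∀ τ : ℝ, (τ : EReal) < T → ∃ C : ℝ≥0∞, C ≠ ⊤ ∧
    ∀ᵐ t ∂(volume.restrict (Icc 0 τ)), eLpNorm (ξ t) 1 volume ≤ C ∧ eLpNorm (ξ t) ⊤ volume ≤ C
  equation : IsDistributionalSolution s T (oddExtension ξ₀) (fun t => oddExtension (ξ t))
  energy_eq : ∀ t : ℝ, 0 ≤ t → (t : EReal) < T → energy s (ξ t) = energy s ξ₀
  impulse_eq : ∀ t : ℝ, 0 ≤ t → (t : EReal) < T → impulse s (ξ t) = impulse s ξ₀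
  rearranged : ∀ t : ℝ, 0 ≤ t → (t : EReal) < T → ξ t ∈ rearrangements s ξ₀
  nonneg : 0 ≤ᵐ[volume] ξ₀ → ∀ t ∈ timeInterval T, 0 ≤ᵐ[volume] ξ t
  supported : s ≤ 1 / 2 → VanishesOff (domain s) ξ₀ →
    ∀ t ∈ timeInterval T, VanishesOff (domain s) (ξ t)

/-- Admissible initial data: nonnegative, supported in `D` if `s ≤ 1/2`, with a global
`L^∞`-regular solution. -/
def Admissible (s : ℝ) (ξ₀ : Plane → ℝ) : Prop :=
  0 ≤ᵐ[volume] ξ₀ ∧ (s ≤ 1 / 2 → VanishesOff (domain s) ξ₀) ∧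
    ∃ ξ : ℝ → Plane → ℝ, IsRegularSolution s ⊤ ξ₀ ξ

end GSQG

end

/-! The proof is concentration compactness for the relaxed variational problem. A regular solution
conserves energy, impulse and distribution function, so at every time it is as nearly maximal as its
initial datum. It is therefore enough that almost maximizing sequences approach the set of
maximizers (`exists_maximizer_near`); stability then follows by contradiction.

Setting. Admissibility makes the maximizers bounded, and equimeasurability passes the bound to `ζ₀`,
so all functions involved are represented by `[0, M]`-valued patches of finite mass. The constraint
becomes `excess F τ ≤ excess Z τ` for all `τ`, up to small errors. The excess is convex, hence
survives weak limits; it is almost superadditive when a sequence splits into its weak limit and a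
remote remainder (`eventually_split`), and subadditive for disjoint pieces. Small violations are
repaired by cutting off the top (`exists_le_excess_le`). Thus pieces may be separated, translated
and glued again inside the relaxed class.

Optimality of limits. Bounded impulse prevents horizontal escape, and positive energy forces mass
into some horizontal strip; after vertical translation there is a nonzero weak limit `A`. If `A`
were not optimal, the remote remainders would carry a definite energy, and suitable translates of
them would have a nonzero weak limit `B`. Cutting `A` and `B` down to strips does not lower `E - W
I`, because far away the potential is below `W x₁`. Placing the two truncations side by side and
keeping the rest of the remainder far away gains a fixed positive interaction energy, while all
errors are arbitrarily small. This exceeds the supremum (`le_penEnergy_of_weakTendsto`).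

Strong convergence. Being a maximizer, `A` is by hypothesis a rearrangement of `ζ₀`, so neither mass
nor `L²` norm is lost in the limit, and weak convergence becomes convergence in `L²` and `L¹`.
Energy is `L¹`-continuous on patches, so near maximality bounds the impulses from above by that of
`A`, and convergence in the weight `x₁` follows as well. -/

noncomputable section

open Filter
open scoped Topology NNReal

namespace GSQG

section

/-! ### Riesz kernels in the plane -/

/-- The kernel `|z|^{-p}`. -/
def riesz (p : ℝ) (z : Plane) : ℝ≥0∞ := ENNReal.ofReal (euclLen z ^ (-p))

theorem continuous_euclLen : Continuous euclLen := by
  unfold euclLen; fun_prop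

theorem euclLen_nonneg (z : Plane) : 0 ≤ euclLen z := Real.sqrt_nonneg _

theorem abs_fst_le_euclLen (z : Plane) : |z.1| ≤ euclLen z :=
  Real.abs_le_sqrt (by nlinarith [sq_nonneg z.2])

theorem abs_snd_le_euclLen (z : Plane) : |z.2| ≤ euclLen z :=
  Real.abs_le_sqrt (by nlinarith [sq_nonneg z.1])

theorem norm_le_euclLen (z : Plane) : ‖z‖ ≤ euclLen z := by
  rw [Prod.norm_def]
  exact max_le (abs_fst_le_euclLen z) (abs_snd_le_euclLen z)

theorem euclLen_pos {z : Plane} (hz : z ≠ 0) : 0 < euclLen z :=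
  (norm_pos_iff.2 hz).trans_le (norm_le_euclLen z)

theorem measurable_riesz (p : ℝ) : Measurable (riesz p) := by
  unfold riesz
  exact (continuous_euclLen.measurable.pow_const _).ennreal_ofReal

/-- The mass of the Riesz kernel near the origin. -/
def rieszMass (p ρ : ℝ) : ℝ≥0∞ := ∫⁻ z in {z : Plane | euclLen z < ρ}, riesz p z

/-- The Euclidean length dominates the sup norm, so the kernel is at most `‖z‖ ^ (-p)`, which is
integrable near the origin of a plane for `p < 2`. -/
theorem rieszMass_ne_top {p : ℝ} (hp0 : 0 < p) (hp : p < 2) (ρ : ℝ) : rieszMass p ρ ≠ ⊤ := by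
  have hsub : {z : Plane | euclLen z < ρ} ⊆ Metric.ball 0 ρ := fun z hz => by
    rw [mem_ball_zero_iff]; exact (norm_le_euclLen z).trans_lt hz
  have hint : IntegrableOn (fun z : Plane => euclLen z ^ (-p)) (Metric.ball 0 ρ) volume := by
    refine integrableOn_ball_of_norm_le_rpow (C := 1) (α := p) ?_ ?_
      (Filter.Eventually.of_forall fun z => ?_)
      (continuous_euclLen.measurable.pow_const _).aestronglyMeasurable
    · simp
    · simpa using hp
    · rw [Real.norm_of_nonneg (Real.rpow_nonneg (euclLen_nonneg z) _), one_mul]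
      rcases eq_or_ne z 0 with rfl | hz
      -- At the origin the power has the default value zero, so the bound holds there too.
      · simp [euclLen, Real.zero_rpow (neg_ne_zero.2 hp0.ne')]
      · exact Real.rpow_le_rpow_of_nonpos (norm_pos_iff.2 hz) (norm_le_euclLen z) (by linarith)
  have h2 := (hint.mono_set hsub).lintegral_lt_top
  exact h2.ne

/-- Absolute continuity of the integral over the unit disc, applied to discs whose area is at most
that of a square of side `2ρ`. -/
theorem exists_rieszMass_le {p : ℝ} (hp0 : 0 < p) (hp : p < 2) {ε : ℝ≥0∞} (hε : ε ≠ 0) :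
    ∃ ρ : ℝ, 0 < ρ ∧ rieszMass p ρ ≤ ε := by
  have hmeas : MeasurableSet {z : Plane | euclLen z < 1} :=
    measurableSet_lt continuous_euclLen.measurable measurable_const
  obtain ⟨δ, δ0, hδ⟩ := exists_pos_setLIntegral_lt_of_measure_lt
    (μ := (volume : Measure Plane).restrict {z : Plane | euclLen z < 1}) (f := riesz p)
    (rieszMass_ne_top hp0 hp 1) hε
  have hlim : Tendsto (fun r : ℝ => ENNReal.ofReal (2 * r) * ENNReal.ofReal (2 * r))
      (𝓝[>] 0) (𝓝 0) := by
    have h1 : Tendsto (fun r : ℝ => ENNReal.ofReal (2 * r)) (𝓝[>] 0) (𝓝 0) := by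
      have : Tendsto (fun r : ℝ => ENNReal.ofReal (2 * r)) (𝓝 0) (𝓝 (ENNReal.ofReal 0)) :=
        ENNReal.tendsto_ofReal (Continuous.tendsto' (by fun_prop) _ _ (by simp))
      rw [ENNReal.ofReal_zero] at this
      exact this.mono_left nhdsWithin_le_nhds
    simpa using ENNReal.Tendsto.mul h1 (Or.inr ENNReal.zero_ne_top) h1 (Or.inr ENNReal.zero_ne_top)
  obtain ⟨ρ, ⟨hρδ, hρ1⟩, hρ0⟩ := ((hlim.eventually_lt_const δ0).and
    (eventually_nhdsWithin_of_eventually_nhds (eventually_lt_nhds (zero_lt_one' ℝ)))).and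
    self_mem_nhdsWithin |>.exists
  refine ⟨ρ, hρ0, ?_⟩
  have hsub : {z : Plane | euclLen z < ρ} ⊆ {z : Plane | euclLen z < 1} := fun z hz =>
    lt_trans hz hρ1
  have hvol : volume {z : Plane | euclLen z < ρ} ≤ ENNReal.ofReal (2 * ρ) * ENNReal.ofReal (2 * ρ) := by
    have : {z : Plane | euclLen z < ρ} ⊆ Metric.ball (0 : Plane) ρ := fun z hz => by
      rw [mem_ball_zero_iff]; exact (norm_le_euclLen z).trans_lt hz
    refine (measure_mono this).trans ?_
    rw [show (0 : Plane) = ((0 : ℝ), (0 : ℝ)) from rfl, ← ball_prod_same, Measure.volume_eq_prod,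
      Measure.prod_prod, Real.volume_ball]
  have h3 := hδ {z : Plane | euclLen z < ρ} (by
    rw [Measure.restrict_apply' hmeas]
    exact (measure_mono inter_subset_left).trans_lt (hvol.trans_lt hρδ))
  rw [Measure.restrict_restrict_of_subset hsub] at h3
  exact h3.le

/-- Horizontal strips. -/
def strip (a R : ℝ) : Set Plane := {x | |x.2 - a| < R}

theorem measurableSet_strip (a R : ℝ) : MeasurableSet (strip a R) :=
  measurableSet_lt (by fun_prop) measurable_const

/-- The Riesz potential of a bounded function is controlled by the mass in a strip. -/
theorem lintegral_riesz_mul_le {p : ℝ} (hp : 0 < p) {ρ R : ℝ} (hρ : 0 < ρ) (hR : 0 < R)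
    {M : ℝ≥0∞} {F : Plane → ℝ≥0∞} (hF : Measurable F) (hM : ∀ x, F x ≤ M) (x : Plane) :
    ∫⁻ y, riesz p (x - y) * F y ≤ M * rieszMass p ρ +
      ENNReal.ofReal (ρ ^ (-p)) * (∫⁻ y in strip x.2 R, F y) +
      ENNReal.ofReal (R ^ (-p)) * ∫⁻ y, F y := by
  have hmeas : MeasurableSet {z : Plane | euclLen z < ρ} :=
    measurableSet_lt continuous_euclLen.measurable measurable_const
  have h1 : Measurable fun y => {z : Plane | euclLen z < ρ}.indicator (riesz p) (x - y) :=
    ((measurable_riesz p).indicator hmeas).comp (by fun_prop)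
  have h2 := hF.indicator (measurableSet_strip x.2 R)
  -- Within distance `ρ` the bound `F ≤ M` meets the integrable singularity. Beyond it the kernel is
  -- at most `ρ ^ (-p)`. Off the strip the vertical distance alone is at least `R`.
  have key : ∀ y, riesz p (x - y) * F y ≤
      M * {z : Plane | euclLen z < ρ}.indicator (riesz p) (x - y)
        + ENNReal.ofReal (ρ ^ (-p)) * (strip x.2 R).indicator F y
        + ENNReal.ofReal (R ^ (-p)) * F y := by
    intro y
    by_cases hy : euclLen (x - y) < ρ
    · rw [indicator_of_mem (show x - y ∈ {z : Plane | euclLen z < ρ} from hy), mul_comm]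
      exact le_add_right (le_add_right (by gcongr; exact hM y))
    · by_cases hs : y ∈ strip x.2 R
      · rw [indicator_of_mem hs]
        refine le_add_right (le_add_left ?_)
        gcongr
        exact ENNReal.ofReal_le_ofReal
          (Real.rpow_le_rpow_of_nonpos hρ (not_lt.1 hy) (by linarith))
      · refine le_add_left ?_
        gcongr
        refine ENNReal.ofReal_le_ofReal (Real.rpow_le_rpow_of_nonpos hR ?_ (by linarith))
        refine (not_lt.1 hs).trans ?_
        rw [abs_sub_comm]
        exact abs_snd_le_euclLen (x - y)
  refine (lintegral_mono key).trans ?_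
  rw [lintegral_add_right _ (hF.const_mul _), lintegral_add_right _ (h2.const_mul _),
    lintegral_const_mul _ h1, lintegral_const_mul _ h2, lintegral_const_mul _ hF,
    lintegral_indicator (measurableSet_strip _ _),
    lintegral_sub_left_eq_self (fun z => {z : Plane | euclLen z < ρ}.indicator (riesz p) z) x,
    lintegral_indicator hmeas]
  rfl

/-! ### The kernel of the half plane -/

theorem cs_pos {s : ℝ} (hs0 : 0 < s) (hs1 : s < 1) : 0 < cs s := by
  unfold cs
  have := Real.Gamma_pos_of_pos hs0
  have := Real.Gamma_pos_of_pos (sub_pos.2 hs1)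
  positivity

/-- The kernel `G_s^+` with values in `[0, ∞]`. -/
def kern (s : ℝ) (x y : Plane) : ℝ≥0∞ := ENNReal.ofReal (greenPlus s x y)

theorem measurable_green (s : ℝ) : Measurable (green s) := by
  unfold green
  exact measurable_const.div (continuous_euclLen.measurable.pow_const _)

theorem measurable_reflect : Measurable reflect := by
  unfold reflect; fun_prop

theorem measurable_greenPlus (s : ℝ) : Measurable fun p : Plane × Plane => greenPlus s p.1 p.2 :=
  Measurable.sub ((measurable_green s).comp (measurable_fst.sub measurable_snd))
    ((measurable_green s).comp (measurable_fst.sub (measurable_reflect.comp measurable_snd)))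

theorem measurable_kern (s : ℝ) : Measurable fun p : Plane × Plane => kern s p.1 p.2 :=
  (measurable_greenPlus s).ennreal_ofReal

theorem measurable_kern_right (s : ℝ) (x : Plane) : Measurable (kern s x) :=
  Measurable.of_uncurry_left (f := kern s) (measurable_kern s)

theorem green_eq (s : ℝ) (z : Plane) : green s z = cs s * euclLen z ^ (-(2 - 2 * s)) := by
  rw [green, Real.rpow_neg (euclLen_nonneg z), div_eq_mul_inv]

theorem green_nonneg {s : ℝ} (hs0 : 0 < s) (hs1 : s < 1) (z : Plane) : 0 ≤ green s z :=
  div_nonneg (cs_pos hs0 hs1).le (Real.rpow_nonneg (euclLen_nonneg z) _)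

theorem kern_le {s : ℝ} (hs0 : 0 < s) (hs1 : s < 1) (x y : Plane) :
    kern s x y ≤ ENNReal.ofReal (cs s) * riesz (2 - 2 * s) (x - y) := by
  rw [riesz, ← ENNReal.ofReal_mul (cs_pos hs0 hs1).le, ← green_eq]
  exact ENNReal.ofReal_le_ofReal (sub_le_self _ (green_nonneg hs0 hs1 _))

theorem euclLen_sub_comm (x y : Plane) : euclLen (x - y) = euclLen (y - x) := by
  simp only [euclLen, Prod.fst_sub, Prod.snd_sub]
  congr 1; ring

theorem euclLen_sub_reflect_comm (x y : Plane) :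
    euclLen (x - reflect y) = euclLen (y - reflect x) := by
  simp only [euclLen, reflect, Prod.fst_sub, Prod.snd_sub]
  congr 1; ring

theorem kern_comm (s : ℝ) (x y : Plane) : kern s x y = kern s y x := by
  simp only [kern, greenPlus, green, euclLen_sub_comm x y, euclLen_sub_reflect_comm x y]

/-- Vertical translations commute with the reflection. This invariance is the reason why compactness
can hold only up to vertical shifts. -/
theorem kern_add_add (s h : ℝ) (x y : Plane) :
    kern s (x + (0, h)) (y + (0, h)) = kern s x y := by
  have h1 : x + (0, h) - (y + (0, h)) = x - y := by simp
  have h2 : x + (0, h) - reflect (y + (0, h)) = x - reflect y := by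
    ext <;> simp [reflect]
  simp only [kern, greenPlus, h1, h2]

/-- The squared lengths differ by `4 x₁ y₁`. -/
theorem euclLen_sub_lt_reflect {x y : Plane} (hx : 0 < x.1) (hy : 0 < y.1) :
    euclLen (x - y) < euclLen (x - reflect y) := by
  refine Real.sqrt_lt_sqrt (by positivity) ?_
  simp only [reflect, Prod.fst_sub, Prod.snd_sub]
  nlinarith [mul_pos hx hy]

theorem greenPlus_pos {s : ℝ} (hs0 : 0 < s) (hs1 : s < 1) {x y : Plane} (hx : 0 < x.1)
    (hy : 0 < y.1) (hxy : x ≠ y) : 0 < greenPlus s x y := by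
  have h0 := euclLen_pos (sub_ne_zero.2 hxy)
  have h1 := Real.rpow_lt_rpow_of_neg h0 (euclLen_sub_lt_reflect hx hy)
    (show -(2 - 2 * s) < 0 by linarith)
  rw [greenPlus, green_eq, green_eq, sub_pos]
  exact mul_lt_mul_of_pos_left h1 (cs_pos hs0 hs1)

/-- The vector `reflect x - reflect y` has the length of `x - y` and differs from `x - reflect y` by
`2 x₁` horizontally. -/
theorem euclLen_sub_reflect_le {x y : Plane} (hx : 0 < x.1) :
    euclLen (x - reflect y) ≤ euclLen (x - y) + 2 * x.1 := by
  have h0 := euclLen_nonneg (x - y)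
  refine (Real.sqrt_le_left (by linarith)).2 ?_
  have h1 := abs_le.1 (abs_fst_le_euclLen (x - y))
  have h2 : euclLen (x - y) ^ 2 = (x.1 - y.1) ^ 2 + (x.2 - y.2) ^ 2 := by
    rw [euclLen, Real.sq_sqrt (by positivity)]; rfl
  simp only [Prod.fst_sub] at h1
  simp only [reflect, Prod.fst_sub, Prod.snd_sub]
  nlinarith [h1.1, h1.2]

/-- Near the boundary of the half plane the kernel gains a factor `x₁`. -/
theorem kern_le_fst {s : ℝ} (hs : 1 / 2 < s) (hs1 : s < 1) {x y : Plane} (hx : 0 < x.1)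
    (hy : 0 < y.1) :
    kern s x y ≤ ENNReal.ofReal (2 * cs s * x.1) * riesz (3 - 2 * s) (x - y) := by
  have hc := cs_pos (by linarith) hs1
  rw [riesz, ← ENNReal.ofReal_mul (by positivity)]
  refine ENNReal.ofReal_le_ofReal ?_
  -- On the diagonal the powers of zero are zero by convention, so `greenPlus` is nonpositive there
  -- and the right side vanishes.
  rcases eq_or_ne x y with rfl | hxy
  · have h0 : euclLen (x - x) = 0 := by simp [euclLen]
    rw [greenPlus, green_eq, h0, Real.zero_rpow (by linarith), Real.zero_rpow (by linarith)]
    simpa using green_nonneg (by linarith) hs1 _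
  have ha := euclLen_pos (sub_ne_zero.2 hxy)
  have hab := (euclLen_sub_lt_reflect hx hy).le
  have hb2 := euclLen_sub_reflect_le (y := y) hx
  rw [greenPlus, green_eq, green_eq]
  set a := euclLen (x - y)
  set b := euclLen (x - reflect y)
  have hb : 0 < b := ha.trans_le hab
  set p := 2 - 2 * s with hp
  have hp1 : p ≤ 1 := by linarith
  have e1 : a ^ (-(3 - 2 * s)) = a ^ (-p) / a := by
    rw [show -(3 - 2 * s) = -p - 1 by rw [hp]; ring, Real.rpow_sub_one ha.ne']
  have hap : 0 < a ^ (-p) := Real.rpow_pos_of_pos ha _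
  have e2 : b ^ (-p) = a ^ (-p) * (a / b) ^ p := by
    rw [Real.div_rpow ha.le hb.le, Real.rpow_neg ha.le, Real.rpow_neg hb.le]
    have := (Real.rpow_pos_of_pos ha p).ne'
    field_simp
  -- As `s > 1/2`, the exponent `p` is at most one, and a ratio in `(0, 1]` does not exceed its
  -- `p`-th power. Hence `1 - (a/b)^p ≤ (b - a)/b ≤ 2 x₁ / a`.
  have e3 : a / b ≤ (a / b) ^ p := by
    have h01 : a / b ≤ 1 := (div_le_one hb).2 hab
    have := Real.rpow_le_rpow_of_exponent_ge (div_pos ha hb) h01 hp1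
    rwa [Real.rpow_one] at this
  have e4 : 1 - a / b ≤ 2 * x.1 / a := by
    rw [sub_le_iff_le_add, div_add_div _ _ ha.ne' hb.ne', le_div_iff₀ (by positivity)]
    nlinarith
  rw [e1, e2]
  calc cs s * a ^ (-p) - cs s * (a ^ (-p) * (a / b) ^ p)
      = cs s * a ^ (-p) * (1 - (a / b) ^ p) := by ring
    _ ≤ cs s * a ^ (-p) * (2 * x.1 / a) := by gcongr; linarith
    _ = 2 * cs s * x.1 * (a ^ (-p) / a) := by ring

end

section

/-! ### Potential, energy form, impulse and excess of `[0, ∞]`-valued functions -/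

/-- The potential `𝒢_s^+ F`. -/
def pot (s : ℝ) (F : Plane → ℝ≥0∞) (x : Plane) : ℝ≥0∞ := ∫⁻ y, kern s x y * F y

/-- The energy form `∬ F(x) G_s^+(x, y) G(y)`. -/
def bil (s : ℝ) (F G : Plane → ℝ≥0∞) : ℝ≥0∞ := ∫⁻ x, F x * pot s G x

/-- The impulse `∫ x₁ F`. -/
def imp (F : Plane → ℝ≥0∞) : ℝ≥0∞ := ∫⁻ x, ENNReal.ofReal x.1 * F x

/-- The excess `∫ (F - τ)₊`. -/
def excess (F : Plane → ℝ≥0∞) (τ : ℝ≥0∞) : ℝ≥0∞ := ∫⁻ x, (F x - τ)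

/-- Vertical translates. -/
def shift (h : ℝ) (F : Plane → ℝ≥0∞) (x : Plane) : ℝ≥0∞ := F (x + (0, h))

theorem measurable_shift {F : Plane → ℝ≥0∞} (hF : Measurable F) (h : ℝ) : Measurable (shift h F) :=
  hF.comp (measurable_id.add_const _)

theorem measurable_pot (s : ℝ) {F : Plane → ℝ≥0∞} (hF : Measurable F) : Measurable (pot s F) := by
  have h : Measurable (Function.uncurry fun x y : Plane => kern s x y * F y) :=
    (measurable_kern s).mul (hF.comp measurable_snd)
  exact h.lintegral_prod_right

theorem measurable_ofReal_fst_mul {F : Plane → ℝ≥0∞} (hF : Measurable F) :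
    Measurable fun x : Plane => ENNReal.ofReal x.1 * F x :=
  measurable_fst.ennreal_ofReal.mul hF

theorem pot_add (s : ℝ) {F : Plane → ℝ≥0∞} (hF : Measurable F) (G : Plane → ℝ≥0∞) :
    pot s (F + G) = pot s F + pot s G := by
  funext x
  simp only [pot, Pi.add_apply, mul_add]
  exact lintegral_add_left ((measurable_kern_right s x).mul hF) _

theorem pot_mono (s : ℝ) {F G : Plane → ℝ≥0∞} (h : F ≤ G) : pot s F ≤ pot s G := fun x =>
  lintegral_mono fun y => by gcongr; exact h y

theorem bil_mono (s : ℝ) {F F' G G' : Plane → ℝ≥0∞} (h : F ≤ F') (h' : G ≤ G') :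
    bil s F G ≤ bil s F' G' :=
  lintegral_mono fun x => mul_le_mul' (h x) (pot_mono s h' x)

theorem bil_add_left (s : ℝ) {F F' G : Plane → ℝ≥0∞} (hF : Measurable F) (hG : Measurable G) :
    bil s (F + F') G = bil s F G + bil s F' G := by
  simp only [bil, Pi.add_apply, add_mul]
  exact lintegral_add_left (hF.mul (measurable_pot s hG)) _

theorem bil_add_right (s : ℝ) {F G G' : Plane → ℝ≥0∞} (hF : Measurable F) (hG : Measurable G) :
    bil s F (G + G') = bil s F G + bil s F G' := by
  simp only [bil, pot_add s hG, Pi.add_apply, mul_add]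
  exact lintegral_add_left (hF.mul (measurable_pot s hG)) _

theorem bil_eq (s : ℝ) (F : Plane → ℝ≥0∞) {G : Plane → ℝ≥0∞} (hG : Measurable G) :
    bil s F G = ∫⁻ x, ∫⁻ y, F x * (kern s x y * G y) := by
  unfold bil pot
  congr 1
  funext x
  rw [lintegral_const_mul _ ((measurable_kern_right s x).fun_mul hG)]

theorem bil_comm (s : ℝ) {F G : Plane → ℝ≥0∞} (hF : Measurable F) (hG : Measurable G) :
    bil s F G = bil s G F := by
  have hm : Measurable (Function.uncurry fun x y : Plane => F x * (kern s x y * G y)) :=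
    (hF.comp measurable_fst).mul ((measurable_kern s).mul (hG.comp measurable_snd))
  rw [bil_eq s F hG, bil_eq s G hF, lintegral_lintegral_swap hm.aemeasurable]
  congr 1; funext x; congr 1; funext y
  rw [kern_comm s y x]
  ring

theorem bil_add_self (s : ℝ) {F G : Plane → ℝ≥0∞} (hF : Measurable F) (hG : Measurable G) :
    bil s (F + G) (F + G) = bil s F F + bil s G G + 2 * bil s F G := by
  rw [bil_add_left s hF (hF.add hG), bil_add_right s hF hF, bil_add_right s hG hF,
    bil_comm s hG hF]
  ring

/-- A second copy of `bil s G G` completes the interaction with the sum: a piece `G` contributes at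
most twice its interaction with the whole. -/
theorem bil_add_self_le (s : ℝ) {F G : Plane → ℝ≥0∞} (hF : Measurable F) (hG : Measurable G) :
    bil s (F + G) (F + G) ≤ bil s F F + 2 * bil s G (F + G) := by
  rw [bil_add_self s hF hG, bil_add_right s hG hF, bil_comm s hF hG, mul_add, add_assoc,
    add_comm (bil s G G)]
  gcongr
  rw [two_mul]
  exact le_self_add

theorem imp_add {F : Plane → ℝ≥0∞} (hF : Measurable F) (G : Plane → ℝ≥0∞) :
    imp (F + G) = imp F + imp G := by
  simp only [imp, Pi.add_apply, mul_add]
  exact lintegral_add_left (measurable_ofReal_fst_mul hF) _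

theorem imp_mono {F G : Plane → ℝ≥0∞} (h : F ≤ G) : imp F ≤ imp G :=
  lintegral_mono fun x => by gcongr; exact h x

theorem excess_mono {F G : Plane → ℝ≥0∞} (h : F ≤ G) (τ : ℝ≥0∞) : excess F τ ≤ excess G τ :=
  lintegral_mono fun x => tsub_le_tsub_right (h x) τ

theorem excess_zero (F : Plane → ℝ≥0∞) : excess F 0 = ∫⁻ x, F x := by simp [excess]

theorem lintegral_shift (h : ℝ) (F : Plane → ℝ≥0∞) : ∫⁻ x, shift h F x = ∫⁻ x, F x :=
  lintegral_add_right_eq_self F ((0, h) : Plane)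

theorem setLIntegral_strip_shift (h a R : ℝ) (F : Plane → ℝ≥0∞) :
    ∫⁻ x in strip a R, shift h F x = ∫⁻ x in strip (a + h) R, F x := by
  rw [← lintegral_indicator (measurableSet_strip _ _),
    ← lintegral_indicator (measurableSet_strip _ _),
    ← lintegral_shift h ((strip (a + h) R).indicator F)]
  congr 1; funext x
  have : x + (0, h) ∈ strip (a + h) R ↔ x ∈ strip a R := by
    simp [strip]
  by_cases hx : x ∈ strip a R
  · rw [indicator_of_mem hx, shift, shift, indicator_of_mem (this.2 hx)]
  · rw [indicator_of_notMem hx, shift, indicator_of_notMem (this.not.2 hx)]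

theorem pot_shift (s h : ℝ) (F : Plane → ℝ≥0∞) : pot s (shift h F) = shift h (pot s F) := by
  funext x
  simp only [pot, shift]
  rw [← lintegral_add_right_eq_self (fun y => kern s (x + (0, h)) y * F y) ((0, h) : Plane)]
  simp only [kern_add_add]

theorem bil_shift (s h : ℝ) (F G : Plane → ℝ≥0∞) :
    bil s (shift h F) (shift h G) = bil s F G := by
  unfold bil
  rw [pot_shift]
  exact lintegral_shift h fun x => F x * pot s G x

theorem imp_shift (h : ℝ) (F : Plane → ℝ≥0∞) : imp (shift h F) = imp F := by
  unfold imp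
  rw [← lintegral_shift h fun x => ENNReal.ofReal x.1 * F x]
  simp [shift]

theorem excess_shift (h : ℝ) (F : Plane → ℝ≥0∞) (τ : ℝ≥0∞) :
    excess (shift h F) τ = excess F τ :=
  lintegral_shift h fun x => F x - τ

theorem shift_shift (h h' : ℝ) (F : Plane → ℝ≥0∞) : shift h (shift h' F) = shift (h + h') F := by
  funext x; simp [shift, add_assoc]

theorem shift_zero (F : Plane → ℝ≥0∞) : shift 0 F = F := by
  funext x; simp [shift, show ((0 : ℝ), (0 : ℝ)) = (0 : Plane) from rfl]

/-! ### Bounded vortex patches -/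

/-- Measurable functions `0 ≤ F ≤ M` of mass at most `m`, vanishing off the domain. -/
structure Patch (s : ℝ) (M m : ℝ≥0) (F : Plane → ℝ≥0∞) : Prop where
  meas : Measurable F
  le : ∀ x, F x ≤ M
  off : ∀ x, x ∉ domain s → F x = 0
  mass : ∫⁻ x, F x ≤ m

variable {s : ℝ} {M m : ℝ≥0} {F G : Plane → ℝ≥0∞}

theorem domain_subset_halfPlane (s : ℝ) : domain s ⊆ halfPlane := fun x hx => by
  simp only [domain, mem_ofPred_eq] at hx
  simp only [halfPlane, mem_ofPred_eq]
  split_ifs at hx <;> linarith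

theorem Patch.of_le (hG : Patch s M m G) (hF : Measurable F) (h : F ≤ G) : Patch s M m F where
  meas := hF
  le x := (h x).trans (hG.le x)
  off x hx := le_antisymm ((h x).trans_eq (hG.off x hx)) bot_le
  mass := (lintegral_mono h).trans hG.mass

theorem Patch.indicator (hF : Patch s M m F) {A : Set Plane} (hA : MeasurableSet A) :
    Patch s M m (A.indicator F) :=
  hF.of_le (hF.meas.indicator hA) (indicator_le_self' fun _ _ => bot_le)

theorem Patch.shift (hF : Patch s M m F) (h : ℝ) : Patch s M m (shift h F) where
  meas := measurable_shift hF.meas h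
  le x := hF.le _
  off x hx := hF.off _ (by simpa [domain] using hx)
  mass := (lintegral_shift h F).le.trans hF.mass

/-- A bound for potentials of patches. -/
def potBound (s : ℝ) (M m : ℝ≥0) : ℝ≥0∞ :=
  ENNReal.ofReal (cs s) * (M * rieszMass (2 - 2 * s) 1 + m + m)

theorem potBound_ne_top (hs0 : 0 < s) (hs1 : s < 1) (M m : ℝ≥0) : potBound s M m ≠ ⊤ := by
  have := rieszMass_ne_top (p := 2 - 2 * s) (by linarith) (by linarith) 1
  unfold potBound
  finiteness

theorem pot_le_riesz (hs0 : 0 < s) (hs1 : s < 1) (hF : Measurable F) (x : Plane) :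
    pot s F x ≤ ENNReal.ofReal (cs s) * ∫⁻ y, riesz (2 - 2 * s) (x - y) * F y := by
  have hr : Measurable fun y => riesz (2 - 2 * s) (x - y) :=
    (measurable_riesz _).comp (measurable_const.sub measurable_id)
  rw [← lintegral_const_mul _ (hr.fun_mul hF)]
  refine lintegral_mono fun y => ?_
  rw [← mul_assoc]
  gcongr
  exact kern_le hs0 hs1 x y

theorem Patch.pot_le (hF : Patch s M m F) (hs0 : 0 < s) (hs1 : s < 1) (x : Plane) :
    pot s F x ≤ potBound s M m := by
  refine (pot_le_riesz hs0 hs1 hF.meas x).trans ?_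
  unfold potBound
  gcongr
  refine (lintegral_riesz_mul_le (by linarith) one_pos one_pos hF.meas hF.le x).trans ?_
  simp only [Real.one_rpow, ENNReal.ofReal_one, one_mul]
  gcongr
  · exact (setLIntegral_le_lintegral _ _).trans hF.mass
  · exact hF.mass

theorem Patch.bil_le (hG : Patch s M m G) (hs0 : 0 < s) (hs1 : s < 1) (hF : Measurable F) :
    bil s F G ≤ potBound s M m * ∫⁻ x, F x := by
  rw [← lintegral_const_mul _ hF]
  refine lintegral_mono fun x => ?_
  rw [mul_comm]
  gcongr
  exact hG.pot_le hs0 hs1 x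

theorem Patch.bil_le' (hF : Patch s M m F) (hG : Patch s M m G) (hs0 : 0 < s) (hs1 : s < 1) :
    bil s F G ≤ potBound s M m * m :=
  (hG.bil_le hs0 hs1 hF.meas).trans (by gcongr; exact hF.mass)

theorem Patch.bil_ne_top (hF : Patch s M m F) (hG : Patch s M m G) (hs0 : 0 < s) (hs1 : s < 1) :
    bil s F G ≠ ⊤ :=
  ne_top_of_le_ne_top (ENNReal.mul_ne_top (potBound_ne_top hs0 hs1 M m) ENNReal.coe_ne_top)
    (hF.bil_le' hG hs0 hs1)

/-- Small mass in all strips of a given width makes Riesz potentials small. -/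
theorem exists_strip_lintegral_riesz_le {p : ℝ} (hp0 : 0 < p) (hp : p < 2) {c : ℝ≥0∞} (hc : c ≠ ⊤)
    (M m : ℝ≥0) {e : ℝ≥0∞} (he : e ≠ 0) :
    ∃ R : ℝ, 0 < R ∧ ∃ σ : ℝ≥0∞, σ ≠ 0 ∧ ∀ F : Plane → ℝ≥0∞, Measurable F → (∀ x, F x ≤ M) →
      ∫⁻ x, F x ≤ m → ∀ x, ∫⁻ y in strip x.2 R, F y ≤ σ →
        c * ∫⁻ y, riesz p (x - y) * F y ≤ e := by
  -- Each range of the kernel gets a third of the tolerance: `ρ` controls the singularity, `R` the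
  -- far range, `σ` the range between. Vanishing `c`, `M` or `m` is harmless, since division by zero
  -- gives `⊤` and `ENNReal.mul_div_le` needs no condition.
  set e₁ := e / c / 3 with he₁
  have he₁0 : e₁ ≠ 0 := ENNReal.div_ne_zero.2 ⟨ENNReal.div_ne_zero.2 ⟨he, hc⟩, by simp⟩
  obtain ⟨ρ, hρ, hρe⟩ := exists_rieszMass_le hp0 hp
    (ε := e₁ / M) (ENNReal.div_ne_zero.2 ⟨he₁0, ENNReal.coe_ne_top⟩)
  have hlim : Tendsto (fun R : ℝ => ENNReal.ofReal (R ^ (-p))) atTop (𝓝 0) := by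
    simpa using ENNReal.tendsto_ofReal (tendsto_rpow_neg_atTop hp0)
  have hpos : 0 < e₁ / m := pos_iff_ne_zero.2 (ENNReal.div_ne_zero.2 ⟨he₁0, ENNReal.coe_ne_top⟩)
  obtain ⟨R, hRe, hR⟩ := ((hlim.eventually_lt_const hpos).and (eventually_gt_atTop 0)).exists
  refine ⟨R, hR, e₁ / ENNReal.ofReal (ρ ^ (-p)),
    ENNReal.div_ne_zero.2 ⟨he₁0, ENNReal.ofReal_ne_top⟩, fun F hF hM hm x hx => ?_⟩
  calc c * ∫⁻ y, riesz p (x - y) * F y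
      ≤ c * (e₁ + e₁ + e₁) := by
        gcongr
        refine (lintegral_riesz_mul_le hp0 hρ hR hF hM x).trans ?_
        gcongr
        · exact (mul_le_mul_right hρe _).trans ENNReal.mul_div_le
        · exact (mul_le_mul_right hx _).trans ENNReal.mul_div_le
        · calc ENNReal.ofReal (R ^ (-p)) * ∫⁻ y, F y ≤ e₁ / m * m := by gcongr
            _ ≤ e₁ := (by rw [mul_comm]; exact ENNReal.mul_div_le)
    _ = c * (e / c) := by rw [he₁, ENNReal.add_thirds]
    _ ≤ e := ENNReal.mul_div_le

/-- Patches of large energy have mass in some strip. -/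
theorem exists_strip_mass_of_le_bil (hs0 : 0 < s) (hs1 : s < 1) (M m : ℝ≥0) {d : ℝ≥0∞}
    (hd : d ≠ 0) (hd' : d ≠ ⊤) :
    ∃ R : ℝ, 0 < R ∧ ∃ σ : ℝ≥0∞, σ ≠ 0 ∧ ∀ F : Plane → ℝ≥0∞, Patch s M m F → d ≤ bil s F F →
      ∃ a : ℝ, σ ≤ ∫⁻ y in strip a R, F y := by
  obtain ⟨R, hR, σ, hσ, H⟩ := exists_strip_lintegral_riesz_le (p := 2 - 2 * s) (by linarith)
    (by linarith) (c := ENNReal.ofReal (cs s)) ENNReal.ofReal_ne_top M m (e := d / 2 / m)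
    (ENNReal.div_ne_zero.2 ⟨ENNReal.div_ne_zero.2 ⟨hd, by simp⟩, ENNReal.coe_ne_top⟩)
  refine ⟨R, hR, σ, hσ, fun F hF hdF => ?_⟩
  -- If every strip had mass below `σ`, the potential would be at most `d / 2 / m` everywhere and
  -- the form at most `d / 2`.
  by_contra! hcon
  have h1 : ∀ x, pot s F x ≤ d / 2 / m := fun x =>
    (pot_le_riesz hs0 hs1 hF.meas x).trans (H F hF.meas hF.le hF.mass x (hcon x.2).le)
  have h2 : bil s F F ≤ d / 2 := by
    calc bil s F F ≤ ∫⁻ x, d / 2 / m * F x :=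
          lintegral_mono fun x => by rw [mul_comm]; gcongr; exact h1 x
      _ = d / 2 / m * ∫⁻ x, F x := lintegral_const_mul _ hF.meas
      _ ≤ d / 2 / m * m := by gcongr; exact hF.mass
      _ ≤ d / 2 := (by rw [mul_comm]; exact ENNReal.mul_div_le)
  exact absurd (hdF.trans h2) (not_le.2 (ENNReal.half_lt_self hd hd'))

/-! ### Boxes -/

/-- The open square of half-width `j`. -/
def box (j : ℝ) : Set Plane := {x | |x.1| < j ∧ |x.2| < j}

theorem measurableSet_box (j : ℝ) : MeasurableSet (box j) :=
  (measurableSet_lt (f := fun x : Plane => |x.1|) (by fun_prop) measurable_const).inter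
    (measurableSet_lt (f := fun x : Plane => |x.2|) (by fun_prop) measurable_const)

theorem volume_box_ne_top (j : ℝ) : volume (box j) ≠ ⊤ := by
  have : box j ⊆ Metric.ball (0 : Plane) j := fun x hx => by
    rw [mem_ball_zero_iff, Prod.norm_def]; exact max_lt hx.1 hx.2
  exact ((measure_mono this).trans_lt measure_ball_lt_top).ne

theorem box_subset_strip (j : ℝ) : box j ⊆ strip 0 j := fun x hx => by
  simpa [strip] using hx.2

theorem box_mono {i j : ℝ} (h : i ≤ j) : box i ⊆ box j := fun _ hx =>
  ⟨hx.1.trans_le h, hx.2.trans_le h⟩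

theorem exists_setLIntegral_compl_box_le {G : Plane → ℝ≥0∞} (hG : Measurable G)
    (hfin : ∫⁻ x, G x ≠ ⊤) {ε : ℝ≥0∞} (hε : ε ≠ 0) :
    ∃ j₀ : ℝ, 0 < j₀ ∧ ∀ j, j₀ ≤ j → ∫⁻ x in (box j)ᶜ, G x ≤ ε := by
  have hlim : Tendsto (fun n : ℕ => ∫⁻ x, (box n)ᶜ.indicator G x) atTop
      (𝓝 (∫⁻ _ : Plane, 0)) := by
    refine tendsto_lintegral_of_dominated_convergence G
      (fun n => hG.indicator (measurableSet_box _).compl)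
      (fun n => Eventually.of_forall fun x => indicator_le_self' (fun _ _ => bot_le) x) hfin
      (Eventually.of_forall fun x => ?_)
    obtain ⟨n₀, hn₀⟩ := exists_nat_gt (max |x.1| |x.2|)
    refine tendsto_const_nhds.congr' ((eventually_ge_atTop n₀).mono fun n hn => ?_)
    have hn' : (n₀ : ℝ) ≤ n := by exact_mod_cast hn
    refine (indicator_of_notMem (notMem_compl_iff.2 ?_) _).symm
    exact ⟨(le_max_left _ _).trans_lt (hn₀.trans_le hn'),
      (le_max_right _ _).trans_lt (hn₀.trans_le hn')⟩
  rw [lintegral_zero] at hlim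
  obtain ⟨n, hn, hn0⟩ := ((hlim.eventually_lt_const (pos_iff_ne_zero.2 hε)).and
    (eventually_gt_atTop 0)).exists
  refine ⟨n, by exact_mod_cast hn0, fun j hj => ?_⟩
  rw [lintegral_indicator (measurableSet_box _).compl] at hn
  exact (lintegral_mono_set (compl_subset_compl.2 (box_mono hj))).trans hn.le

/-- Far from the origin in the vertical direction the potential is small compared with `x₁`. -/
theorem Patch.exists_pot_le (hF : Patch s M m F) (hs0 : 0 < s) (hs1 : s < 1) {w : ℝ}
    (hw : 0 < w) : ∃ L₀ : ℝ, ∀ L, L₀ ≤ L → ∀ x ∈ domain s, x ∉ strip 0 L →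
      pot s F x ≤ ENNReal.ofReal w * ENNReal.ofReal x.1 := by
  -- The strip of half-width `R` around a vertically remote point misses the box that carries all
  -- but `σ` of the mass.
  have key : ∀ p : ℝ, 0 < p → p < 2 → ∀ c : ℝ≥0∞, c ≠ ⊤ → ∃ L₀ : ℝ, ∀ L, L₀ ≤ L → ∀ x,
      x ∉ strip 0 L → c * ∫⁻ y, riesz p (x - y) * F y ≤ ENNReal.ofReal w := by
    intro p hp0 hp c hc
    obtain ⟨R, hR, σ, hσ, H⟩ := exists_strip_lintegral_riesz_le hp0 hp hc M m
      (e := ENNReal.ofReal w) (by simpa using hw)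
    obtain ⟨j, hj, hj'⟩ := exists_setLIntegral_compl_box_le hF.meas
      (ne_top_of_le_ne_top ENNReal.coe_ne_top hF.mass) hσ
    refine ⟨j + R, fun L hL x hx => H F hF.meas hF.le hF.mass x ?_⟩
    refine (lintegral_mono_set fun y hy hyb => ?_).trans (hj' j le_rfl)
    simp only [strip, mem_ofPred_eq, sub_zero, not_lt] at hx hy
    have h1 := hyb.2
    have h2 := abs_sub_abs_le_abs_sub x.2 y.2
    rw [abs_sub_comm] at h2
    linarith
  -- For `s > 1/2` the domain reaches the boundary, and the factor `x₁` comes from cancellation in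
  -- the kernel, whose exponent `3 - 2s` is still below two. Otherwise `x₁ ≥ 1` on the domain and no
  -- cancellation is needed.
  by_cases hs : 1 / 2 < s
  · obtain ⟨L₀, h⟩ := key (3 - 2 * s) (by linarith) (by linarith) (ENNReal.ofReal (2 * cs s))
      ENNReal.ofReal_ne_top
    refine ⟨L₀, fun L hL x hxD hx => ?_⟩
    have hx1 : 0 < x.1 := domain_subset_halfPlane s hxD
    have hc := cs_pos hs0 hs1
    have hr : Measurable fun y => riesz (3 - 2 * s) (x - y) :=
      (measurable_riesz _).comp (measurable_const.sub measurable_id)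
    calc pot s F x
        ≤ ∫⁻ y, ENNReal.ofReal (2 * cs s * x.1) * (riesz (3 - 2 * s) (x - y) * F y) := by
          refine lintegral_mono fun y => ?_
          by_cases hy : y ∈ domain s
          · rw [← mul_assoc]
            gcongr
            exact kern_le_fst hs hs1 hx1 (domain_subset_halfPlane s hy)
          · simp [hF.off y hy]
      _ = ENNReal.ofReal (2 * cs s) * (∫⁻ y, riesz (3 - 2 * s) (x - y) * F y)
            * ENNReal.ofReal x.1 := by
          rw [lintegral_const_mul _ (hr.fun_mul hF.meas), ENNReal.ofReal_mul (by positivity)]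
          ring
      _ ≤ _ := by gcongr; exact h L hL x hx
  · obtain ⟨L₀, h⟩ := key (2 - 2 * s) (by linarith) (by linarith) (ENNReal.ofReal (cs s))
      ENNReal.ofReal_ne_top
    refine ⟨L₀, fun L hL x hxD hx => (pot_le_riesz hs0 hs1 hF.meas x).trans
      ((h L hL x hx).trans ?_)⟩
    simp only [domain, hs, if_false, mem_ofPred_eq] at hxD
    calc ENNReal.ofReal w = ENNReal.ofReal w * ENNReal.ofReal 1 := by simp
      _ ≤ _ := by gcongr

/-- The interaction of two functions separated by a horizontal strip. -/
theorem bil_le_of_separated (hs0 : 0 < s) (hs1 : s < 1) (hF : Measurable F) (hG : Measurable G)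
    {r R : ℝ} (hrR : r < R) (hFr : ∀ x ∉ strip 0 r, F x = 0) (hGR : ∀ x ∈ strip 0 R, G x = 0) :
    bil s F G ≤ ENNReal.ofReal (cs s) * ENNReal.ofReal ((R - r) ^ (-(2 - 2 * s))) *
      (∫⁻ x, G x) * ∫⁻ x, F x := by
  set c := ENNReal.ofReal (cs s) * ENNReal.ofReal ((R - r) ^ (-(2 - 2 * s)))
  rw [← lintegral_const_mul _ hF]
  refine lintegral_mono fun x => ?_
  by_cases hx : x ∈ strip 0 r
  · rw [mul_comm]
    gcongr
    rw [← lintegral_const_mul _ hG]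
    refine lintegral_mono fun y => ?_
    by_cases hy : y ∈ strip 0 R
    · simp [hGR y hy]
    · gcongr
      refine (kern_le hs0 hs1 x y).trans ?_
      refine mul_le_mul_right (ENNReal.ofReal_le_ofReal ?_) _
      refine Real.rpow_le_rpow_of_nonpos (sub_pos.2 hrR) ?_ (by linarith)
      simp only [strip, mem_ofPred_eq, sub_zero, not_lt] at hx hy
      have h2 := abs_sub_abs_le_abs_sub y.2 x.2
      rw [abs_sub_comm] at h2
      have := abs_snd_le_euclLen (x - y)
      simp only [Prod.snd_sub] at this
      linarith
  · simp [hFr x hx]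

end

section

/-! ### Weak convergence -/

/-- Bounded sequences in separable Hilbert spaces have weakly convergent subsequences. -/
theorem exists_subseq_tendsto_inner {H : Type*} [NormedAddCommGroup H] [InnerProductSpace ℝ H]
    [CompleteSpace H] [TopologicalSpace.SeparableSpace H] {u : ℕ → H} {r : ℝ}
    (hu : ∀ n, ‖u n‖ ≤ r) :
    ∃ a : H, ∃ φ : ℕ → ℕ, StrictMono φ ∧
      ∀ g, Tendsto (fun n => inner ℝ (u (φ n)) g) atTop (𝓝 (inner ℝ a g)) := by
  obtain ⟨a, -, φ, hφ, hlim⟩ := WeakDual.isSeqCompact_closedBall ℝ H 0 r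
    (x := fun n => StrongDual.toWeakDual (InnerProductSpace.toDual ℝ H (u n))) (fun n => by
      simpa using hu n)
  refine ⟨(InnerProductSpace.toDual ℝ H).symm (WeakDual.toStrongDual a), φ, hφ, fun g => ?_⟩
  have h := ((WeakDual.eval_continuous (𝕜 := ℝ) g).tendsto a).comp hlim
  simpa [Function.comp_def] using h

/-- Weak `L²` convergence of `[0, ∞]`-valued functions. -/
def WeakTendsto (F : ℕ → Plane → ℝ≥0∞) (A : Plane → ℝ≥0∞) : Prop :=
  ∀ g : Plane → ℝ≥0∞, Measurable g → ∫⁻ x, g x ^ 2 ≠ ⊤ →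
    Tendsto (fun n => ∫⁻ x, g x * F n x) atTop (𝓝 (∫⁻ x, g x * A x))

variable {s : ℝ} {M m : ℝ≥0} {F : ℕ → Plane → ℝ≥0∞} {A : Plane → ℝ≥0∞}

theorem lintegral_sq_indicator_ne_top {g : Plane → ℝ≥0∞} {S : Set Plane} (hS : MeasurableSet S)
    {j : ℝ} (hSj : S ⊆ box j) {C : ℝ≥0∞} (hC : C ≠ ⊤) (hg : ∀ x ∈ S, g x ≤ C) :
    ∫⁻ x, S.indicator g x ^ 2 ≠ ⊤ := by
  have h1 : ∀ x, S.indicator g x ^ 2 ≤ S.indicator (fun _ => C ^ 2) x := fun x => by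
    by_cases hx : x ∈ S
    · simp only [indicator_of_mem hx]; gcongr; exact hg x hx
    · simp [hx]
  refine ne_top_of_le_ne_top ?_ (lintegral_mono h1)
  rw [lintegral_indicator hS, setLIntegral_const]
  exact ENNReal.mul_ne_top (ENNReal.pow_ne_top hC)
    (ne_top_of_le_ne_top (volume_box_ne_top j) (measure_mono hSj))

theorem WeakTendsto.setLIntegral (h : WeakTendsto F A) {g : Plane → ℝ≥0∞} (hgm : Measurable g)
    {S : Set Plane} (hS : MeasurableSet S) {j : ℝ} (hSj : S ⊆ box j) {C : ℝ≥0∞} (hC : C ≠ ⊤)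
    (hg : ∀ x ∈ S, g x ≤ C) :
    Tendsto (fun n => ∫⁻ x in S, g x * F n x) atTop (𝓝 (∫⁻ x in S, g x * A x)) := by
  have := h (S.indicator g) (hgm.indicator hS) (lintegral_sq_indicator_ne_top hS hSj hC hg)
  have e : ∀ G : Plane → ℝ≥0∞, ∫⁻ x, S.indicator g x * G x = ∫⁻ x in S, g x * G x := fun G => by
    rw [← lintegral_indicator hS]
    congr 1; funext x
    by_cases hx : x ∈ S <;> simp [hx]
  simpa only [e] using this

theorem WeakTendsto.setLIntegral_one (h : WeakTendsto F A) {S : Set Plane} (hS : MeasurableSet S)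
    {j : ℝ} (hSj : S ⊆ box j) :
    Tendsto (fun n => ∫⁻ x in S, F n x) atTop (𝓝 (∫⁻ x in S, A x)) := by
  simpa using h.setLIntegral (g := fun _ => 1) measurable_const hS hSj ENNReal.one_ne_top
    (fun _ _ => le_rfl)

theorem iUnion_box : ⋃ n : ℕ, box n = univ := by
  refine eq_univ_of_forall fun x => mem_iUnion.2 ?_
  obtain ⟨n, hn⟩ := exists_nat_gt (max |x.1| |x.2|)
  exact ⟨n, (le_max_left _ _).trans_lt hn, (le_max_right _ _).trans_lt hn⟩

theorem lintegral_le_of_forall_box {G : Plane → ℝ≥0∞} {K : ℝ≥0∞}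
    (h : ∀ n : ℕ, ∫⁻ x in box n, G x ≤ K) : ∫⁻ x, G x ≤ K := by
  rw [← setLIntegral_univ, ← iUnion_box, setLIntegral_iUnion_of_directed]
  · exact iSup_le h
  · exact Monotone.directed_le (f := fun n : ℕ => box (n : ℝ)) fun a b hab =>
      box_mono (by exact_mod_cast hab)

/-- The weight need not be square integrable on the plane. It is tested on boxes, where it is
bounded, and the boxes are then exhausted monotonically. -/
theorem WeakTendsto.lintegral_le (h : WeakTendsto F A) {g : Plane → ℝ≥0∞} (hg : Measurable g)
    (hb : ∀ j : ℝ, ∃ C : ℝ≥0∞, C ≠ ⊤ ∧ ∀ x ∈ box j, g x ≤ C) {K : ℝ≥0∞}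
    (hK : ∀ n, ∫⁻ x, g x * F n x ≤ K) : ∫⁻ x, g x * A x ≤ K := by
  refine lintegral_le_of_forall_box fun j => ?_
  obtain ⟨C, hC, hgC⟩ := hb j
  exact le_of_tendsto' (h.setLIntegral hg (measurableSet_box j) subset_rfl hC hgC) fun n =>
    (setLIntegral_le_lintegral _ _).trans (hK n)

theorem WeakTendsto.imp_le (h : WeakTendsto F A) {K : ℝ≥0∞} (hK : ∀ n, imp (F n) ≤ K) :
    imp A ≤ K :=
  h.lintegral_le measurable_fst.ennreal_ofReal
    (fun j => ⟨ENNReal.ofReal j, ENNReal.ofReal_ne_top, fun _ hx =>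
      ENNReal.ofReal_le_ofReal ((le_abs_self _).trans hx.1.le)⟩) hK

theorem measurableSet_domain (s : ℝ) : MeasurableSet (domain s) := by
  unfold domain
  split_ifs
  · exact measurableSet_lt measurable_const measurable_fst
  · exact measurableSet_le measurable_const measurable_fst

theorem Patch.ne_top {F : Plane → ℝ≥0∞} (hF : Patch s M m F) (x : Plane) : F x ≠ ⊤ :=
  ne_top_of_le_ne_top ENNReal.coe_ne_top (hF.le x)

theorem Patch.lintegral_ne_top {F : Plane → ℝ≥0∞} (hF : Patch s M m F) : ∫⁻ x, F x ≠ ⊤ :=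
  ne_top_of_le_ne_top ENNReal.coe_ne_top hF.mass

theorem Patch.integrable {F : Plane → ℝ≥0∞} (hF : Patch s M m F) :
    Integrable fun x => (F x).toReal :=
  integrable_toReal_of_lintegral_ne_top hF.meas.aemeasurable hF.lintegral_ne_top

theorem Patch.integral_toReal_le {F : Plane → ℝ≥0∞} (hF : Patch s M m F) :
    ∫ x, (F x).toReal ≤ m := by
  rw [integral_toReal hF.meas.aemeasurable (Eventually.of_forall fun x => (hF.ne_top x).lt_top)]
  exact ENNReal.toReal_le_coe_of_le_coe hF.mass

theorem Patch.toReal_le {F : Plane → ℝ≥0∞} (hF : Patch s M m F) (x : Plane) :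
    (F x).toReal ≤ M := ENNReal.toReal_le_coe_of_le_coe (hF.le x)

theorem Patch.integrable_sq {F : Plane → ℝ≥0∞} (hF : Patch s M m F) :
    Integrable fun x => (F x).toReal ^ 2 := by
  refine (hF.integrable.const_mul (M : ℝ)).mono' 
    (hF.meas.ennreal_toReal.pow_const 2).aestronglyMeasurable (Eventually.of_forall fun x => ?_)
  rw [Real.norm_of_nonneg (by positivity), sq]
  gcongr
  exact hF.toReal_le x

theorem Patch.memLp_two {F : Plane → ℝ≥0∞} (hF : Patch s M m F) :
    MemLp (fun x => (F x).toReal) 2 :=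
  (memLp_two_iff_integrable_sq hF.integrable.aestronglyMeasurable).2 hF.integrable_sq

theorem inner_toLp {f g : Plane → ℝ} (hf : MemLp f 2) (hg : MemLp g 2) :
    inner ℝ (hf.toLp f) (hg.toLp g) = ∫ x, f x * g x := by
  rw [L2.inner_def]
  refine integral_congr_ae ?_
  filter_upwards [hf.coeFn_toLp, hg.coeFn_toLp] with x h1 h2
  simp [h1, h2, mul_comm]

theorem Patch.norm_toLp_le {F : Plane → ℝ≥0∞} (hF : Patch s M m F) :
    ‖hF.memLp_two.toLp _‖ ≤ Real.sqrt (M * m) := by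
  refine Real.le_sqrt_of_sq_le ?_
  rw [← real_inner_self_eq_norm_sq, inner_toLp]
  calc ∫ x, (F x).toReal * (F x).toReal ≤ ∫ x, M * (F x).toReal := by
        refine integral_mono_ae (by simpa only [sq] using hF.integrable_sq)
          (hF.integrable.const_mul _) (Eventually.of_forall fun x => ?_)
        dsimp only
        gcongr
        exact hF.toReal_le x
    _ ≤ M * m := by
        rw [integral_const_mul]
        gcongr
        exact hF.integral_toReal_le

theorem memLp_two_toReal {g : Plane → ℝ≥0∞} (hg : Measurable g) (h2 : ∫⁻ x, g x ^ 2 ≠ ⊤) :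
    MemLp (fun x => (g x).toReal) 2 := by
  rw [memLp_two_iff_integrable_sq hg.ennreal_toReal.aestronglyMeasurable]
  have := integrable_toReal_of_lintegral_ne_top (hg.pow_const 2).aemeasurable h2
  simpa only [ENNReal.toReal_pow] using this

/-- Rewrites a `[0, ∞]`-valued test integral as an `L²` pairing of real functions, so that weak
compactness in the Hilbert space applies. -/
theorem lintegral_mul_eq_ofReal {g A : Plane → ℝ≥0∞} {a : Plane → ℝ} (hg : Measurable g)
    (h2 : ∫⁻ x, g x ^ 2 ≠ ⊤) (ha : MemLp a 2) (ha0 : 0 ≤ᵐ[volume] a)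
    (hA : A =ᵐ[volume] fun x => ENNReal.ofReal (a x)) :
    ∫⁻ x, g x * A x = ENNReal.ofReal (∫ x, a x * (g x).toReal) := by
  have hi : Integrable fun x => a x * (g x).toReal := ha.integrable_mul (memLp_two_toReal hg h2)
  rw [ofReal_integral_eq_lintegral_ofReal hi
    (by filter_upwards [ha0] with x hx using mul_nonneg hx ENNReal.toReal_nonneg)]
  refine lintegral_congr_ae ?_
  filter_upwards [hA, ae_lt_top (hg.pow_const 2) h2, ha0] with x h1 h3 h4
  have : g x ≠ ⊤ := by
    intro h; simp [h] at h3
  rw [h1, ENNReal.ofReal_mul h4, ENNReal.ofReal_toReal this, mul_comm]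

/-- Sequences of patches have weakly convergent subsequences, and the limit is a patch. -/
theorem exists_weakTendsto (hF : ∀ n, Patch s M m (F n)) :
    ∃ φ : ℕ → ℕ, StrictMono φ ∧ ∃ A, Patch s M m A ∧ WeakTendsto (fun n => F (φ n)) A := by
  have : Fact ((2 : ℝ≥0∞) ≠ ⊤) := ⟨ENNReal.ofNat_ne_top⟩
  obtain ⟨a, φ, hφ, hlim⟩ := exists_subseq_tendsto_inner
    (u := fun n => (hF n).memLp_two.toLp _) (fun n => (hF n).norm_toLp_le)
  have ha : MemLp a 2 := Lp.memLp a
  have hlim' : ∀ g : Plane → ℝ, MemLp g 2 →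
      Tendsto (fun n => ∫ x, (F (φ n) x).toReal * g x) atTop (𝓝 (∫ x, a x * g x)) := by
    intro g hg
    have h := hlim (hg.toLp g)
    have ea : inner ℝ a (hg.toLp g) = ∫ x, a x * g x := by
      rw [← inner_toLp ha hg, Lp.toLp_coeFn a ha]
    simpa only [inner_toLp, ea] using h
  -- Testing against the negative part of `a` gives minus the integral of its square, yet the limit
  -- is nonnegative.
  have ha0 : 0 ≤ᵐ[volume] a := by
    have hneg := ha.neg_part
    have h0 : 0 ≤ ∫ x, a x * max (-a x) 0 := ge_of_tendsto' (hlim' _ hneg) fun n =>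
      integral_nonneg fun x => mul_nonneg ENNReal.toReal_nonneg (le_max_right _ _)
    have e : ∀ x, a x * max (-a x) 0 = -(max (-a x) 0 ^ 2) := fun x => by
      rcases le_total (-a x) 0 with h | h
      · simp [max_eq_right h]
      · rw [max_eq_left h]; ring
    simp only [e, integral_neg] at h0
    have h1 : ∫ x, max (-a x) 0 ^ 2 = 0 :=
      le_antisymm (by linarith) (integral_nonneg fun x => by positivity)
    rw [integral_eq_zero_iff_of_nonneg (fun x => by positivity) hneg.integrable_sq] at h1
    filter_upwards [h1] with x hx
    have hx' : max (-a x) 0 = 0 := by simpa using hx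
    have := le_max_left (-a x) 0
    simp only [Pi.zero_apply]
    linarith
  set A₁ : Plane → ℝ≥0∞ := fun x => ENNReal.ofReal (a x) with hA₁
  have hA₁m : Measurable A₁ := (Lp.stronglyMeasurable a).measurable.ennreal_ofReal
  have hw : WeakTendsto (fun n => F (φ n)) A₁ := by
    intro g hg h2
    rw [lintegral_mul_eq_ofReal hg h2 ha ha0 (ae_eq_refl _)]
    have e : ∀ n, ∫⁻ x, g x * F (φ n) x
        = ENNReal.ofReal (∫ x, (F (φ n) x).toReal * (g x).toReal) := fun n =>
      lintegral_mul_eq_ofReal hg h2 (hF _).memLp_two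
        (Eventually.of_forall fun x => ENNReal.toReal_nonneg)
        (Eventually.of_forall fun x => (ENNReal.ofReal_toReal ((hF _).ne_top x)).symm)
    simp only [e]
    exact ENNReal.tendsto_ofReal (hlim' _ (memLp_two_toReal hg h2))
  -- Test on the part of `{A₁ > M}` in a box: if it had positive measure, the integral of `A₁` over
  -- it would strictly exceed the bound inherited from the sequence.
  have hle : ∀ᵐ x, A₁ x ≤ M := by
    have hS : ∀ j : ℕ, MeasurableSet ({x | (M : ℝ≥0∞) < A₁ x} ∩ box j) := fun j =>
      (measurableSet_lt measurable_const hA₁m).inter (measurableSet_box _)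
    have h0 : ∀ j : ℕ, volume ({x | (M : ℝ≥0∞) < A₁ x} ∩ box j) = 0 := by
      intro j
      have h1 : ∫⁻ x in {x | (M : ℝ≥0∞) < A₁ x} ∩ box j, A₁ x
          ≤ ∫⁻ x in {x | (M : ℝ≥0∞) < A₁ x} ∩ box j, M :=
        le_of_tendsto' (hw.setLIntegral_one (hS j) inter_subset_right) fun n =>
          lintegral_mono fun x => (hF _).le x
      by_contra hne
      have hfin : volume ({x | (M : ℝ≥0∞) < A₁ x} ∩ box j) ≠ ⊤ :=
        ne_top_of_le_ne_top (volume_box_ne_top j) (measure_mono inter_subset_right)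
      refine absurd h1 (not_le.2 (setLIntegral_strict_mono (hS j) hne hA₁m ?_
        (Eventually.of_forall fun x hx => hx.1)))
      rw [setLIntegral_const]
      exact ENNReal.mul_ne_top ENNReal.coe_ne_top hfin
    have h1 : volume {x | (M : ℝ≥0∞) < A₁ x} = 0 := by
      rw [← inter_univ {x | (M : ℝ≥0∞) < A₁ x}, ← iUnion_box, inter_iUnion]
      exact measure_iUnion_null h0
    rw [ae_iff]
    simpa only [not_le] using h1
  have hoff : ∀ᵐ x, x ∉ domain s → A₁ x = 0 := by
    have h0 : ∫⁻ x, (domain s)ᶜ.indicator (fun _ => 1) x * A₁ x ≤ 0 := by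
      refine hw.lintegral_le (measurable_const.indicator (measurableSet_domain s).compl)
        (fun j => ⟨1, ENNReal.one_ne_top, fun x _ =>
          indicator_le_self' (f := fun _ => (1 : ℝ≥0∞)) (fun _ _ => bot_le) x⟩) fun n => ?_
      refine (lintegral_mono fun x => ?_).trans_eq lintegral_zero
      by_cases hx : x ∈ domain s
      · simp [hx]
      · simp [(hF _).off x hx]
    have h1 := (lintegral_eq_zero_iff
      ((measurable_const.indicator (measurableSet_domain s).compl).mul hA₁m)).1 (le_antisymm h0 bot_le)
    filter_upwards [h1] with x hx hxD
    simpa [hxD] using hx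
  have hmass : ∫⁻ x, A₁ x ≤ m := by
    simpa using hw.lintegral_le (g := fun _ => 1) measurable_const
      (fun _ => ⟨1, ENNReal.one_ne_top, fun _ _ => le_rfl⟩) (K := m)
      (fun n => by simpa using (hF _).mass)
  -- A null set is corrected, because `Patch` asks for its bounds at every point.
  set A : Plane → ℝ≥0∞ := (domain s).indicator fun x => min M (A₁ x) with hA
  have hAA : A =ᵐ[volume] A₁ := by
    filter_upwards [hle, hoff] with x h1 h2
    by_cases hx : x ∈ domain s
    · simp [hA, hx, h1]
    · simp [hA, hx, h2 hx]
  refine ⟨φ, hφ, A, ⟨(measurable_const.min hA₁m).indicator (measurableSet_domain s), fun x => ?_,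
    fun x hx => indicator_of_notMem hx _, (lintegral_congr_ae hAA).le.trans hmass⟩, ?_⟩
  · exact (indicator_le_self' (fun _ _ => bot_le) x).trans (min_le_left _ _)
  · intro g hg h2
    have : ∫⁻ x, g x * A x = ∫⁻ x, g x * A₁ x :=
      lintegral_congr_ae (by filter_upwards [hAA] with x hx; rw [hx])
    rw [this]
    exact hw g hg h2

end

section

/-! ### Splitting of weakly convergent sequences -/

variable {s : ℝ} {M m : ℝ≥0} {F : ℕ → Plane → ℝ≥0∞} {A : Plane → ℝ≥0∞}

theorem eventually_le_add_of_tendsto {u : ℕ → ℝ≥0∞} {a : ℝ≥0∞} (h : Tendsto u atTop (𝓝 a))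
    (ha : a ≠ ⊤) {ε : ℝ≥0∞} (hε : ε ≠ 0) : ∀ᶠ n in atTop, a ≤ u n + ε ∧ u n ≤ a + ε := by
  filter_upwards [(ENNReal.tendsto_nhds ha).1 h ε (pos_iff_ne_zero.2 hε)] with n hn
  exact ⟨tsub_le_iff_right.1 hn.1, hn.2⟩

/-- Lower semicontinuity of a convex functional. On `S`, where `A > τ`, the excess of `A` is the
linear quantity `∫ A - τ |S|`, which passes to the weak limit. For `F n` the same linear quantity
only bounds the excess from below. -/
theorem eventually_setLIntegral_sub_le (hA : Patch s M m A) (hw : WeakTendsto F A)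
    (j : ℝ) {τ : ℝ≥0∞} (hτ : τ ≠ ⊤) {ε : ℝ≥0∞} (hε : ε ≠ 0) :
    ∀ᶠ n in atTop, ∫⁻ x in box j, (A x - τ) ≤ (∫⁻ x in box j, (F n x - τ)) + ε := by
  set S := {x | τ < A x} ∩ box j with hSdef
  have hS : MeasurableSet S := (measurableSet_lt measurable_const hA.meas).inter
    (measurableSet_box j)
  have hvol : volume S ≠ ⊤ :=
    ne_top_of_le_ne_top (volume_box_ne_top j) (measure_mono inter_subset_right)
  filter_upwards [eventually_le_add_of_tendsto (hw.setLIntegral_one hS inter_subset_right)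
    (ne_top_of_le_ne_top hA.lintegral_ne_top (setLIntegral_le_lintegral _ _)) hε] with n hn
  have h1 : ∫⁻ x in box j, (A x - τ) = ∫⁻ x in S, (A x - τ) := by
    rw [← lintegral_indicator hS, ← lintegral_indicator (measurableSet_box j)]
    congr 1; funext x
    by_cases hx : x ∈ box j
    · by_cases hx' : τ < A x
      · rw [indicator_of_mem hx, indicator_of_mem (show x ∈ S from ⟨hx', hx⟩)]
      · rw [indicator_of_mem hx, indicator_of_notMem (fun h : x ∈ S => hx' h.1),
          tsub_eq_zero_of_le (not_lt.1 hx')]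
    · rw [indicator_of_notMem hx, indicator_of_notMem (fun h : x ∈ S => hx h.2)]
  have h2 : ∫⁻ x in S, A x = (∫⁻ x in S, (A x - τ)) + τ * volume S := by
    rw [← setLIntegral_const, ← lintegral_add_right _ measurable_const]
    refine setLIntegral_congr_fun hS fun x hx => ?_
    exact (tsub_add_cancel_of_le hx.1.le).symm
  have h3 : ∫⁻ x in S, F n x ≤ (∫⁻ x in S, (F n x - τ)) + τ * volume S := by
    rw [← setLIntegral_const, ← lintegral_add_right _ measurable_const]
    exact lintegral_mono fun x => le_tsub_add
  rw [h1]
  have h4 : (∫⁻ x in S, (A x - τ)) + τ * volume S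
      ≤ ((∫⁻ x in S, (F n x - τ)) + ε) + τ * volume S := by
    rw [← h2, add_right_comm]
    exact hn.1.trans (by gcongr)
  refine (ENNReal.add_le_add_iff_right (ENNReal.mul_ne_top hτ hvol)).1 h4 |>.trans ?_
  gcongr
  exact inter_subset_right

/-- Uniformity in the level: on the box the excess is Lipschitz in `τ` with constant the area of the
box, so a finite grid of mesh `δ` below `M` suffices. -/
theorem eventually_forall_setLIntegral_sub_le (hA : Patch s M m A) (hw : WeakTendsto F A)
    (j : ℝ) {ε : ℝ≥0∞} (hε : ε ≠ 0) :
    ∀ᶠ n in atTop, ∀ τ, ∫⁻ x in box j, (A x - τ) ≤ (∫⁻ x in box j, (F n x - τ)) + ε := by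
  have hε2 : ε / 2 ≠ 0 := ENNReal.div_ne_zero.2 ⟨hε, by simp⟩
  obtain ⟨δ, hδ0, hδ⟩ : ∃ δ : ℝ≥0, δ ≠ 0 ∧ δ * volume (box j) ≤ ε / 2 := by
    obtain ⟨δ, hδ0, hδ⟩ := ENNReal.lt_iff_exists_nnreal_btwn.1
      (pos_iff_ne_zero.2 (ENNReal.div_ne_zero.2 ⟨hε2, volume_box_ne_top j⟩))
    refine ⟨δ, by simpa using hδ0.ne', ?_⟩
    calc δ * volume (box j) ≤ ε / 2 / volume (box j) * volume (box j) := by gcongr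
      _ ≤ ε / 2 := by rw [mul_comm]; exact ENNReal.mul_div_le
  have hgrid : ∀ᶠ n in atTop, ∀ i ∈ Finset.range (⌊M / δ⌋₊ + 1),
      ∫⁻ x in box j, (A x - ((i * δ : ℝ≥0) : ℝ≥0∞))
        ≤ (∫⁻ x in box j, (F n x - ((i * δ : ℝ≥0) : ℝ≥0∞))) + ε / 2 :=
    (Filter.eventually_all_finset _).2 fun i _ =>
      eventually_setLIntegral_sub_le hA hw j ENNReal.coe_ne_top hε2
  filter_upwards [hgrid] with n hn τ
  by_cases hτ : M ≤ τ
  · have : ∀ x, A x - τ = 0 := fun x => tsub_eq_zero_of_le ((hA.le x).trans hτ)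
    simp [this]
  lift τ to ℝ≥0 using (ne_top_of_lt (not_le.1 hτ))
  have hτM : τ < M := by exact_mod_cast not_le.1 hτ
  set i := ⌊τ / δ⌋₊
  have hi : i ∈ Finset.range (⌊M / δ⌋₊ + 1) := by
    rw [Finset.mem_range, Nat.lt_succ_iff]
    exact Nat.floor_mono (by gcongr)
  have hi1 : i * δ ≤ τ := by
    rw [← le_div_iff₀ (pos_iff_ne_zero.2 hδ0)]
    exact Nat.floor_le (by positivity)
  have hi2 : τ ≤ δ + i * δ := by
    have := (Nat.lt_floor_add_one (τ / δ)).le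
    rw [div_le_iff₀ (pos_iff_ne_zero.2 hδ0), add_mul, one_mul, add_comm] at this
    exact this
  calc ∫⁻ x in box j, (A x - τ) ≤ ∫⁻ x in box j, (A x - ((i * δ : ℝ≥0) : ℝ≥0∞)) := by
        refine lintegral_mono fun x => tsub_le_tsub_left ?_ _
        exact ENNReal.coe_le_coe.2 hi1
    _ ≤ (∫⁻ x in box j, (F n x - ((i * δ : ℝ≥0) : ℝ≥0∞))) + ε / 2 := hn i hi
    _ ≤ (∫⁻ x in box j, ((F n x - τ) + δ)) + ε / 2 := by
        gcongr with x
        rw [tsub_le_iff_right, add_assoc]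
        refine le_tsub_add.trans (b := F n x - τ + τ) ?_
        gcongr
        exact_mod_cast hi2
    _ = (∫⁻ x in box j, (F n x - τ)) + δ * volume (box j) + ε / 2 := by
        rw [lintegral_add_right _ measurable_const, setLIntegral_const]
    _ ≤ (∫⁻ x in box j, (F n x - τ)) + ε / 2 + ε / 2 := by gcongr
    _ = _ := by rw [add_assoc, ENNReal.add_halves]

/-- The energy of the part in a box is upper semicontinuous under weak convergence. -/
theorem eventually_bil_box_le (hs0 : 0 < s) (hs1 : s < 1) (hA : Patch s M m A)
    (hw : WeakTendsto F A) (hF : ∀ n, Patch s M m (F n)) (j : ℝ) {ε : ℝ≥0∞} (hε : ε ≠ 0) :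
    ∀ᶠ n in atTop, bil s ((box j).indicator (F n)) ((box j).indicator (F n))
      ≤ bil s A A + ε := by
  have hε3 : ε / 3 ≠ 0 := ENNReal.div_ne_zero.2 ⟨hε, by simp⟩
  set c := ENNReal.ofReal (cs s)
  have hc : c * M * m ≠ ⊤ := by finiteness
  -- This radius makes the interaction near the diagonal, at most `c * M * m * rieszMass`, cost no
  -- more than `ε / 3`.
  obtain ⟨ρ, hρ, hρε⟩ := exists_rieszMass_le (p := 2 - 2 * s) (by linarith) (by linarith)
    (ε := ε / 3 / (c * M * m)) (ENNReal.div_ne_zero.2 ⟨hε3, hc⟩)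
  set b := box j with hb
  have hbm : MeasurableSet b := measurableSet_box j
  -- the kernel away from the diagonal
  set k : Plane → Plane → ℝ≥0∞ := fun x y => {p : Plane × Plane | euclLen (p.1 - p.2) < ρ}ᶜ.indicator
    (fun p => kern s p.1 p.2) (x, y) with hk
  have hkm : Measurable (Function.uncurry k) := by
    refine (measurable_kern s).indicator (MeasurableSet.compl ?_)
    exact measurableSet_lt (continuous_euclLen.measurable.comp (measurable_fst.sub measurable_snd))
      measurable_const
  have hkx : ∀ x, Measurable (k x) := fun x => Measurable.of_uncurry_left (f := k) hkm
  set κ := c * ENNReal.ofReal (ρ ^ (-(2 - 2 * s)))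
  have hκ : κ ≠ ⊤ := by finiteness
  have hkκ : ∀ x y, k x y ≤ κ := by
    intro x y
    by_cases hxy : euclLen (x - y) < ρ
    · simp [hk, hxy]
    · have : k x y = kern s x y := indicator_of_mem (by simpa using hxy) _
      rw [this]
      refine (kern_le hs0 hs1 x y).trans (mul_le_mul_right (ENNReal.ofReal_le_ofReal ?_) _)
      exact Real.rpow_le_rpow_of_nonpos hρ (not_lt.1 hxy) (by linarith)
  have hkk : ∀ x y, k x y ≤ kern s x y := fun x y =>
    indicator_le_self' (f := fun p : Plane × Plane => kern s p.1 p.2) (fun _ _ => bot_le) (x, y)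
  set u : (Plane → ℝ≥0∞) → Plane → ℝ≥0∞ := fun G x => ∫⁻ y in b, k x y * G y with hu
  have hum : ∀ G, Measurable G → Measurable (u G) := fun G hG =>
    Measurable.lintegral_prod_right (f := fun x y => k x y * G y)
      (hkm.mul (hG.comp measurable_snd))
  have huκ : ∀ G, Patch s M m G → ∀ x, u G x ≤ κ * m := fun G hG x => by
    calc u G x ≤ ∫⁻ y, κ * G y := (setLIntegral_le_lintegral _ _).trans
          (lintegral_mono fun y => by gcongr; exact hkκ x y)
      _ ≤ κ * m := by rw [lintegral_const_mul _ hG.meas]; gcongr; exact hG.mass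
  have hpot : ∀ G, Patch s M m G → ∀ x, pot s (b.indicator G) x
      ≤ c * M * rieszMass (2 - 2 * s) ρ + u G x := by
    intro G hG x
    have h1 : ∀ y, kern s x y * b.indicator G y ≤
        c * M * {z : Plane | euclLen z < ρ}.indicator (riesz (2 - 2 * s)) (x - y)
          + b.indicator (fun y => k x y * G y) y := by
      intro y
      by_cases hy : y ∈ b
      · rw [indicator_of_mem hy, indicator_of_mem hy]
        by_cases hxy : euclLen (x - y) < ρ
        · refine le_add_right ?_
          rw [indicator_of_mem (show x - y ∈ {z : Plane | euclLen z < ρ} from hxy)]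
          calc kern s x y * G y ≤ c * riesz (2 - 2 * s) (x - y) * M := by
                gcongr
                · exact kern_le hs0 hs1 x y
                · exact hG.le y
            _ = _ := by ring
        · refine le_add_left ?_
          have : k x y = kern s x y := indicator_of_mem (by simpa using hxy) _
          rw [this]
      · simp [hy]
    have hmeas : MeasurableSet {z : Plane | euclLen z < ρ} :=
      measurableSet_lt continuous_euclLen.measurable measurable_const
    have hmeas' : Measurable fun y =>
        {z : Plane | euclLen z < ρ}.indicator (riesz (2 - 2 * s)) (x - y) :=
      ((measurable_riesz _).indicator hmeas).comp (measurable_const.sub measurable_id)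
    refine (lintegral_mono h1).trans_eq ?_
    rw [lintegral_add_right _ (((hkx x).fun_mul hG.meas).indicator hbm), lintegral_indicator hbm,
      lintegral_const_mul _ hmeas',
      lintegral_sub_left_eq_self
        (fun z => {z : Plane | euclLen z < ρ}.indicator (riesz (2 - 2 * s)) z) x,
      lintegral_indicator hmeas]
    rfl
  -- With the diagonal removed the kernel is bounded, so weak convergence gives pointwise
  -- convergence of the potentials and, by domination on the box, convergence of their integrated
  -- differences. One factor `u (F n)` may then be replaced by `u A` at a cost of `M * ∫ (u (F n) -
  -- u A)`.
  have hulim : ∀ x, Tendsto (fun n => u (F n) x) atTop (𝓝 (u A x)) := fun x =>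
    hw.setLIntegral (hkx x) hbm subset_rfl hκ fun y _ => hkκ x y
  have hdiff : Tendsto (fun n => ∫⁻ x in b, (u (F n) x - u A x)) atTop (𝓝 0) := by
    have := tendsto_lintegral_of_dominated_convergence (μ := volume.restrict b)
      (F := fun n x => u (F n) x - u A x) (f := fun _ => 0) (fun _ => κ * m)
      (fun n => (hum _ (hF n).meas).sub (hum _ hA.meas))
      (fun n => Eventually.of_forall fun x => tsub_le_self.trans (huκ _ (hF n) x))
      (by rw [setLIntegral_const]
          exact ENNReal.mul_ne_top (by finiteness) (volume_box_ne_top j))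
      (Eventually.of_forall fun x => by
        have hfin : u A x ≠ ⊤ := ne_top_of_le_ne_top (by finiteness) (huκ A hA x)
        simpa using ENNReal.Tendsto.sub (hulim x) tendsto_const_nhds (Or.inr hfin))
    simpa using this
  have hdiffM := ENNReal.Tendsto.const_mul hdiff (Or.inr (ENNReal.coe_ne_top (r := M)))
  rw [mul_zero] at hdiffM
  have hmain := hw.setLIntegral (hum A hA.meas) hbm subset_rfl (C := κ * m) (by finiteness)
    fun x _ => huκ A hA x
  have hlimle : ∫⁻ x in b, u A x * A x ≤ bil s A A := by
    refine (setLIntegral_le_lintegral _ _).trans (lintegral_mono fun x => ?_)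
    rw [mul_comm]
    gcongr
    exact (setLIntegral_le_lintegral _ _).trans (lintegral_mono fun y => by gcongr; exact hkk x y)
  filter_upwards [(eventually_le_add_of_tendsto hmain
      (ne_top_of_le_ne_top (hA.bil_ne_top hA hs0 hs1) hlimle) hε3),
    eventually_le_add_of_tendsto hdiffM ENNReal.zero_ne_top hε3] with n h1 h2
  have hFn := hF n
  have hun := hum _ hFn.meas
  have huA := hum _ hA.meas
  calc bil s (b.indicator (F n)) (b.indicator (F n))
      ≤ ∫⁻ x, (c * M * rieszMass (2 - 2 * s) ρ * F n x
          + b.indicator (fun x => u A x * F n x + M * (u (F n) x - u A x)) x) := by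
        refine lintegral_mono fun x => ?_
        by_cases hx : x ∈ b
        · rw [indicator_of_mem hx, indicator_of_mem hx]
          calc F n x * pot s (b.indicator (F n)) x
              ≤ F n x * (c * M * rieszMass (2 - 2 * s) ρ + (u A x + (u (F n) x - u A x))) := by
                gcongr
                refine (hpot _ hFn x).trans ?_
                gcongr
                exact le_add_tsub
            _ = c * M * rieszMass (2 - 2 * s) ρ * F n x
                + (u A x * F n x + F n x * (u (F n) x - u A x)) := by ring
            _ ≤ _ := by gcongr; exact hFn.le x
        · simp [hx]
    _ = c * M * rieszMass (2 - 2 * s) ρ * (∫⁻ x, F n x) + ((∫⁻ x in b, u A x * F n x)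
          + M * ∫⁻ x in b, (u (F n) x - u A x)) := by
        rw [lintegral_add_left (hFn.meas.const_mul _), lintegral_const_mul _ hFn.meas,
          lintegral_indicator hbm, lintegral_add_left (huA.fun_mul hFn.meas),
          lintegral_const_mul (M : ℝ≥0∞) (f := fun x => u (F n) x - u A x) (hun.sub huA)]
    _ ≤ ε / 3 + ((bil s A A + ε / 3) + (0 + ε / 3)) := by
        gcongr
        · calc c * M * rieszMass (2 - 2 * s) ρ * (∫⁻ x, F n x)
              ≤ c * M * rieszMass (2 - 2 * s) ρ * m := by gcongr; exact hFn.mass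
            _ = c * M * m * rieszMass (2 - 2 * s) ρ := by ring
            _ ≤ c * M * m * (ε / 3 / (c * M * m)) := by gcongr
            _ ≤ ε / 3 := ENNReal.mul_div_le
        · exact h1.2.trans (by gcongr)
        · exact h2.2
    _ = bil s A A + (ε / 3 + ε / 3 + ε / 3) := by ring
    _ = bil s A A + ε := by rw [ENNReal.add_thirds]

/-- Markov's inequality for the weight `x₁`. A bounded impulse thus rules out escape of mass in the
horizontal direction. -/
theorem lintegral_indicator_fst_le {F : Plane → ℝ≥0∞} (hF : Measurable F) {X : ℝ} (hX : 0 < X) :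
    ∫⁻ x, {x : Plane | X ≤ x.1}.indicator F x ≤ imp F / ENNReal.ofReal X := by
  rw [ENNReal.le_div_iff_mul_le (Or.inl (by simpa using hX)) (Or.inl ENNReal.ofReal_ne_top),
    mul_comm, ← lintegral_const_mul _ (hF.indicator (measurableSet_le measurable_const measurable_fst))]
  refine lintegral_mono fun x => ?_
  by_cases hx : X ≤ x.1
  · rw [indicator_of_mem (show x ∈ {x : Plane | X ≤ x.1} from hx)]
    gcongr
  · simp [hx]

theorem exists_forall_lintegral_indicator_fst_le {K : ℝ≥0∞} (hK : K ≠ ⊤) {e : ℝ≥0∞} (he : e ≠ 0) :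
    ∃ X : ℝ, 0 < X ∧ ∀ F : Plane → ℝ≥0∞, Measurable F → imp F ≤ K →
      ∫⁻ x, {x : Plane | X ≤ x.1}.indicator F x ≤ e := by
  rcases eq_or_ne e ⊤ with rfl | het
  · exact ⟨1, one_pos, fun _ _ _ => le_top⟩
  refine ⟨(K / e).toReal + 1, by positivity, fun F hF hFK =>
    (lintegral_indicator_fst_le hF (by positivity)).trans (ENNReal.div_le_of_le_mul ?_)⟩
  calc imp F ≤ K := hFK
    _ = e * (K / e) := (ENNReal.mul_div_cancel he het).symm
    _ = e * ENNReal.ofReal (K / e).toReal := by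
        rw [ENNReal.ofReal_toReal (ENNReal.div_ne_top hK he)]
    _ ≤ e * ENNReal.ofReal ((K / e).toReal + 1) := by
        gcongr
        linarith

/-- Splitting of a weakly convergent sequence of patches into its limit and a remote part. -/
theorem eventually_split (hs0 : 0 < s) (hs1 : s < 1) (hA : Patch s M m A)
    (hw : WeakTendsto F A) (hF : ∀ n, Patch s M m (F n)) {K : ℝ≥0∞} (hK : K ≠ ⊤)
    (hFK : ∀ n, imp (F n) ≤ K) {ε : ℝ≥0∞} (hε : ε ≠ 0) :
    ∃ R₀ : ℝ, ∀ R, R₀ ≤ R → ∀ᶠ n in atTop,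
      bil s (F n) (F n) ≤ bil s A A
        + bil s ((strip 0 R)ᶜ.indicator (F n)) ((strip 0 R)ᶜ.indicator (F n)) + ε ∧
      imp A + imp ((strip 0 R)ᶜ.indicator (F n)) ≤ imp (F n) + ε ∧
      ∀ τ, excess A τ + excess ((strip 0 R)ᶜ.indicator (F n)) τ ≤ excess (F n) τ + ε := by
  set C := potBound s M m
  have hC : C ≠ ⊤ := potBound_ne_top hs0 hs1 M m
  -- The energy estimate loses `e` on the box, `2e` in the cross term and `2C · 3e` through the
  -- discarded middle piece. The other two estimates lose `2e`.
  set e := ε / (3 + 6 * C) with he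
  have he0 : e ≠ 0 := ENNReal.div_ne_zero.2 ⟨hε, by finiteness⟩
  have heε : (3 + 6 * C) * e ≤ ε := ENNReal.mul_div_le
  have he2 : e + e ≤ ε := by
    refine le_trans ?_ heε
    calc e + e = 2 * e := (two_mul e).symm
      _ ≤ (3 + 6 * C) * e := by gcongr; exact le_add_right (by norm_num)
  obtain ⟨j₁, hj₁, hA₁⟩ := exists_setLIntegral_compl_box_le hA.meas hA.lintegral_ne_top he0
  obtain ⟨j₂, hj₂, hA₂⟩ := exists_setLIntegral_compl_box_le (measurable_ofReal_fst_mul hA.meas)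
    (ne_top_of_le_ne_top hK (hw.imp_le hFK)) he0
  set j := max j₁ j₂
  have hj : 0 < j := lt_max_of_lt_left hj₁
  replace hA₁ := hA₁ j (le_max_left _ _)
  replace hA₂ := hA₂ j (le_max_right _ _)
  have hlim : Tendsto (fun R : ℝ => ENNReal.ofReal (cs s) *
      ENNReal.ofReal ((R - j) ^ (-(2 - 2 * s))) * m * m) atTop (𝓝 0) := by
    have h1 : Tendsto (fun R : ℝ => ENNReal.ofReal ((R - j) ^ (-(2 - 2 * s)))) atTop (𝓝 0) := by
      simpa [sub_eq_add_neg] using ENNReal.tendsto_ofReal ((tendsto_rpow_neg_atTop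
        (y := 2 - 2 * s) (by linarith)).comp (tendsto_atTop_add_const_right _ (-j) tendsto_id))
    have h2 := ENNReal.Tendsto.const_mul h1
      (Or.inr (show ENNReal.ofReal (cs s) * m * m ≠ ⊤ by finiteness))
    rw [mul_zero] at h2
    refine h2.congr fun R => by ring
  obtain ⟨R₀, hR₀⟩ := eventually_atTop.1 ((hlim.eventually_le_const (pos_iff_ne_zero.2 he0)).and
    (eventually_gt_atTop j))
  obtain ⟨X, hX, hXF⟩ := exists_forall_lintegral_indicator_fst_le hK he0
  refine ⟨R₀, fun R hR => ?_⟩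
  obtain ⟨hRe, hjR⟩ := hR₀ R hR
  set b := box j
  have hbm : MeasurableSet b := measurableSet_box j
  have hSm : MeasurableSet (strip 0 R) := measurableSet_strip 0 R
  set J := max X R
  have hdm : MeasurableSet (box J \ b) := (measurableSet_box J).diff hbm
  have hbS : b ⊆ strip 0 R := fun x hx => by
    simpa [strip] using hx.2.trans hjR
  filter_upwards [eventually_bil_box_le hs0 hs1 hA hw hF j he0,
    eventually_forall_setLIntegral_sub_le hA hw j he0,
    eventually_le_add_of_tendsto (hw.setLIntegral measurable_fst.ennreal_ofReal hbm subset_rfl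
      (C := ENNReal.ofReal j) ENNReal.ofReal_ne_top fun x hx =>
        ENNReal.ofReal_le_ofReal ((le_abs_self _).trans hx.1.le))
      (ne_top_of_le_ne_top (ne_top_of_le_ne_top hK (hw.imp_le hFK))
        (setLIntegral_le_lintegral _ _)) he0,
    eventually_le_add_of_tendsto (hw.setLIntegral_one hdm sdiff_subset)
      (ne_top_of_le_ne_top hA.lintegral_ne_top (setLIntegral_le_lintegral _ _)) he0]
    with n hn1 hn2 hn3 hn4
  have hFn := hF n
  -- Three pieces: `p` converges to the bulk of `A`, `γ` is remote, and `q` lies between. Only `q`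
  -- is discarded.
  set p := b.indicator (F n) with hp
  set γ := (strip 0 R)ᶜ.indicator (F n) with hγ
  set q := (strip 0 R \ b).indicator (F n) with hq
  have hpP : Patch s M m p := hFn.indicator hbm
  have hγP : Patch s M m γ := hFn.indicator hSm.compl
  have hqP : Patch s M m q := hFn.indicator (hSm.diff hbm)
  have hsum : F n = p + γ + q := by
    funext x
    simp only [Pi.add_apply, hp, hγ, hq]
    by_cases h1 : x ∈ b
    · simp [h1, hbS h1]
    · by_cases h2 : x ∈ strip 0 R <;> simp [h1, h2]
  have hpγ : p + γ ≤ F n := by rw [hsum]; exact le_self_add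
  -- A point of the domain in the strip but outside `b` either has `x₁ ≥ X`, where the impulse
  -- bounds the mass, or lies in `box J \ b`, where smallness passes from `A` by weak convergence.
  -- As `J` depends on `R`, the index `n` is taken large only after `R` is fixed.
  have hqmass : ∫⁻ x, q x ≤ e + (e + e) := by
    have h1 : ∀ x, q x ≤ {x : Plane | X ≤ x.1}.indicator (F n) x
        + (box J \ b).indicator (F n) x := by
      intro x
      by_cases hx : x ∈ strip 0 R \ b
      · rw [hq, indicator_of_mem hx]
        by_cases hxJ : x ∈ box J
        · rw [indicator_of_mem (show x ∈ box J \ b from ⟨hxJ, hx.2⟩)]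
          exact le_add_self
        · by_cases hx1 : X ≤ x.1
          · rw [indicator_of_mem (show x ∈ {x : Plane | X ≤ x.1} from hx1)]
            exact le_self_add
          · rw [hFn.off x]
            · exact bot_le
            · intro hxD
              have h0 : 0 < x.1 := domain_subset_halfPlane s hxD
              refine hxJ ⟨?_, ?_⟩
              · rw [abs_of_pos h0]
                exact (not_le.1 hx1).trans_le (le_max_left _ _)
              · have : |x.2| < R := by simpa [strip] using hx.1
                exact this.trans_le (le_max_right _ _)
      · rw [hq, indicator_of_notMem hx]; exact bot_le
    refine (lintegral_mono h1).trans ?_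
    rw [lintegral_add_right _ (hFn.meas.indicator hdm), lintegral_indicator hdm]
    refine add_le_add (hXF _ hFn.meas (hFK n)) (hn4.2.trans ?_)
    gcongr
    exact (lintegral_mono_set fun x hx => hx.2).trans hA₁
  refine ⟨?_, ?_, fun τ => ?_⟩
  · have hcross : bil s p γ ≤ e := by
      refine (bil_le_of_separated hs0 hs1 hpP.meas hγP.meas hjR (fun x hx => ?_)
        fun x hx => ?_).trans (le_trans ?_ hRe)
      · exact indicator_of_notMem (fun h => hx (box_subset_strip j h)) _
      · exact indicator_of_notMem (notMem_compl_iff.2 hx) _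
      · gcongr
        · exact hγP.mass
        · exact hpP.mass
    have hqF : bil s q (F n) ≤ C * (e + (e + e)) :=
      (hFn.bil_le hs0 hs1 hqP.meas).trans (by gcongr)
    calc bil s (F n) (F n) ≤ bil s (p + γ) (p + γ) + 2 * bil s q (F n) := by
          rw [hsum]
          exact bil_add_self_le s (hpP.meas.add hγP.meas) hqP.meas
      _ ≤ (bil s p p + bil s γ γ + 2 * bil s p γ) + 2 * (C * (e + (e + e))) := by
          rw [bil_add_self s hpP.meas hγP.meas]
          gcongr
      _ ≤ ((bil s A A + e) + bil s γ γ + 2 * e) + 2 * (C * (e + (e + e))) := by gcongr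
      _ = bil s A A + bil s γ γ + (3 + 6 * C) * e := by ring
      _ ≤ _ := by gcongr
  · have h1 : imp A = (∫⁻ x in b, ENNReal.ofReal x.1 * A x)
        + ∫⁻ x in bᶜ, ENNReal.ofReal x.1 * A x := (lintegral_add_compl _ hbm).symm
    have h2 : imp p = ∫⁻ x in b, ENNReal.ofReal x.1 * F n x := by
      rw [← lintegral_indicator hbm]
      unfold imp
      congr 1; funext x
      by_cases hx : x ∈ b <;> simp [hp, hx]
    calc imp A + imp γ ≤ ((imp p + e) + e) + imp γ := by
          rw [h1, h2]
          gcongr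
          exact hn3.1
      _ = imp (p + γ) + (e + e) := by rw [imp_add hpP.meas]; ring
      _ ≤ imp (F n) + ε := add_le_add (imp_mono hpγ) he2
  · have h1 : excess A τ ≤ (∫⁻ x in b, (A x - τ)) + e := by
      unfold excess
      rw [← lintegral_add_compl _ hbm]
      gcongr
      exact (lintegral_mono fun x => tsub_le_self).trans hA₁
    have h2 : (∫⁻ x in b, (F n x - τ)) + excess γ τ ≤ excess (F n) τ := by
      unfold excess
      rw [← lintegral_indicator hbm,
        ← lintegral_add_left (Measurable.indicator (f := fun x => F n x - τ)
          (hFn.meas.sub measurable_const) hbm)]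
      refine lintegral_mono fun x => ?_
      by_cases hx : x ∈ b
      · simp [hx, hγ, hbS hx]
      · rw [indicator_of_notMem hx, zero_add]
        exact tsub_le_tsub_right (indicator_le_self' (fun _ _ => bot_le) x) τ
    calc excess A τ + excess γ τ
        ≤ (((∫⁻ x in b, (F n x - τ)) + e) + e) + excess γ τ := by
          gcongr
          exact h1.trans (by gcongr; exact hn2 τ)
      _ = ((∫⁻ x in b, (F n x - τ)) + excess γ τ) + (e + e) := by ring
      _ ≤ excess (F n) τ + ε := add_le_add h2 he2

end

section

/-! ### The penalized energy -/

/-- `E - W I` as a real number. -/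
def penEnergy (s W : ℝ) (F : Plane → ℝ≥0∞) : ℝ := (bil s F F).toReal / 2 - W * (imp F).toReal

variable {s W : ℝ} {M m : ℝ≥0} {F G A B Z : Plane → ℝ≥0∞}

theorem penEnergy_shift (s W h : ℝ) (F : Plane → ℝ≥0∞) :
    penEnergy s W (shift h F) = penEnergy s W F := by
  rw [penEnergy, bil_shift, imp_shift, penEnergy]

theorem imp_ne_top_of_le (h : F ≤ G) (hG : imp G ≠ ⊤) : imp F ≠ ⊤ :=
  ne_top_of_le_ne_top hG (imp_mono h)

theorem penEnergy_add (hs0 : 0 < s) (hs1 : s < 1) {m' : ℝ≥0} (hF : Patch s M m F)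
    (hG : Patch s M m' G) (hFi : imp F ≠ ⊤) (hGi : imp G ≠ ⊤) :
    penEnergy s W (F + G) = penEnergy s W F + penEnergy s W G + (bil s F G).toReal := by
  have h1 := hF.bil_ne_top hF hs0 hs1
  have h2 := hG.bil_ne_top hG hs0 hs1
  have h3 : bil s F G ≠ ⊤ := by
    refine ne_top_of_le_ne_top ?_ (hG.bil_le hs0 hs1 hF.meas)
    exact ENNReal.mul_ne_top (potBound_ne_top hs0 hs1 M m') hF.lintegral_ne_top
  unfold penEnergy
  rw [bil_add_self s hF.meas hG.meas, imp_add hF.meas,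
    ENNReal.toReal_add (by finiteness) (by finiteness), ENNReal.toReal_add h1 h2,
    ENNReal.toReal_add hFi hGi, ENNReal.toReal_mul]
  simp
  ring

theorem penEnergy_le_of_split (hs0 : 0 < s) (hs1 : s < 1) (hW : 0 < W) (hA : Patch s M m A)
    (hG : Patch s M m G) (hAi : imp A ≠ ⊤) (hGi : imp G ≠ ⊤) (hFi : imp F ≠ ⊤)
    {ε : ℝ} (hε : 0 ≤ ε) (hb : bil s F F ≤ bil s A A + bil s G G + ENNReal.ofReal ε)
    (hi : imp A + imp G ≤ imp F + ENNReal.ofReal ε) :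
    penEnergy s W F ≤ penEnergy s W A + penEnergy s W G + (1 / 2 + W) * ε := by
  have h1 := hA.bil_ne_top hA hs0 hs1
  have h2 := hG.bil_ne_top hG hs0 hs1
  have hb' := ENNReal.toReal_mono (by finiteness) hb
  have hi' := ENNReal.toReal_mono (by finiteness) hi
  rw [ENNReal.toReal_add (by finiteness) (by finiteness), ENNReal.toReal_add h1 h2,
    ENNReal.toReal_ofReal hε] at hb'
  rw [ENNReal.toReal_add hAi hGi, ENNReal.toReal_add hFi (by finiteness),
    ENNReal.toReal_ofReal hε] at hi'
  unfold penEnergy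
  nlinarith

/-- The form is monotone, and `F ≤ G + (F - G)` with truncated subtraction. Replacing one factor at
a time costs the mass of the positive part times a bounded potential. -/
theorem bil_le_bil_add_lintegral_sub (hs0 : 0 < s) (hs1 : s < 1) (hF : Patch s M m F)
    (hG : Patch s M m G) :
    bil s F F ≤ bil s G G + 2 * (potBound s M m * ∫⁻ x, (F x - G x)) := by
  set D : Plane → ℝ≥0∞ := fun x => F x - G x
  have hD : Measurable D := hF.meas.sub hG.meas
  have hle : F ≤ G + D := fun x => le_add_tsub
  calc bil s F F ≤ bil s (G + D) F := bil_mono s hle le_rfl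
    _ = bil s G F + bil s D F := bil_add_left s hG.meas hF.meas
    _ = bil s F G + bil s D F := by rw [bil_comm s hG.meas hF.meas]
    _ ≤ bil s (G + D) G + bil s D F := by gcongr; exact bil_mono s hle le_rfl
    _ = bil s G G + (bil s D G + bil s D F) := by rw [bil_add_left s hG.meas hG.meas, add_assoc]
    _ ≤ _ := by
        rw [two_mul]
        gcongr
        · exact hG.bil_le hs0 hs1 hD
        · exact hF.bil_le hs0 hs1 hD

/-- Continuity in the level lets the intermediate value theorem find a level whose excess is a
prescribed number. -/
theorem continuous_excess (hF : Patch s M m F) :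
    Continuous fun h : ℝ => excess F (ENNReal.ofReal h) := by
  refine continuous_iff_continuousAt.2 fun h => ?_
  refine tendsto_lintegral_filter_of_dominated_convergence F
    (Eventually.of_forall fun t => hF.meas.sub measurable_const)
    (Eventually.of_forall fun t => Eventually.of_forall fun x => tsub_le_self)
    hF.lintegral_ne_top (Eventually.of_forall fun x => ?_)
  exact ((ENNReal.continuous_sub_left (hF.ne_top x)).comp ENNReal.continuous_ofReal).tendsto h

/-- Cutting off the top of a function that is almost dominated by `Z`. -/
theorem exists_le_excess_le (hF : Patch s M m F) {ε : ℝ≥0∞} (hε : ε ≠ ⊤)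
    (h : ∀ τ, excess F τ ≤ excess Z τ + ε) :
    ∃ G, Measurable G ∧ G ≤ F ∧ (∀ τ, excess G τ ≤ excess Z τ) ∧ ∫⁻ x, (F x - G x) ≤ ε := by
  rcases le_total (∫⁻ x, F x) ε with hle | hge
  · exact ⟨0, measurable_const, fun x => bot_le, fun τ => by simp [excess], by simpa using hle⟩
  have hmem : ε ∈ Icc (excess F (ENNReal.ofReal M)) (excess F (ENNReal.ofReal 0)) := by
    constructor
    · have : ∀ x, F x - M = 0 := fun x => tsub_eq_zero_of_le (hF.le x)
      simp [excess, this]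
    · simpa [excess] using hge
  -- Cut at the level where the excess of `F` is exactly `ε`. The truncation then loses mass `ε`,
  -- and each of its excesses below that level drops by `ε`, which absorbs the error in the
  -- domination.
  obtain ⟨t, -, ht⟩ := intermediate_value_Icc' (NNReal.coe_nonneg M)
    (continuous_excess hF).continuousOn hmem
  set h₀ := ENNReal.ofReal t
  dsimp only at ht
  refine ⟨fun x => min (F x) h₀, hF.meas.min measurable_const, fun x => min_le_left _ _,
    fun τ => ?_, ?_⟩
  · rcases le_total h₀ τ with hτ | hτ
    · have : ∀ x, min (F x) h₀ - τ = 0 := fun x =>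
        tsub_eq_zero_of_le ((min_le_right _ _).trans hτ)
      simp [excess, this]
    · refine (ENNReal.add_le_add_iff_right hε).1 (le_trans ?_ (h τ))
      nth_rw 1 [← ht]
      change excess _ τ + excess F h₀ ≤ excess F τ
      unfold excess
      rw [← lintegral_add_right _ (g := fun x => F x - h₀) (hF.meas.sub measurable_const)]
      refine lintegral_mono fun x => ?_
      dsimp only
      rcases le_total (F x) h₀ with hx | hx
      · rw [min_eq_left hx, tsub_eq_zero_of_le hx, add_zero]
      · rw [min_eq_right hx, add_comm, tsub_add_tsub_cancel hx hτ]
  · refine (lintegral_mono fun x => ?_).trans ht.le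
    dsimp only
    rcases le_total (F x) h₀ with hx | hx
    · simp [min_eq_left hx]
    · rw [min_eq_right hx]

/-- The top cut off to restore the constraint has mass at most `ε`. Removing it lowers the impulse
and costs at most `potBound` times `ε` of energy. -/
theorem penEnergy_le_add_of_excess_le (hs0 : 0 < s) (hs1 : s < 1) (hW : 0 < W) {S : ℝ}
    (hS : ∀ G, Patch s M m G → imp G ≠ ⊤ → (∀ τ, excess G τ ≤ excess Z τ) →
      penEnergy s W G ≤ S)
    (hF : Patch s M m F) (hFi : imp F ≠ ⊤) {ε : ℝ} (hε : 0 ≤ ε)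
    (h : ∀ τ, excess F τ ≤ excess Z τ + ENNReal.ofReal ε) :
    penEnergy s W F ≤ S + (potBound s M m).toReal * ε := by
  obtain ⟨G, hGm, hGF, hGe, hGd⟩ := exists_le_excess_le hF ENNReal.ofReal_ne_top h
  have hG := hF.of_le hGm hGF
  have hGi := imp_ne_top_of_le hGF hFi
  have h1 := hS G hG hGi hGe
  have hC := potBound_ne_top hs0 hs1 M m
  have hGG := hG.bil_ne_top hG hs0 hs1
  have h2 : bil s F F ≤ bil s G G + 2 * (potBound s M m * ENNReal.ofReal ε) :=
    (bil_le_bil_add_lintegral_sub hs0 hs1 hF hG).trans (by gcongr)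
  have h3 := ENNReal.toReal_mono (by finiteness) h2
  rw [ENNReal.toReal_add hGG (by finiteness), ENNReal.toReal_mul, ENNReal.toReal_mul,
    ENNReal.toReal_ofReal hε] at h3
  have h4 := ENNReal.toReal_mono hFi (imp_mono hGF)
  simp only [ENNReal.toReal_ofNat] at h3
  unfold penEnergy at h1 ⊢
  nlinarith

/-- Discarding the part of a patch far away in the vertical direction does not lower `E - W I`. -/
theorem Patch.exists_penEnergy_le_strip (hA : Patch s M m A) (hs0 : 0 < s) (hs1 : s < 1)
    (hW : 0 < W) (hAi : imp A ≠ ⊤) : ∃ L₀ : ℝ, ∀ L, L₀ ≤ L →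
      penEnergy s W A ≤ penEnergy s W ((strip 0 L).indicator A) := by
  obtain ⟨L₀, h⟩ := hA.exists_pot_le hs0 hs1 hW
  refine ⟨L₀, fun L hL => ?_⟩
  have hm := measurableSet_strip 0 L
  set A₁ := (strip 0 L).indicator A
  set A₂ := (strip 0 L)ᶜ.indicator A with hA₂
  have h1P : Patch s M m A₁ := hA.indicator hm
  have h2P : Patch s M m A₂ := hA.indicator hm.compl
  have hsum : A = A₁ + A₂ := (indicator_self_add_compl _ _).symm
  have hi1 : imp A₁ ≠ ⊤ := imp_ne_top_of_le (by rw [hsum]; exact le_self_add) hAi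
  have hi2 : imp A₂ ≠ ⊤ := imp_ne_top_of_le (by rw [hsum]; exact le_add_self) hAi
  -- Removing `A₂` loses at most `bil s A₂ A` of energy and saves `W * imp A₂`. On the support of
  -- `A₂` the potential is at most `W x₁`.
  have hb : bil s A₂ A ≤ ENNReal.ofReal W * imp A₂ := by
    unfold bil imp
    rw [← lintegral_const_mul _ (measurable_ofReal_fst_mul h2P.meas)]
    refine lintegral_mono fun x => ?_
    by_cases hx : x ∈ strip 0 L
    · simp [hA₂, hx]
    · by_cases hxD : x ∈ domain s
      · rw [← mul_assoc, mul_comm]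
        gcongr
        exact h L hL x hxD hx
      · simp [h2P.off x hxD]
  have hb2 : bil s A A ≤ bil s A₁ A₁ + 2 * (ENNReal.ofReal W * imp A₂) := by
    calc bil s A A ≤ bil s A₁ A₁ + 2 * bil s A₂ A := by
          rw [hsum]; exact bil_add_self_le s h1P.meas h2P.meas
      _ ≤ _ := by gcongr
  have h11 := h1P.bil_ne_top h1P hs0 hs1
  have h3 := ENNReal.toReal_mono (by finiteness) hb2
  rw [ENNReal.toReal_add h11 (by finiteness), ENNReal.toReal_mul, ENNReal.toReal_mul,
    ENNReal.toReal_ofReal hW.le] at h3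
  simp only [ENNReal.toReal_ofNat] at h3
  have h4 : (imp A).toReal = (imp A₁).toReal + (imp A₂).toReal := by
    rw [hsum, imp_add h1P.meas, ENNReal.toReal_add hi1 hi2]
  unfold penEnergy
  rw [h4]
  linarith

/-- Two nontrivial patches interact. -/
theorem bil_ne_zero (hs0 : 0 < s) (hs1 : s < 1) (hA : Patch s M m A) (hB : Patch s M m B)
    (hA0 : ∫⁻ x, A x ≠ 0) (hB0 : ∫⁻ x, B x ≠ 0) : bil s A B ≠ 0 := by
  intro h
  have h1 := (lintegral_eq_zero_iff (hA.meas.mul (measurable_pot s hB.meas))).1 h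
  refine hA0 ((lintegral_eq_zero_iff hA.meas).2 ?_)
  filter_upwards [h1] with x hx
  by_contra hAx
  have hxD : x ∈ domain s := by
    by_contra hn; exact hAx (hA.off x hn)
  have hpot : pot s B x = 0 := by
    simpa [show A x ≠ 0 from hAx] using hx
  have h2 := (lintegral_eq_zero_iff ((measurable_kern_right s x).mul hB.meas)).1 hpot
  refine hB0 ((lintegral_eq_zero_iff hB.meas).2 ?_)
  have hne : ∀ᵐ y : Plane, y ≠ x := by simp [ae_iff]
  filter_upwards [h2, hne] with y hy hyx
  by_contra hBy
  have hyD : y ∈ domain s := by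
    by_contra hn; exact hBy (hB.off y hn)
  have hk : kern s x y ≠ 0 := by
    have := greenPlus_pos hs0 hs1 (domain_subset_halfPlane s hxD) (domain_subset_halfPlane s hyD)
      hyx.symm
    simpa [kern] using this
  have : kern s x y = 0 ∨ B y = 0 := by simpa using hy
  exact this.elim hk hBy

/-- At each point at most one summand is present. The inequality fails for overlapping functions, so
competitors are glued from pieces with disjoint supports. -/
theorem excess_add_le_of_disjoint (hF : Measurable F) (h : ∀ x, F x = 0 ∨ G x = 0) (τ : ℝ≥0∞) :
    excess (F + G) τ ≤ excess F τ + excess G τ := by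
  unfold excess
  rw [← lintegral_add_left (f := fun x => F x - τ) (hF.sub measurable_const)]
  refine lintegral_mono fun x => ?_
  rcases h x with h | h <;> simp [h]

theorem Patch.add_of_disjoint {m' : ℝ≥0} (hF : Patch s M m F) (hG : Patch s M m' G)
    (h : ∀ x, F x = 0 ∨ G x = 0) : Patch s M (m + m') (F + G) where
  meas := hF.meas.add hG.meas
  le x := by
    rcases h x with h | h
    · simpa [h] using hG.le x
    · simpa [h] using hF.le x
  off x hx := by simp [hF.off x hx, hG.off x hx]
  mass := by
    simp only [Pi.add_apply]
    rw [lintegral_add_left hF.meas, ENNReal.coe_add]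
    exact add_le_add hF.mass hG.mass

/-- At most half of the mass `σ` can sit at large `x₁`, by the impulse bound. The other half stays
in a fixed box, where weak convergence sees it. -/
theorem WeakTendsto.lintegral_ne_zero {F : ℕ → Plane → ℝ≥0∞} (hw : WeakTendsto F A)
    (hF : ∀ n, Patch s M m (F n)) {K : ℝ≥0∞} (hK : K ≠ ⊤) (hFK : ∀ n, imp (F n) ≤ K)
    {R : ℝ} {σ : ℝ≥0∞} (hσ : σ ≠ 0) (hm : ∀ n, σ ≤ ∫⁻ x in strip 0 R, F n x) :
    ∫⁻ x, A x ≠ 0 := by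
  intro h0
  have hσt : σ ≠ ⊤ := ne_top_of_le_ne_top (hF 0).lintegral_ne_top
    ((hm 0).trans (setLIntegral_le_lintegral _ _))
  obtain ⟨X, hX, hXF⟩ := exists_forall_lintegral_indicator_fst_le hK
    (ENNReal.div_ne_zero.2 ⟨hσ, by simp⟩ : σ / 2 ≠ 0)
  set J := max X R
  have h1 : ∀ n, σ ≤ σ / 2 + ∫⁻ x in box J, F n x := by
    intro n
    refine (hm n).trans (le_trans ?_ (add_le_add_left (hXF _ (hF n).meas (hFK n)) _))
    rw [← lintegral_indicator (measurableSet_strip _ _), ← lintegral_indicator (measurableSet_box _),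
      ← lintegral_add_right _ ((hF n).meas.indicator (measurableSet_box _))]
    refine lintegral_mono fun x => ?_
    by_cases hx : x ∈ strip 0 R
    · rw [indicator_of_mem hx]
      by_cases hxJ : x ∈ box J
      · rw [indicator_of_mem hxJ]
        exact le_add_self
      · by_cases hx1 : X ≤ x.1
        · rw [indicator_of_mem (show x ∈ {x : Plane | X ≤ x.1} from hx1)]
          exact le_self_add
        · rw [(hF n).off x]
          · exact bot_le
          · intro hxD
            have h0 : 0 < x.1 := domain_subset_halfPlane s hxD
            refine hxJ ⟨?_, ?_⟩
            · rw [abs_of_pos h0]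
              exact (not_le.1 hx1).trans_le (le_max_left _ _)
            · have : |x.2| < R := by simpa [strip] using hx
              exact this.trans_le (le_max_right _ _)
    · rw [indicator_of_notMem hx]; exact bot_le
  have h2 := ge_of_tendsto'
    ((hw.setLIntegral_one (measurableSet_box J) subset_rfl).const_add (σ / 2)) h1
  have h3 : ∫⁻ x in box J, A x = 0 := le_antisymm
    ((setLIntegral_le_lintegral _ _).trans h0.le) bot_le
  rw [h3, add_zero] at h2
  exact absurd h2 (not_le.2 (ENNReal.half_lt_self hσ hσt))

theorem Patch.exists_strip_lintegral_ne_zero (hA : Patch s M m A) (h0 : ∫⁻ x, A x ≠ 0) :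
    ∃ L₀ : ℝ, ∀ L, L₀ ≤ L → ∫⁻ x, (strip 0 L).indicator A x ≠ 0 := by
  obtain ⟨j, -, hj⟩ := exists_setLIntegral_compl_box_le hA.meas hA.lintegral_ne_top
    (ENNReal.div_ne_zero.2 ⟨h0, by simp⟩ : (∫⁻ x, A x) / 2 ≠ 0)
  refine ⟨j, fun L hL h => ?_⟩
  rw [lintegral_indicator (measurableSet_strip _ _)] at h
  have h1 : ∫⁻ x in box j, A x = 0 := le_antisymm ((lintegral_mono_set
    ((box_mono hL).trans (box_subset_strip L))).trans h.le) bot_le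
  have h2 := lintegral_add_compl (μ := volume) A (measurableSet_box j)
  rw [h1, zero_add] at h2
  exact absurd (h2.symm.le.trans (hj j le_rfl))
    (not_le.2 (ENNReal.half_lt_self h0 hA.lintegral_ne_top))

end

/-! ### Optimality of weak limits: excluding dichotomy -/

section

variable {s W : ℝ} {M m : ℝ≥0} {A B Z : Plane → ℝ≥0∞}

theorem shift_le_shift {F G : Plane → ℝ≥0∞} (h : F ≤ G) (a : ℝ) : shift a F ≤ shift a G :=
  fun _ => h _

/-- If the weak limit `A` of an almost maximizing sequence is not optimal, then the sequence
contains remote pieces that complement `A`, whose mass does not spread out. -/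
theorem exists_remote_piece (hs0 : 0 < s) (hs1 : s < 1) (hW : 0 < W) {S : ℝ}
    {F : ℕ → Plane → ℝ≥0∞} (hF : ∀ n, Patch s M m (F n)) {K : ℝ≥0∞} (hK : K ≠ ⊤)
    (hFK : ∀ n, imp (F n) ≤ K) (hA : Patch s M m A) (hw : WeakTendsto F A)
    {e : ℕ → ℝ} (he : Tendsto e atTop (𝓝 0))
    (hFe : ∀ n τ, excess (F n) τ ≤ excess Z τ + ENNReal.ofReal (e n))
    (hFS : ∀ n, S - e n ≤ penEnergy s W (F n)) (hAS : penEnergy s W A < S) :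
    ∃ R' : ℝ, ∃ σ : ℝ≥0∞, σ ≠ 0 ∧ ∀ ε : ℝ, 0 < ε → ∀ r : ℝ, ∃ a : ℝ, ∃ θ : Plane → ℝ≥0∞,
      Patch s M m θ ∧ imp θ ≤ K ∧ (∀ x ∈ strip 0 r, shift (-a) θ x = 0) ∧
      S ≤ penEnergy s W A + penEnergy s W θ + ε ∧
      (∀ τ, excess A τ + excess θ τ ≤ excess Z τ + ENNReal.ofReal ε) ∧
      σ ≤ ∫⁻ x in strip 0 R', θ x := by
  -- Half the energy gap. Remote pieces keep at least this much whatever `ε ≤ d` is used, so `R'`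
  -- and `σ` do not depend on `ε` and `r`.
  set d := (S - penEnergy s W A) / 2 with hd
  have hd0 : 0 < d := by rw [hd]; linarith
  obtain ⟨R', -, σ, hσ, hstrip⟩ := exists_strip_mass_of_le_bil hs0 hs1 M m
    (d := ENNReal.ofReal d) (by simpa using hd0) ENNReal.ofReal_ne_top
  refine ⟨R', σ, hσ, fun ε hε r => ?_⟩
  -- The splitting error `1/2 + W` and the defect `e n` add up to less than `2 + W` units; the
  -- domination error is two units.
  set ε' := min ε d / (2 + W) with hε'
  have hmin : 0 < min ε d := lt_min hε hd0
  have hε'0 : 0 < ε' := div_pos hmin (by linarith)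
  have hε'1 : (2 + W) * ε' = min ε d := mul_div_cancel₀ _ (by linarith)
  have hε'ε : (2 + W) * ε' ≤ ε := hε'1.le.trans (min_le_left _ _)
  have hε'd : (2 + W) * ε' ≤ d := hε'1.le.trans (min_le_right _ _)
  obtain ⟨R₀, hR₀⟩ := eventually_split hs0 hs1 hA hw hF hK hFK
    (ε := ENNReal.ofReal ε') (by simpa using hε'0)
  set R := max R₀ r
  obtain ⟨n, ⟨hb, hi, hx⟩, hen⟩ := ((hR₀ R (le_max_left _ _)).and
    (he.eventually_lt_const hε'0)).exists
  set γ := (strip 0 R)ᶜ.indicator (F n) with hγ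
  have hγP : Patch s M m γ := (hF n).indicator (measurableSet_strip 0 R).compl
  have hγF : γ ≤ F n := indicator_le_self' fun _ _ => bot_le
  have hγK : imp γ ≤ K := (imp_mono hγF).trans (hFK n)
  have hAi : imp A ≠ ⊤ := ne_top_of_le_ne_top hK (hw.imp_le hFK)
  have hJ := penEnergy_le_of_split hs0 hs1 hW hA hγP hAi (ne_top_of_le_ne_top hK hγK)
    (ne_top_of_le_ne_top hK (hFK n)) hε'0.le hb hi
  have hSn := hFS n
  have hJγ : d ≤ penEnergy s W γ := by nlinarith
  have hbγ : ENNReal.ofReal d ≤ bil s γ γ := by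
    refine ENNReal.ofReal_le_of_le_toReal (hJγ.trans ?_)
    have h1 : 0 ≤ W * (imp γ).toReal := by positivity
    have h2 : 0 ≤ (bil s γ γ).toReal := ENNReal.toReal_nonneg
    unfold penEnergy
    linarith
  -- The piece is moved so that its massive strip is centred at height zero. The shift `a` is
  -- recorded, as the original position is remote from `A`.
  obtain ⟨a, ha⟩ := hstrip γ hγP hbγ
  refine ⟨a, shift a γ, hγP.shift a, (imp_shift a γ).le.trans hγK, fun x hxr => ?_, ?_, fun τ => ?_,
    ?_⟩
  · rw [shift_shift, neg_add_cancel, shift_zero, hγ, indicator_of_notMem]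
    refine notMem_compl_iff.2 ?_
    exact (show |x.2 - 0| < r from hxr).trans_le (le_max_right _ _)
  · rw [penEnergy_shift]
    nlinarith
  · rw [excess_shift]
    calc excess A τ + excess γ τ ≤ excess (F n) τ + ENNReal.ofReal ε' := hx τ
      _ ≤ excess Z τ + ENNReal.ofReal (e n) + ENNReal.ofReal ε' := by gcongr; exact hFe n τ
      _ ≤ excess Z τ + ENNReal.ofReal ε' + ENNReal.ofReal ε' := by gcongr
      _ = excess Z τ + ENNReal.ofReal (ε' + ε') := by
          rw [add_assoc, ENNReal.ofReal_add hε'0.le hε'0.le]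
      _ ≤ _ := by gcongr; nlinarith
  · rw [setLIntegral_strip_shift, zero_add]
    exact ha

/-- Weak limits of almost maximizing sequences are optimal. -/
theorem le_penEnergy_of_weakTendsto (hs0 : 0 < s) (hs1 : s < 1) (hW : 0 < W) {S : ℝ}
    (hS : ∀ (m' : ℝ≥0) (G : Plane → ℝ≥0∞), Patch s M m' G → imp G ≠ ⊤ →
      (∀ τ, excess G τ ≤ excess Z τ) → penEnergy s W G ≤ S)
    {F : ℕ → Plane → ℝ≥0∞} (hF : ∀ n, Patch s M m (F n)) {K : ℝ≥0∞} (hK : K ≠ ⊤)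
    (hFK : ∀ n, imp (F n) ≤ K) (hA : Patch s M m A) (hw : WeakTendsto F A)
    (hA0 : ∫⁻ x, A x ≠ 0) {e : ℕ → ℝ} (he : Tendsto e atTop (𝓝 0))
    (hFe : ∀ n τ, excess (F n) τ ≤ excess Z τ + ENNReal.ofReal (e n))
    (hFS : ∀ n, S - e n ≤ penEnergy s W (F n)) : S ≤ penEnergy s W A := by
  by_contra! hAS
  obtain ⟨R', σ, hσ, hpiece⟩ := exists_remote_piece hs0 hs1 hW hF hK hFK hA hw he hFe hFS hAS
  have hpos : ∀ k : ℕ, 0 < 1 / ((k : ℝ) + 1) := fun k => Nat.one_div_pos_of_nat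
  -- Tolerance `1 / (k + 1)` and remoteness `k`, so errors vanish while the original positions
  -- recede to infinity.
  choose a θ hθ hθK hθoff hθS hθe hθσ using fun k : ℕ => hpiece (1 / ((k : ℝ) + 1)) (hpos k) k
  obtain ⟨φ, hφ, B, hB, hwB⟩ := exists_weakTendsto hθ
  have hB0 : ∫⁻ x, B x ≠ 0 := hwB.lintegral_ne_zero (fun n => hθ (φ n)) hK (fun n => hθK (φ n)) hσ
    fun n => hθσ (φ n)
  have hAi : imp A ≠ ⊤ := ne_top_of_le_ne_top hK (hw.imp_le hFK)
  have hBi : imp B ≠ ⊤ := ne_top_of_le_ne_top hK (hwB.imp_le fun n => hθK (φ n))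
  obtain ⟨L₁, hL₁⟩ := hA.exists_penEnergy_le_strip hs0 hs1 hW hAi
  obtain ⟨L₂, hL₂⟩ := hB.exists_penEnergy_le_strip hs0 hs1 hW hBi
  obtain ⟨L₃, hL₃⟩ := hA.exists_strip_lintegral_ne_zero hA0
  obtain ⟨L₄, hL₄⟩ := hB.exists_strip_lintegral_ne_zero hB0
  set L := max (max L₁ L₂) (max L₃ L₄)
  replace hL₁ := hL₁ L ((le_max_left _ _).trans (le_max_left _ _))
  replace hL₂ := hL₂ L ((le_max_right _ _).trans (le_max_left _ _))
  replace hL₃ := hL₃ L ((le_max_left _ _).trans (le_max_right _ _))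
  replace hL₄ := hL₄ L ((le_max_right _ _).trans (le_max_right _ _))
  have hmL := measurableSet_strip 0 L
  set A' := (strip 0 L).indicator A with hA'
  set B' := (strip 0 L).indicator B with hB'
  have hA'A : A' ≤ A := indicator_le_self' fun _ _ => bot_le
  have hB'B : B' ≤ B := indicator_le_self' fun _ _ => bot_le
  -- The support of `T` lies in heights between `L` and `3L`, next to that of `A'` and disjoint from
  -- it. The resulting interaction is positive and fixed before `ε` and the index are chosen.
  set T := shift (-(2 * L)) B' with hT
  have hA'P : Patch s M m A' := hA.indicator hmL
  have hB'P : Patch s M m B' := hB.indicator hmL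
  have hTP : Patch s M m T := hB'P.shift _
  have hA'i := imp_ne_top_of_le hA'A hAi
  have hTi : imp T ≠ ⊤ := by rw [hT, imp_shift]; exact imp_ne_top_of_le hB'B hBi
  have hg : bil s A' T ≠ 0 := bil_ne_zero hs0 hs1 hA'P hTP hL₃ (by rwa [hT, lintegral_shift])
  have hg0 : 0 < (bil s A' T).toReal := ENNReal.toReal_pos hg (hA'P.bil_ne_top hTP hs0 hs1)
  set g := (bil s A' T).toReal
  have hTsupp : ∀ x, T x ≠ 0 → |x.2 - 2 * L| < L := by
    intro x hx
    by_contra hn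
    refine hx (indicator_of_notMem (fun h => hn ?_) _)
    simpa [strip, sub_eq_add_neg] using h
  have hA'supp : ∀ x, A' x ≠ 0 → |x.2| < L := by
    intro x hx
    by_contra hn
    refine hx (indicator_of_notMem (fun h => hn ?_) _)
    simpa [strip] using h
  have hdisj : ∀ x, A' x = 0 ∨ T x = 0 := by
    intro x
    by_contra! h
    have h1 := abs_lt.1 (hA'supp x h.1)
    have h2 := abs_lt.1 (hTsupp x h.2)
    linarith
  have hATP := hA'P.add_of_disjoint hTP hdisj
  have hATi : imp (A' + T) ≠ ⊤ := by rw [imp_add hA'P.meas]; finiteness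
  have hJAT : penEnergy s W A + penEnergy s W B + g ≤ penEnergy s W (A' + T) := by
    rw [penEnergy_add hs0 hs1 hA'P hTP hA'i hTi, hT, penEnergy_shift]
    linarith
  set C := (potBound s M (m + m + m)).toReal
  have hC0 : 0 ≤ C := ENNReal.toReal_nonneg
  -- The losses, `1` from the piece, `1/2 + W` from splitting it and `2C` from repairing the
  -- constraint, total at most `g / 2` in units of `ε`. A gain of `g` therefore contradicts the
  -- bound `S`.
  set ε := g / (2 * (2 + W + 2 * C)) with hε
  have hε0 : 0 < ε := by positivity
  have hεg : (2 + W + 2 * C) * ε = g / 2 := by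
    rw [hε]; field_simp
  obtain ⟨R₀, hR₀⟩ := eventually_split hs0 hs1 hB hwB (fun n => hθ (φ n)) hK (fun n => hθK (φ n))
    (ε := ENNReal.ofReal ε) (by simpa using hε0)
  have hlim : Tendsto (fun n : ℕ => 1 / ((φ n : ℝ) + 1)) atTop (𝓝 0) :=
    tendsto_one_div_add_atTop_nhds_zero_nat.comp hφ.tendsto_atTop
  have hφL : Tendsto (fun n : ℕ => (φ n : ℝ)) atTop atTop :=
    tendsto_natCast_atTop_atTop.comp hφ.tendsto_atTop
  obtain ⟨n, ⟨⟨hb, hi, hx⟩, hn⟩, hnL⟩ := (((hR₀ R₀ le_rfl).and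
    (hlim.eventually_lt_const hε0)).and (hφL.eventually_ge_atTop (3 * L))).exists
  set k := φ n
  set γ := (strip 0 R₀)ᶜ.indicator (θ k)
  have hγθ : γ ≤ θ k := indicator_le_self' fun _ _ => bot_le
  have hγP : Patch s M m γ := (hθ k).indicator (measurableSet_strip 0 R₀).compl
  have hγi : imp γ ≠ ⊤ := imp_ne_top_of_le hγθ (ne_top_of_le_ne_top hK (hθK k))
  -- The remainder of the piece returns to its original position, outside heights below `k ≥ 3L`,
  -- and so misses both `A'` and `T`.
  set U := shift (-a k) γ with hU
  have hUP : Patch s M m U := hγP.shift _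
  have hUi : imp U ≠ ⊤ := by rwa [hU, imp_shift]
  have hdisj2 : ∀ x, (A' + T) x = 0 ∨ U x = 0 := by
    intro x
    by_cases hxs : x ∈ strip 0 (k : ℝ)
    · right
      exact le_antisymm ((shift_le_shift hγθ _ x).trans_eq (hθoff k x hxs)) bot_le
    · left
      have hxk : 3 * L ≤ |x.2| := by
        simp only [strip, mem_ofPred_eq, sub_zero, not_lt] at hxs
        linarith
      have h1 : A' x = 0 := by
        by_contra h
        have := hA'supp x h
        have := abs_nonneg x.2
        linarith
      have h2 : T x = 0 := by
        by_contra h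
        have h3 := abs_lt.1 (hTsupp x h)
        rcases abs_cases x.2 with ⟨h4, _⟩ | ⟨h4, _⟩ <;> linarith
      simp [h1, h2]
  have hfP := hATP.add_of_disjoint hUP hdisj2
  have hfi : imp (A' + T + U) ≠ ⊤ := by rw [imp_add hATP.meas]; finiteness
  have hJf : penEnergy s W (A' + T) + penEnergy s W γ ≤ penEnergy s W (A' + T + U) := by
    rw [penEnergy_add hs0 hs1 hATP hUP hATi hUi, hU, penEnergy_shift]
    linarith [ENNReal.toReal_nonneg (a := bil s (A' + T) (shift (-a k) γ))]
  have hJθ := penEnergy_le_of_split hs0 hs1 hW hB hγP hBi hγi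
    (ne_top_of_le_ne_top hK (hθK k)) hε0.le hb hi
  have hf_excess : ∀ τ, excess (A' + T + U) τ ≤ excess Z τ + ENNReal.ofReal (ε + ε) := by
    intro τ
    calc excess (A' + T + U) τ ≤ excess A' τ + excess T τ + excess U τ :=
          (excess_add_le_of_disjoint hATP.meas hdisj2 τ).trans
            (by gcongr; exact excess_add_le_of_disjoint hA'P.meas hdisj τ)
      _ ≤ excess A τ + (excess B τ + excess γ τ) := by
          rw [add_assoc, hT, hU, excess_shift, excess_shift]
          gcongr
          · exact excess_mono hA'A τ
          · exact excess_mono hB'B τ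
      _ ≤ excess A τ + (excess (θ k) τ + ENNReal.ofReal ε) :=
          add_le_add le_rfl (hx τ)
      _ = excess A τ + excess (θ k) τ + ENNReal.ofReal ε := by rw [add_assoc]
      _ ≤ excess Z τ + ENNReal.ofReal ε + ENNReal.ofReal ε := by
          refine add_le_add ((hθe k τ).trans (add_le_add le_rfl ?_)) le_rfl
          exact ENNReal.ofReal_le_ofReal hn.le
      _ = _ := by rw [add_assoc, ENNReal.ofReal_add hε0.le hε0.le]
  have hfinal := penEnergy_le_add_of_excess_le hs0 hs1 hW (hS _) hfP hfi (by linarith) hf_excess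
  have hSk := hθS k
  change _ ≤ S + C * (ε + ε) at hfinal
  nlinarith

end

section

/-! ### Strong convergence -/

/-- The distance `|F - G|` of `[0, ∞]`-valued functions. -/
def absDiff (F G : Plane → ℝ≥0∞) (x : Plane) : ℝ≥0∞ := (F x - G x) + (G x - F x)

variable {s W : ℝ} {M m : ℝ≥0} {A Z : Plane → ℝ≥0∞} {F : ℕ → Plane → ℝ≥0∞} {e : ℕ → ℝ}

theorem measurable_absDiff {F G : Plane → ℝ≥0∞} (hF : Measurable F) (hG : Measurable G) :
    Measurable (absDiff F G) := (hF.sub hG).add (hG.sub hF)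

theorem absDiff_shift (h : ℝ) (F G : Plane → ℝ≥0∞) :
    absDiff (shift h F) (shift h G) = shift h (absDiff F G) := rfl

/-- The expansion of the square without subtraction; a finite mixed integral can then be cancelled.
-/
theorem absDiff_sq_add {F G : Plane → ℝ≥0∞} {x : Plane} (hF : F x ≠ ⊤) (hG : G x ≠ ⊤) :
    absDiff F G x ^ 2 + 2 * (G x * F x) = F x ^ 2 + G x ^ 2 := by
  unfold absDiff
  rcases le_total (F x) (G x) with h | h
  · obtain ⟨d, hd⟩ := exists_add_of_le h
    rw [tsub_eq_zero_of_le h, hd, ENNReal.add_sub_cancel_left hF]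
    ring
  · obtain ⟨d, hd⟩ := exists_add_of_le h
    rw [tsub_eq_zero_of_le h, hd, ENNReal.add_sub_cancel_left hG]
    ring

theorem Patch.lintegral_sq_ne_top {F : Plane → ℝ≥0∞} (hF : Patch s M m F) :
    ∫⁻ x, F x ^ 2 ≠ ⊤ := by
  refine ne_top_of_le_ne_top (b := (M : ℝ≥0∞) * m) (by finiteness) ?_
  calc ∫⁻ x, F x ^ 2 ≤ ∫⁻ x, M * F x := lintegral_mono fun x => by
        rw [sq]; gcongr; exact hF.le x
    _ = M * ∫⁻ x, F x := lintegral_const_mul _ hF.meas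
    _ ≤ M * m := by gcongr; exact hF.mass

theorem tendsto_ofReal_zero (he : Tendsto e atTop (𝓝 0)) :
    Tendsto (fun n => ENNReal.ofReal (e n)) atTop (𝓝 0) := by
  simpa using ENNReal.tendsto_ofReal he

/-- Weak convergence together with an upper bound for the limiting norms gives norm convergence: the
mixed term tends to `∫ A²`. -/
theorem tendsto_lintegral_absDiff_sq (hA : Patch s M m A) (hF : ∀ n, Patch s M m (F n))
    (hw : WeakTendsto F A) (he : Tendsto e atTop (𝓝 0))
    (h2 : ∀ n, ∫⁻ x, F n x ^ 2 ≤ (∫⁻ x, A x ^ 2) + ENNReal.ofReal (e n)) :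
    Tendsto (fun n => ∫⁻ x, absDiff (F n) A x ^ 2) atTop (𝓝 0) := by
  refine ENNReal.tendsto_nhds_zero.2 fun ε hε => ?_
  have hε3 : ε / 3 ≠ 0 := ENNReal.div_ne_zero.2 ⟨hε.ne', by simp⟩
  filter_upwards [eventually_le_add_of_tendsto (hw A hA.meas hA.lintegral_sq_ne_top)
    (by simpa only [sq] using hA.lintegral_sq_ne_top) hε3,
    (tendsto_ofReal_zero he).eventually_le_const (pos_iff_ne_zero.2 hε3)] with n hn hen
  have hFm := (hF n).meas
  have hmul : Measurable fun x => A x * F n x := hA.meas.mul hFm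
  have hfin : ∫⁻ x, A x * F n x ≠ ⊤ := by
    refine ne_top_of_le_ne_top (b := (M : ℝ≥0∞) * m) (by finiteness) ?_
    calc ∫⁻ x, A x * F n x ≤ ∫⁻ x, M * F n x := lintegral_mono fun x => by
          gcongr; exact hA.le x
      _ = M * ∫⁻ x, F n x := lintegral_const_mul _ hFm
      _ ≤ M * m := by gcongr; exact (hF n).mass
  have key : (∫⁻ x, absDiff (F n) A x ^ 2) + 2 * ∫⁻ x, A x * F n x
      = (∫⁻ x, F n x ^ 2) + ∫⁻ x, A x ^ 2 := by
    rw [← lintegral_const_mul _ hmul, ← lintegral_add_right _ (hmul.const_mul 2),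
      ← lintegral_add_right _ (hA.meas.pow_const 2)]
    congr 1; funext x
    exact absDiff_sq_add ((hF n).ne_top x) (hA.ne_top x)
  have hAA : ∫⁻ x, A x ^ 2 ≤ (∫⁻ x, A x * F n x) + ε / 3 := by
    simpa only [sq] using hn.1
  refine (ENNReal.add_le_add_iff_right (a := 2 * ∫⁻ x, A x * F n x) (by finiteness)).1 ?_
  calc (∫⁻ x, absDiff (F n) A x ^ 2) + 2 * ∫⁻ x, A x * F n x
      = (∫⁻ x, F n x ^ 2) + ∫⁻ x, A x ^ 2 := key
    _ ≤ ((∫⁻ x, A x * F n x) + ε / 3 + ε / 3) + ((∫⁻ x, A x * F n x) + ε / 3) := by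
        gcongr
        exact (h2 n).trans (by gcongr)
    _ = (ε / 3 + ε / 3 + ε / 3) + 2 * ∫⁻ x, A x * F n x := by ring
    _ = _ := by rw [ENNReal.add_thirds]

/-- Inside a large box `L²` convergence suffices, through `d ≤ t + d² / t`. Outside, the total mass
of `F n` hardly exceeds that of `A` and its mass in the box is almost that of `A`, so little
remains. -/
theorem tendsto_lintegral_absDiff (hA : Patch s M m A) (hF : ∀ n, Patch s M m (F n))
    (hw : WeakTendsto F A) (he : Tendsto e atTop (𝓝 0))
    (h1 : ∀ n, ∫⁻ x, F n x ≤ (∫⁻ x, A x) + ENNReal.ofReal (e n))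
    (h2 : Tendsto (fun n => ∫⁻ x, absDiff (F n) A x ^ 2) atTop (𝓝 0)) :
    Tendsto (fun n => ∫⁻ x, absDiff (F n) A x) atTop (𝓝 0) := by
  refine ENNReal.tendsto_nhds_zero.2 fun ε hε => ?_
  set ε' := ε / 6 with hε'
  have hε0 : ε' ≠ 0 := ENNReal.div_ne_zero.2 ⟨hε.ne', by simp⟩
  obtain ⟨j, -, hj⟩ := exists_setLIntegral_compl_box_le hA.meas hA.lintegral_ne_top hε0
  replace hj := hj j le_rfl
  have hbm := measurableSet_box j
  obtain ⟨t, ht0, ht⟩ : ∃ t : ℝ≥0, t ≠ 0 ∧ t * volume (box j) ≤ ε' := by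
    obtain ⟨t, ht0, ht⟩ := ENNReal.lt_iff_exists_nnreal_btwn.1
      (pos_iff_ne_zero.2 (ENNReal.div_ne_zero.2 ⟨hε0, volume_box_ne_top j⟩))
    refine ⟨t, by simpa using ht0.ne', ?_⟩
    calc t * volume (box j) ≤ ε' / volume (box j) * volume (box j) := by gcongr
      _ ≤ ε' := by rw [mul_comm]; exact ENNReal.mul_div_le
  have htop : (t : ℝ≥0∞)⁻¹ ≠ ⊤ := ENNReal.inv_ne_top.2 (by exact_mod_cast ht0)
  have h2' := ENNReal.Tendsto.const_mul h2 (Or.inr htop)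
  rw [mul_zero] at h2'
  filter_upwards [eventually_le_add_of_tendsto (hw.setLIntegral_one hbm subset_rfl)
    (ne_top_of_le_ne_top hA.lintegral_ne_top (setLIntegral_le_lintegral _ _)) hε0,
    (tendsto_ofReal_zero he).eventually_le_const (pos_iff_ne_zero.2 hε0),
    h2'.eventually_le_const (pos_iff_ne_zero.2 hε0)] with n hn hen hn2
  have hFm := (hF n).meas
  have hDm := measurable_absDiff hFm hA.meas
  have hFc : ∫⁻ x in (box j)ᶜ, F n x ≤ ε' + ε' + ε' := by
    have hfin : ∫⁻ x in box j, F n x ≠ ⊤ :=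
      ne_top_of_le_ne_top (hF n).lintegral_ne_top (setLIntegral_le_lintegral _ _)
    refine (ENNReal.add_le_add_iff_left hfin).1 ?_
    calc (∫⁻ x in box j, F n x) + ∫⁻ x in (box j)ᶜ, F n x = ∫⁻ x, F n x :=
          lintegral_add_compl _ hbm
      _ ≤ (∫⁻ x in box j, A x) + (∫⁻ x in (box j)ᶜ, A x) + ENNReal.ofReal (e n) := by
          rw [lintegral_add_compl _ hbm]; exact h1 n
      _ ≤ ((∫⁻ x in box j, F n x) + ε') + ε' + ε' := by
          gcongr
          exact hn.1
      _ = _ := by ring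
  have hbox : ∫⁻ x in box j, absDiff (F n) A x ≤ ε' + ε' := by
    calc ∫⁻ x in box j, absDiff (F n) A x
        ≤ ∫⁻ x in box j, (t + (t : ℝ≥0∞)⁻¹ * absDiff (F n) A x ^ 2) := by
          refine lintegral_mono fun x => ?_
          rcases le_total (absDiff (F n) A x) t with h | h
          · exact le_add_right h
          · refine le_add_left ?_
            calc absDiff (F n) A x = (t : ℝ≥0∞)⁻¹ * (t * absDiff (F n) A x) := by
                  rw [← mul_assoc, ENNReal.inv_mul_cancel (by exact_mod_cast ht0)
                    ENNReal.coe_ne_top, one_mul]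
              _ ≤ _ := by rw [sq]; gcongr
      _ = t * volume (box j) + (t : ℝ≥0∞)⁻¹ * ∫⁻ x in box j, absDiff (F n) A x ^ 2 := by
          rw [lintegral_add_left measurable_const, setLIntegral_const,
            lintegral_const_mul _ (hDm.pow_const 2)]
      _ ≤ ε' + ε' := by
          gcongr
          refine le_trans ?_ hn2
          gcongr
          exact Measure.restrict_le_self
  calc ∫⁻ x, absDiff (F n) A x
      = (∫⁻ x in box j, absDiff (F n) A x) + ∫⁻ x in (box j)ᶜ, absDiff (F n) A x :=
        (lintegral_add_compl _ hbm).symm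
    _ ≤ (ε' + ε') + ((ε' + ε' + ε') + ε') := by
        gcongr
        calc ∫⁻ x in (box j)ᶜ, absDiff (F n) A x ≤ ∫⁻ x in (box j)ᶜ, (F n x + A x) :=
              lintegral_mono fun x => add_le_add tsub_le_self tsub_le_self
          _ = (∫⁻ x in (box j)ᶜ, F n x) + ∫⁻ x in (box j)ᶜ, A x := lintegral_add_left hFm _
          _ ≤ _ := by gcongr
    _ = 6 * ε' := by ring
    _ ≤ ε := ENNReal.mul_div_le

/-- Energies converge by `L¹` closeness, so near maximality with `W > 0` bounds the impulse of `F n`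
by that of `A` plus a small error. The positive part of `A - F n` has small impulse, being dominated
by `A`, and the other part is controlled by comparing totals. -/
theorem tendsto_imp_absDiff (hs0 : 0 < s) (hs1 : s < 1) (hW : 0 < W) (hA : Patch s M m A)
    (hAi : imp A ≠ ⊤) (hF : ∀ n, Patch s M m (F n)) (hFi : ∀ n, imp (F n) ≠ ⊤)
    (he : Tendsto e atTop (𝓝 0))
    (hFS : ∀ n, penEnergy s W A - e n ≤ penEnergy s W (F n))
    (h1 : Tendsto (fun n => ∫⁻ x, absDiff (F n) A x) atTop (𝓝 0)) :
    Tendsto (fun n => imp (absDiff (F n) A)) atTop (𝓝 0) := by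
  have hC := potBound_ne_top hs0 hs1 M m
  set C := potBound s M m
  -- the impulse of the limit bounds the impulses from above
  have hup : ∀ n, imp (F n) ≤ imp A
      + (ENNReal.ofReal W⁻¹ * (C * ∫⁻ x, absDiff (F n) A x) + ENNReal.ofReal (W⁻¹ * |e n|)) := by
    intro n
    have hD : ∫⁻ x, absDiff (F n) A x ≠ ⊤ := by
      refine ne_top_of_le_ne_top (b := (m : ℝ≥0∞) + m) (by finiteness) ?_
      calc ∫⁻ x, absDiff (F n) A x ≤ ∫⁻ x, (F n x + A x) :=
            lintegral_mono fun x => add_le_add tsub_le_self tsub_le_self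
        _ = (∫⁻ x, F n x) + ∫⁻ x, A x := lintegral_add_left (hF n).meas _
        _ ≤ m + m := add_le_add (hF n).mass hA.mass
    have hAA := hA.bil_ne_top hA hs0 hs1
    have hb : bil s (F n) (F n) ≤ bil s A A + 2 * (C * ∫⁻ x, absDiff (F n) A x) := by
      refine (bil_le_bil_add_lintegral_sub hs0 hs1 (hF n) hA).trans ?_
      gcongr with x
      exact le_self_add
    have hb' := ENNReal.toReal_mono (by finiteness) hb
    rw [ENNReal.toReal_add hAA (by finiteness), ENNReal.toReal_mul, ENNReal.toReal_ofNat] at hb'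
    have hS := hFS n
    unfold penEnergy at hS
    have he' := le_abs_self (e n)
    set c := (C * ∫⁻ x, absDiff (F n) A x).toReal with hc
    have hc0 : 0 ≤ c := ENNReal.toReal_nonneg
    have hi : (imp (F n)).toReal ≤ (imp A).toReal + (W⁻¹ * c + W⁻¹ * |e n|) := by
      rw [← mul_add, inv_mul_eq_div, ← sub_le_iff_le_add', le_div_iff₀ hW]
      nlinarith
    rw [← ENNReal.ofReal_toReal (hFi n)]
    refine (ENNReal.ofReal_le_ofReal hi).trans_eq ?_
    rw [ENNReal.ofReal_add ENNReal.toReal_nonneg (by positivity), ENNReal.ofReal_toReal hAi,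
      ENNReal.ofReal_add (by positivity) (by positivity), ENNReal.ofReal_mul (by positivity), hc,
      ENNReal.ofReal_toReal (by finiteness)]
  have hlow : ∀ ε : ℝ≥0∞, ε ≠ 0 → ∀ᶠ n in atTop, imp (fun x => A x - F n x) ≤ ε := by
    intro ε hε
    have hε2 : ε / 2 ≠ 0 := ENNReal.div_ne_zero.2 ⟨hε, by simp⟩
    obtain ⟨j, -, hj⟩ := exists_setLIntegral_compl_box_le (measurable_ofReal_fst_mul hA.meas)
      hAi hε2
    replace hj := hj j le_rfl
    have hbm := measurableSet_box j
    have h1' := ENNReal.Tendsto.const_mul (a := ENNReal.ofReal j) h1 (Or.inr ENNReal.ofReal_ne_top)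
    rw [mul_zero] at h1'
    filter_upwards [h1'.eventually_le_const (pos_iff_ne_zero.2 hε2)] with n hn
    have hDm := measurable_absDiff (hF n).meas hA.meas
    unfold imp
    rw [← lintegral_add_compl _ hbm]
    calc _ ≤ (∫⁻ x in box j, ENNReal.ofReal j * absDiff (F n) A x)
          + ∫⁻ x in (box j)ᶜ, ENNReal.ofReal x.1 * A x := by
          refine add_le_add (setLIntegral_mono' hbm fun x hx => ?_)
            (lintegral_mono fun x => ?_)
          · gcongr
            · exact (le_abs_self _).trans hx.1.le
            · exact le_add_self
          · gcongr
            exact tsub_le_self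
      _ ≤ ε / 2 + ε / 2 := by
          gcongr
          rw [lintegral_const_mul _ hDm]
          exact le_trans (by gcongr; exact Measure.restrict_le_self) hn
      _ = ε := ENNReal.add_halves ε
  refine ENNReal.tendsto_nhds_zero.2 fun ε hε => ?_
  have hε3 : ε / 3 ≠ 0 := ENNReal.div_ne_zero.2 ⟨hε.ne', by simp⟩
  have hsmall : Tendsto (fun n => ENNReal.ofReal W⁻¹ * (C * ∫⁻ x, absDiff (F n) A x)
      + ENNReal.ofReal (W⁻¹ * |e n|)) atTop (𝓝 0) := by
    have h3 : Tendsto (fun n => W⁻¹ * |e n|) atTop (𝓝 0) := by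
      simpa using he.abs.const_mul W⁻¹
    have h4 := ENNReal.Tendsto.const_mul (a := ENNReal.ofReal W⁻¹ * C) h1
      (Or.inr (by finiteness))
    simpa [mul_assoc] using h4.add (tendsto_ofReal_zero h3)
  filter_upwards [hlow _ hε3, hsmall.eventually_le_const (pos_iff_ne_zero.2 hε3)] with n hn1 hn2
  have hFm := (hF n).meas
  have hsub : Measurable fun x => F n x - A x := hFm.sub hA.meas
  -- Both sides are the impulse of the pointwise maximum.
  have hsum : imp (fun x => F n x - A x) + imp A = imp (F n) + imp (fun x => A x - F n x) := by
    rw [← imp_add hsub, ← imp_add hFm]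
    congr 1; funext x
    simp only [Pi.add_apply]
    rw [tsub_add_eq_max, add_tsub_eq_max]
  have h5 : imp (fun x => F n x - A x) ≤ ε / 3 + ε / 3 := by
    refine (ENNReal.add_le_add_iff_right hAi).1 ?_
    rw [hsum]
    calc _ ≤ imp A + ε / 3 + ε / 3 := by
          gcongr
          exact (hup n).trans (by gcongr)
      _ = _ := by ring
  calc imp (absDiff (F n) A) = imp (fun x => F n x - A x) + imp (fun x => A x - F n x) :=
        imp_add hsub _
    _ ≤ ε / 3 + ε / 3 + ε / 3 := by gcongr
    _ = ε := ENNReal.add_thirds ε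

/-- Almost maximizing sequences approach the set of maximizers. -/
theorem exists_maximizer_near (hs0 : 0 < s) (hs1 : s < 1) (hW : 0 < W) {S : ℝ} (hS0 : 0 < S)
    (hS : ∀ (m' : ℝ≥0) (G : Plane → ℝ≥0∞), Patch s M m' G → imp G ≠ ⊤ →
      (∀ τ, excess G τ ≤ excess Z τ) → penEnergy s W G ≤ S)
    (hZ : ∀ G : Plane → ℝ≥0∞, Patch s M m G → imp G ≠ ⊤ →
      (∀ τ, excess G τ ≤ excess Z τ) → penEnergy s W G = S →
      ∫⁻ x, Z x = ∫⁻ x, G x ∧ ∫⁻ x, Z x ^ 2 = ∫⁻ x, G x ^ 2)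
    (hF : ∀ n, Patch s M m (F n)) {K : ℝ≥0∞} (hK : K ≠ ⊤) (hFK : ∀ n, imp (F n) ≤ K)
    (he : Tendsto e atTop (𝓝 0))
    (hFe : ∀ n τ, excess (F n) τ ≤ excess Z τ + ENNReal.ofReal (e n))
    (hF2 : ∀ n, ∫⁻ x, F n x ^ 2 ≤ (∫⁻ x, Z x ^ 2) + ENNReal.ofReal (e n))
    (hFS : ∀ n, S - e n ≤ penEnergy s W (F n)) {η : ℝ≥0∞} (hη : η ≠ 0) :
    ∃ n G, Patch s M m G ∧ imp G ≠ ⊤ ∧ (∀ τ, excess G τ ≤ excess Z τ) ∧ penEnergy s W G = S ∧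
      (∫⁻ x, absDiff (F n) G x) + (∫⁻ x, absDiff (F n) G x ^ 2) ^ (1 / 2 : ℝ)
        + imp (absDiff (F n) G) ≤ η := by
  -- From `n₀` on the penalized energy exceeds `S / 2`, so the quadratic form, which is twice the
  -- energy, exceeds `S`.
  obtain ⟨n₀, hn₀⟩ := eventually_atTop.1 (he.eventually_lt_const (half_pos hS0))
  obtain ⟨R, -, σ, hσ, hstrip⟩ := exists_strip_mass_of_le_bil hs0 hs1 M m
    (d := ENNReal.ofReal S) (by simpa using hS0) ENNReal.ofReal_ne_top
  have hmass : ∀ n, ∃ a : ℝ, σ ≤ ∫⁻ y in strip a R, F (n + n₀) y := fun n => by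
    refine hstrip _ (hF _) (ENNReal.ofReal_le_of_le_toReal ?_)
    have h1 := hFS (n + n₀)
    have h2 := hn₀ (n + n₀) (Nat.le_add_left _ _)
    have h3 : 0 ≤ W * (imp (F (n + n₀))).toReal := by positivity
    unfold penEnergy at h1
    linarith
  choose a ha using hmass
  obtain ⟨φ, hφ, A, hA, hw⟩ := exists_weakTendsto
    (F := fun n => shift (a n) (F (n + n₀))) fun n => (hF _).shift _
  set H : ℕ → Plane → ℝ≥0∞ := fun n => shift (a (φ n)) (F (φ n + n₀)) with hH
  set e' : ℕ → ℝ := fun n => e (φ n + n₀)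
  have he' : Tendsto e' atTop (𝓝 0) :=
    he.comp ((tendsto_add_atTop_nat n₀).comp hφ.tendsto_atTop)
  have hHP : ∀ n, Patch s M m (H n) := fun n => (hF _).shift _
  have hHK : ∀ n, imp (H n) ≤ K := fun n => (imp_shift _ _).le.trans (hFK _)
  have hHe : ∀ n τ, excess (H n) τ ≤ excess Z τ + ENNReal.ofReal (e' n) := fun n τ =>
    (excess_shift _ _ _).le.trans (hFe _ _)
  have hHS : ∀ n, S - e' n ≤ penEnergy s W (H n) := fun n => by
    rw [hH, penEnergy_shift]; exact hFS _
  have hA0 : ∫⁻ x, A x ≠ 0 := hw.lintegral_ne_zero hHP hK hHK (R := R) hσ fun n => by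
    rw [hH, setLIntegral_strip_shift, zero_add]; exact ha _
  have hAi : imp A ≠ ⊤ := ne_top_of_le_ne_top hK (hw.imp_le hHK)
  have hAdom : ∀ τ, excess A τ ≤ excess Z τ := by
    intro τ
    refine le_of_forall_pos_le_add fun ε hε => ?_
    have hε2 : ε / 2 ≠ 0 := ENNReal.div_ne_zero.2 ⟨hε.ne', by simp⟩
    obtain ⟨R₀, hR₀⟩ := eventually_split hs0 hs1 hA hw hHP hK hHK hε2
    obtain ⟨n, ⟨-, -, hn⟩, hen⟩ := ((hR₀ R₀ le_rfl).and
      ((tendsto_ofReal_zero he').eventually_le_const (pos_iff_ne_zero.2 hε2))).exists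
    calc excess A τ ≤ excess (H n) τ + ε / 2 := le_self_add.trans (hn τ)
      _ ≤ (excess Z τ + ε / 2) + ε / 2 := by
          gcongr
          exact (hHe n τ).trans (by gcongr)
      _ = excess Z τ + ε := by rw [add_assoc, ENNReal.add_halves]
  have hAS : penEnergy s W A = S := le_antisymm (hS m A hA hAi hAdom)
    (le_penEnergy_of_weakTendsto hs0 hs1 hW hS hHP hK hHK hA hw hA0 he' hHe hHS)
  -- Optimality forces `A` to have the full mass and `L²` norm of `Z`; this upgrades weak to strong
  -- convergence.
  obtain ⟨hZ1, hZ2⟩ := hZ A hA hAi hAdom hAS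
  have hL2 := tendsto_lintegral_absDiff_sq hA hHP hw he' fun n => by
    rw [← hZ2]
    exact (lintegral_shift _ fun x => F (φ n + n₀) x ^ 2).le.trans (hF2 _)
  have hL1 := tendsto_lintegral_absDiff hA hHP hw he' (fun n => by
    have := hHe n 0
    rwa [excess_zero, excess_zero, hZ1] at this) hL2
  have hLi := tendsto_imp_absDiff hs0 hs1 hW hA hAi hHP (fun n => ne_top_of_le_ne_top hK (hHK n))
    he' (fun n => by rw [hAS]; exact hHS n) hL1
  have hL2' : Tendsto (fun n => (∫⁻ x, absDiff (H n) A x ^ 2) ^ (1 / 2 : ℝ)) atTop (𝓝 0) := by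
    have := (ENNReal.continuous_rpow_const (y := (1 / 2 : ℝ))).tendsto 0 |>.comp hL2
    simpa [Function.comp_def] using this
  have hall := (hL1.add hL2').add hLi
  simp only [add_zero] at hall
  obtain ⟨n, hn⟩ := (hall.eventually_le_const (pos_iff_ne_zero.2 hη)).exists
  -- The vertical shift is undone. A translate of `A` keeps its excess and penalized energy.
  refine ⟨φ n + n₀, shift (-a (φ n)) A, hA.shift _, by rwa [imp_shift], fun τ => by
    rw [excess_shift]; exact hAdom τ, by rw [penEnergy_shift, hAS], ?_⟩
  have hback : F (φ n + n₀) = shift (-a (φ n)) (H n) := by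
    rw [hH, shift_shift, neg_add_cancel, shift_zero]
  rw [hback, absDiff_shift, imp_shift, lintegral_shift]
  have : ∫⁻ x, shift (-a (φ n)) (absDiff (H n) A) x ^ 2 = ∫⁻ x, absDiff (H n) A x ^ 2 :=
    lintegral_shift _ fun x => absDiff (H n) A x ^ 2
  rw [this]
  exact hn

end

section

/-! ### Real-valued representatives -/

variable {s W : ℝ} {M m : ℝ≥0} {F G : Plane → ℝ≥0∞} {ζ ξ : Plane → ℝ}

theorem setLIntegral_eq_lintegral {S : Set Plane} (hS : MeasurableSet S) {f : Plane → ℝ≥0∞}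
    (h : ∀ᵐ x, x ∉ S → f x = 0) : ∫⁻ x in S, f x = ∫⁻ x, f x := by
  rw [← lintegral_indicator hS]
  refine lintegral_congr_ae ?_
  filter_upwards [h] with x hx
  by_cases hxS : x ∈ S
  · rw [indicator_of_mem hxS]
  · rw [indicator_of_notMem hxS, hx hxS]

theorem measurableSet_halfPlane : MeasurableSet halfPlane :=
  measurableSet_lt measurable_const measurable_fst

/-- Bounded integrable functions are represented by patches. -/
theorem exists_patch (hm : AEMeasurable ζ) (hoff : VanishesOff (domain s) ζ)
    (hM : ∀ᵐ x, ζ x ≤ M) (hmass : ∫⁻ x, ENNReal.ofReal (ζ x) ≤ m) :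
    ∃ F, Patch s M m F ∧ F =ᵐ[volume] fun x => ENNReal.ofReal (ζ x) := by
  set F : Plane → ℝ≥0∞ := (domain s).indicator fun x => min M (ENNReal.ofReal (hm.mk ζ x)) with hF
  have hFζ : F =ᵐ[volume] fun x => ENNReal.ofReal (ζ x) := by
    filter_upwards [hm.ae_eq_mk, hoff, hM] with x h1 h2 h3
    by_cases hx : x ∈ domain s
    · have h4 : ENNReal.ofReal (ζ x) ≤ M := by
        rw [← ENNReal.ofReal_coe_nnreal]; exact ENNReal.ofReal_le_ofReal h3
      simp only [hF, indicator_of_mem hx]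
      rw [← h1, min_eq_right h4]
    · simp [hF, hx, h2 hx]
  refine ⟨F, ⟨?_, fun x => ?_, fun x hx => indicator_of_notMem hx _, ?_⟩, hFζ⟩
  · exact (measurable_const.min hm.measurable_mk.ennreal_ofReal).indicator (measurableSet_domain s)
  · exact (indicator_le_self' (fun _ _ => bot_le) x).trans (min_le_left _ _)
  · exact (lintegral_congr_ae hFζ).le.trans hmass

/-- The kernel is positive off the diagonal, a null set, so the Bochner integral agrees with the
`[0, ∞]`-valued one. -/
theorem potentialPlus_eq (hs0 : 0 < s) (hs1 : s < 1) (hF : Patch s M m F) (h0 : 0 ≤ᵐ[volume] ζ)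
    (h : F =ᵐ[volume] fun x => ENNReal.ofReal (ζ x)) {x : Plane} (hx : 0 < x.1) :
    potentialPlus s ζ x = (pot s F x).toReal := by
  have hne : ∀ᵐ y : Plane, y ≠ x := by simp [ae_iff]
  have h1 : ∫ y in halfPlane, greenPlus s x y * ζ y
      = ∫ y in halfPlane, (kern s x y * F y).toReal := by
    refine setIntegral_congr_ae measurableSet_halfPlane ?_
    filter_upwards [hne, h, h0] with y hy1 hy2 hy3 hyH
    have hg := (greenPlus_pos hs0 hs1 hx hyH hy1.symm).le
    rw [hy2, kern, ENNReal.toReal_mul, ENNReal.toReal_ofReal hg, ENNReal.toReal_ofReal hy3]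
  rw [potentialPlus, h1, integral_toReal ((measurable_kern_right s x).fun_mul hF.meas).aemeasurable
    (Eventually.of_forall fun y => ENNReal.mul_lt_top ENNReal.ofReal_lt_top (hF.ne_top y).lt_top),
    setLIntegral_eq_lintegral measurableSet_halfPlane]
  · rfl
  · refine Eventually.of_forall fun y hy => ?_
    simp [hF.off y fun hD => hy (domain_subset_halfPlane s hD)]

theorem energy_eq (hs0 : 0 < s) (hs1 : s < 1) (hF : Patch s M m F) (h0 : 0 ≤ᵐ[volume] ζ)
    (h : F =ᵐ[volume] fun x => ENNReal.ofReal (ζ x)) :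
    energy s ζ = (bil s F F).toReal / 2 := by
  have hpot : ∀ x, pot s F x ≠ ⊤ := fun x =>
    ne_top_of_le_ne_top (potBound_ne_top hs0 hs1 M m) (hF.pot_le hs0 hs1 x)
  have h1 : ∫ x in domain s, ζ x * potentialPlus s ζ x
      = ∫ x in domain s, (F x * pot s F x).toReal := by
    refine setIntegral_congr_ae (measurableSet_domain s) ?_
    filter_upwards [h, h0] with x hx1 hx2 hxD
    rw [potentialPlus_eq hs0 hs1 hF h0 h (domain_subset_halfPlane s hxD), hx1,
      ENNReal.toReal_mul, ENNReal.toReal_ofReal hx2]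
  rw [energy, h1, integral_toReal (hF.meas.fun_mul (measurable_pot s hF.meas)).aemeasurable
    (Eventually.of_forall fun x => ENNReal.mul_lt_top (hF.ne_top x).lt_top (hpot x).lt_top),
    setLIntegral_eq_lintegral (measurableSet_domain s)]
  · rw [bil]; ring
  · exact Eventually.of_forall fun x hx => by simp [hF.off x hx]

theorem impulse_eq (hoff : ∀ x ∉ domain s, F x = 0) (h0 : 0 ≤ᵐ[volume] ζ)
    (h : F =ᵐ[volume] fun x => ENNReal.ofReal (ζ x)) : impulse s ζ = (imp F : EReal) := by
  have h1 : ∫⁻ x in domain s, ENNReal.ofReal (x.1 * ζ x) = imp F := by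
    rw [imp, ← setLIntegral_eq_lintegral (measurableSet_domain s)
      (Eventually.of_forall fun x hx => by simp [hoff x hx])]
    refine setLIntegral_congr_fun_ae (measurableSet_domain s) ?_
    filter_upwards [h] with x hx hxD
    rw [hx, ENNReal.ofReal_mul (domain_subset_halfPlane s hxD : 0 < x.1).le]
  have h2 : ∫⁻ x in domain s, ENNReal.ofReal (-(x.1 * ζ x)) = 0 := by
    rw [← lintegral_zero (μ := volume.restrict (domain s))]
    refine setLIntegral_congr_fun_ae (measurableSet_domain s) ?_
    filter_upwards [h0] with x hx hxD
    have : 0 < x.1 := domain_subset_halfPlane s hxD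
    exact ENNReal.ofReal_of_nonpos (neg_nonpos.2 (mul_nonneg this.le hx))
  rw [impulse, h1, h2]
  simp

theorem energyImpulse_eq (hs0 : 0 < s) (hs1 : s < 1) (hF : Patch s M m F)
    (h0 : 0 ≤ᵐ[volume] ζ) (h : F =ᵐ[volume] fun x => ENNReal.ofReal (ζ x)) (hi : imp F ≠ ⊤) :
    energyImpulse s W ζ = (penEnergy s W F : EReal) := by
  rw [energyImpulse, impulse_eq hF.off h0 h, energy_eq hs0 hs1 hF h0 h, penEnergy,
    EReal.coe_sub, EReal.coe_mul]
  congr 2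
  lift imp F to ℝ≥0 using hi with c
  rfl

theorem imp_ne_top_of_energyImpulse (hW : 0 < W) (hoff : ∀ x ∉ domain s, F x = 0)
    (h0 : 0 ≤ᵐ[volume] ζ) (h : F =ᵐ[volume] fun x => ENNReal.ofReal (ζ x))
    (hne : energyImpulse s W ζ ≠ ⊥) : imp F ≠ ⊤ := by
  intro hi
  refine hne ?_
  rw [energyImpulse, impulse_eq hoff h0 h, hi, EReal.coe_ennreal_top, EReal.coe_mul_top_of_pos hW]
  simp

theorem excess_eq (h : F =ᵐ[volume] fun x => ENNReal.ofReal (ζ x)) {α : ℝ} (hα : 0 ≤ α) :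
    excess F (ENNReal.ofReal α) = ∫⁻ x, ENNReal.ofReal (ζ x - α) := by
  refine lintegral_congr_ae ?_
  filter_upwards [h] with x hx
  rw [hx, ENNReal.ofReal_sub _ hα]

theorem excess_eq_setLIntegral (hoff : ∀ x ∉ domain s, F x = 0)
    (h : F =ᵐ[volume] fun x => ENNReal.ofReal (ζ x)) {α : ℝ} (hα : 0 ≤ α) :
    excess F (ENNReal.ofReal α) = ∫⁻ x in domain s, ENNReal.ofReal (ζ x - α) := by
  rw [excess_eq h hα, setLIntegral_eq_lintegral (measurableSet_domain s)]
  filter_upwards [h] with x hx hxD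
  rw [ENNReal.ofReal_sub _ hα, ← hx, hoff x hxD, zero_tsub]

theorem excess_top (F : Plane → ℝ≥0∞) : excess F ⊤ = 0 := by simp [excess]

/-! ### Equimeasurable functions -/

/-- By the layer-cake formula the excess at `α` integrates the measures of superlevel sets at levels
above `α`; only positive levels occur. -/
theorem lintegral_ofReal_sub_eq_of_equimeasurable (hζm : AEMeasurable ζ) (hξm : AEMeasurable ξ)
    (h : ∀ τ : ℝ, 0 < τ → volume {x | τ < ζ x} = volume {x | τ < ξ x}) {α : ℝ} (hα : 0 ≤ α) :
    ∫⁻ x, ENNReal.ofReal (ζ x - α) = ∫⁻ x, ENNReal.ofReal (ξ x - α) := by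
  have key : ∀ f : Plane → ℝ, AEMeasurable f → ∫⁻ x, ENNReal.ofReal (f x - α)
      = ∫⁻ t in Ioi (0 : ℝ), volume {x | t + α < f x} := by
    intro f hf
    have h1 := lintegral_eq_lintegral_meas_lt volume (f := fun x => max (f x - α) 0)
      (Eventually.of_forall fun x => le_max_right _ _)
      ((hf.sub_const α).max aemeasurable_const)
    have h2 : ∀ x, ENNReal.ofReal (max (f x - α) 0) = ENNReal.ofReal (f x - α) := fun x => by
      rw [ENNReal.ofReal_max, ENNReal.ofReal_zero, max_eq_left zero_le]
    simp only [h2] at h1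
    rw [h1]
    refine setLIntegral_congr_fun measurableSet_Ioi fun t ht => ?_
    congr 1
    ext x
    have ht' : 0 < t := ht
    simp only [mem_ofPred_eq, lt_max_iff]
    constructor
    · rintro (h | h) <;> linarith
    · intro h; left; linarith
  rw [key ζ hζm, key ξ hξm]
  exact setLIntegral_congr_fun measurableSet_Ioi fun t ht => h _ (add_pos_of_pos_of_nonneg ht hα)

theorem lintegral_ofReal_sq_eq_of_equimeasurable (hζm : AEMeasurable ζ) (hξm : AEMeasurable ξ)
    (hζ0 : 0 ≤ᵐ[volume] ζ) (hξ0 : 0 ≤ᵐ[volume] ξ)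
    (h : ∀ τ : ℝ, 0 < τ → volume {x | τ < ζ x} = volume {x | τ < ξ x}) :
    ∫⁻ x, ENNReal.ofReal (ζ x) ^ 2 = ∫⁻ x, ENNReal.ofReal (ξ x) ^ 2 := by
  have key : ∀ f : Plane → ℝ, AEMeasurable f → 0 ≤ᵐ[volume] f →
      ∫⁻ x, ENNReal.ofReal (f x) ^ 2 = ENNReal.ofReal 2 *
        ∫⁻ t in Ioi (0 : ℝ), volume {x | t < f x} * ENNReal.ofReal (t ^ ((2 : ℝ) - 1)) := by
    intro f hf hf0
    rw [← lintegral_rpow_eq_lintegral_meas_lt_mul volume hf0 hf two_pos]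
    refine lintegral_congr_ae ?_
    filter_upwards [hf0] with x hx
    rw [← ENNReal.ofReal_pow hx, Real.rpow_two]
  rw [key ζ hζm hζ0, key ξ hξm hξ0]
  congr 1
  exact setLIntegral_congr_fun measurableSet_Ioi fun t ht => by simp only [h t ht]

theorem ae_le_of_equimeasurable
    (h : ∀ τ : ℝ, 0 < τ → volume {x | τ < ζ x} = volume {x | τ < ξ x}) {c : ℝ} (hc : 0 < c)
    (hξ : ∀ᵐ x, ξ x ≤ c) : ∀ᵐ x, ζ x ≤ c := by
  rw [ae_iff] at hξ ⊢
  simp only [not_le] at hξ ⊢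
  rw [h c hc, hξ]

/-- Patches representing equimeasurable functions have equal excess and equal `L²` norm. -/
theorem excess_eq_of_equimeasurable (hF : F =ᵐ[volume] fun x => ENNReal.ofReal (ζ x))
    (hG : G =ᵐ[volume] fun x => ENNReal.ofReal (ξ x)) (hζm : AEMeasurable ζ) (hξm : AEMeasurable ξ)
    (h : ∀ τ : ℝ, 0 < τ → volume {x | τ < ζ x} = volume {x | τ < ξ x}) (τ : ℝ≥0∞) :
    excess F τ = excess G τ := by
  rcases eq_or_ne τ ⊤ with rfl | hτ
  · simp [excess_top]
  rw [← ENNReal.ofReal_toReal hτ, excess_eq hF ENNReal.toReal_nonneg,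
    excess_eq hG ENNReal.toReal_nonneg,
    lintegral_ofReal_sub_eq_of_equimeasurable hζm hξm h ENNReal.toReal_nonneg]

theorem lintegral_sq_eq_of_equimeasurable (hF : F =ᵐ[volume] fun x => ENNReal.ofReal (ζ x))
    (hG : G =ᵐ[volume] fun x => ENNReal.ofReal (ξ x)) (hζm : AEMeasurable ζ) (hξm : AEMeasurable ξ)
    (hζ0 : 0 ≤ᵐ[volume] ζ) (hξ0 : 0 ≤ᵐ[volume] ξ)
    (h : ∀ τ : ℝ, 0 < τ → volume {x | τ < ζ x} = volume {x | τ < ξ x}) :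
    ∫⁻ x, F x ^ 2 = ∫⁻ x, G x ^ 2 := by
  have h1 : ∫⁻ x, F x ^ 2 = ∫⁻ x, ENNReal.ofReal (ζ x) ^ 2 :=
    lintegral_congr_ae (by filter_upwards [hF] with x hx; rw [hx])
  have h2 : ∫⁻ x, G x ^ 2 = ∫⁻ x, ENNReal.ofReal (ξ x) ^ 2 :=
    lintegral_congr_ae (by filter_upwards [hG] with x hx; rw [hx])
  rw [h1, h2, lintegral_ofReal_sq_eq_of_equimeasurable hζm hξm hζ0 hξ0 h]

/-! ### Distances of real-valued functions -/

theorem ofReal_abs_sub {a b : ℝ} (ha : 0 ≤ a) (hb : 0 ≤ b) : ENNReal.ofReal |a - b|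
    = (ENNReal.ofReal a - ENNReal.ofReal b) + (ENNReal.ofReal b - ENNReal.ofReal a) := by
  rw [← ENNReal.ofReal_sub _ hb, ← ENNReal.ofReal_sub _ ha]
  rcases le_total a b with h | h
  · rw [abs_of_nonpos (by linarith), ENNReal.ofReal_of_nonpos (by linarith : a - b ≤ 0), zero_add,
      neg_sub]
  · rw [abs_of_nonneg (by linarith), ENNReal.ofReal_of_nonpos (by linarith : b - a ≤ 0), add_zero]

theorem absDiff_ae_eq (hζ0 : 0 ≤ᵐ[volume] ζ) (hξ0 : 0 ≤ᵐ[volume] ξ)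
    (hF : F =ᵐ[volume] fun x => ENNReal.ofReal (ζ x))
    (hG : G =ᵐ[volume] fun x => ENNReal.ofReal (ξ x)) :
    absDiff F G =ᵐ[volume] fun x => ENNReal.ofReal |ζ x - ξ x| := by
  filter_upwards [hζ0, hξ0, hF, hG] with x h1 h2 h3 h4
  rw [absDiff, h3, h4, ofReal_abs_sub h1 h2]

theorem eLpNorm_sub_one_eq (hζ0 : 0 ≤ᵐ[volume] ζ) (hξ0 : 0 ≤ᵐ[volume] ξ)
    (hF : F =ᵐ[volume] fun x => ENNReal.ofReal (ζ x))
    (hG : G =ᵐ[volume] fun x => ENNReal.ofReal (ξ x)) :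
    eLpNorm (ζ - ξ) 1 volume = ∫⁻ x, absDiff F G x := by
  rw [eLpNorm_one_eq_lintegral_enorm, lintegral_congr_ae (absDiff_ae_eq hζ0 hξ0 hF hG)]
  simp only [Pi.sub_apply, ← ofReal_norm, Real.norm_eq_abs]

theorem eLpNorm_sub_two_eq (hζ0 : 0 ≤ᵐ[volume] ζ) (hξ0 : 0 ≤ᵐ[volume] ξ)
    (hF : F =ᵐ[volume] fun x => ENNReal.ofReal (ζ x))
    (hG : G =ᵐ[volume] fun x => ENNReal.ofReal (ξ x)) :
    eLpNorm (ζ - ξ) 2 volume = (∫⁻ x, absDiff F G x ^ 2) ^ (1 / 2 : ℝ) := by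
  rw [eLpNorm_eq_lintegral_rpow_enorm_toReal two_ne_zero ENNReal.ofNat_ne_top]
  simp only [ENNReal.toReal_ofNat, ENNReal.rpow_two]
  congr 1
  refine lintegral_congr_ae ?_
  filter_upwards [absDiff_ae_eq hζ0 hξ0 hF hG] with x hx
  rw [hx, Pi.sub_apply, ← ofReal_norm, Real.norm_eq_abs]

theorem impulse_abs_sub_eq (hFo : ∀ x ∉ domain s, F x = 0) (hGo : ∀ x ∉ domain s, G x = 0)
    (hζ0 : 0 ≤ᵐ[volume] ζ) (hξ0 : 0 ≤ᵐ[volume] ξ)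
    (hF : F =ᵐ[volume] fun x => ENNReal.ofReal (ζ x))
    (hG : G =ᵐ[volume] fun x => ENNReal.ofReal (ξ x)) :
    (impulse s fun x => |ζ x - ξ x|).toENNReal = imp (absDiff F G) := by
  rw [impulse_eq (F := absDiff F G) (fun x hx => by simp [absDiff, hFo x hx, hGo x hx])
    (Eventually.of_forall fun x => abs_nonneg _) (absDiff_ae_eq hζ0 hξ0 hF hG)]
  exact EReal.toENNReal_coe

/-- The impulses of two functions differ by at most the impulse of the difference. -/
theorem imp_le_add_of_impulse_sub (hFo : Patch s M m F) (hGo : Patch s M m G)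
    (hζ0 : 0 ≤ᵐ[volume] ζ) (hξ0 : 0 ≤ᵐ[volume] ξ)
    (hF : F =ᵐ[volume] fun x => ENNReal.ofReal (ζ x))
    (hG : G =ᵐ[volume] fun x => ENNReal.ofReal (ξ x)) {δ : ℝ}
    (h : (impulse s (ζ - ξ)).abs ≤ ENNReal.ofReal δ) : imp F ≤ imp G + ENNReal.ofReal δ := by
  set P := ∫⁻ x in domain s, ENNReal.ofReal (x.1 * (ζ - ξ) x)
  set N := ∫⁻ x in domain s, ENNReal.ofReal (-(x.1 * (ζ - ξ) x))
  -- The identity is kept free of subtraction, so it holds even when some terms are infinite.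
  have hsum : imp F + N = imp G + P := by
    have h1 : ∀ {H : Plane → ℝ≥0∞}, Patch s M m H →
        imp H = ∫⁻ x in domain s, ENNReal.ofReal x.1 * H x := fun hH =>
      (setLIntegral_eq_lintegral (measurableSet_domain s)
        (Eventually.of_forall fun x hx => by simp [hH.off x hx])).symm
    rw [h1 hFo, h1 hGo, ← lintegral_add_left (measurable_ofReal_fst_mul hFo.meas),
      ← lintegral_add_left (measurable_ofReal_fst_mul hGo.meas)]
    refine setLIntegral_congr_fun_ae (measurableSet_domain s) ?_
    filter_upwards [hF, hG, hζ0, hξ0] with x h1 h2 h3 h4 hxD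
    have hx : 0 < x.1 := domain_subset_halfPlane s hxD
    simp only [Pi.zero_apply] at h3 h4
    rw [h1, h2, ← ENNReal.ofReal_mul hx.le, ← ENNReal.ofReal_mul hx.le, Pi.sub_apply]
    rcases le_total (ζ x) (ξ x) with hle | hle
    · have : x.1 * (ζ x - ξ x) ≤ 0 := mul_nonpos_of_nonneg_of_nonpos hx.le (by linarith)
      rw [ENNReal.ofReal_of_nonpos this, add_zero,
        ← ENNReal.ofReal_add (mul_nonneg hx.le h3) (by linarith)]
      congr 1; ring
    · have : 0 ≤ x.1 * (ζ x - ξ x) := mul_nonneg hx.le (by linarith)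
      rw [ENNReal.ofReal_of_nonpos (by linarith : -(x.1 * (ζ x - ξ x)) ≤ 0), add_zero,
        ← ENNReal.ofReal_add (mul_nonneg hx.le h4) this]
      congr 1; ring
  have himp : impulse s (ζ - ξ) = (P : EReal) - (N : EReal) := rfl
  rw [himp] at h
  clear himp
  clear_value P N
  -- In `EReal` the difference `⊤ - ⊤` is `⊥`, whose absolute value is `⊤`; hence a finite bound
  -- forces both parts to be finite.
  have hPt : P ≠ ⊤ := by
    intro hPt
    rw [hPt] at h
    rcases eq_or_ne N ⊤ with hNt | hNt
    · rw [hNt] at h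
      simp at h
    · lift N to ℝ≥0 using hNt
      rw [EReal.coe_ennreal_top, EReal.top_sub (by simp)] at h
      simp at h
  have hNt : N ≠ ⊤ := by
    intro hNt
    rw [hNt] at h
    simp at h
  have hPN : P ≤ N + ENNReal.ofReal δ := by
    lift P to ℝ≥0 using hPt
    lift N to ℝ≥0 using hNt
    have e : ((P : ℝ≥0∞) : EReal) - ((N : ℝ≥0∞) : EReal) = (((P : ℝ) - (N : ℝ) : ℝ) : EReal) := rfl
    rw [e, EReal.abs_def] at h
    calc (P : ℝ≥0∞) = ENNReal.ofReal P := (ENNReal.ofReal_coe_nnreal).symm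
      _ ≤ ENNReal.ofReal (N + |(P : ℝ) - N|) :=
          ENNReal.ofReal_le_ofReal (by linarith [le_abs_self ((P : ℝ) - N)])
      _ = N + ENNReal.ofReal |(P : ℝ) - N| := by
          rw [ENNReal.ofReal_add (by positivity) (abs_nonneg _), ENNReal.ofReal_coe_nnreal]
      _ ≤ _ := by gcongr
  refine (ENNReal.add_le_add_iff_right hNt).1 ?_
  rw [hsum, add_assoc, add_comm (ENNReal.ofReal δ)]
  gcongr

end

section

/-! ### Maximizers and regular solutions -/

variable {s W : ℝ} {M m : ℝ≥0} {F G Z : Plane → ℝ≥0∞} {ζ₀ ζ ξ₀ : Plane → ℝ}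

theorem Patch.ae_le_of_repr (hF : Patch s M m F)
    (h : F =ᵐ[volume] fun x => ENNReal.ofReal (ζ x)) : ∀ᵐ x, ζ x ≤ M := by
  filter_upwards [h] with x hx
  have h1 := hF.le x
  rw [hx, ← ENNReal.ofReal_coe_nnreal] at h1
  exact (ENNReal.ofReal_le_ofReal_iff M.coe_nonneg).1 h1

/-- Rearrangements of a function represented by a patch are represented by patches. -/
theorem exists_patch_of_mem_rearrangements (hM : 0 < M) (hZ : Patch s M m Z)
    (hZζ : Z =ᵐ[volume] fun x => ENNReal.ofReal (ζ₀ x)) (hm : AEMeasurable ζ₀)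
    (h0 : 0 ≤ᵐ[volume] ζ₀) (hζ : ζ ∈ rearrangements s ζ₀) :
    ∃ F, Patch s M m F ∧ F =ᵐ[volume] (fun x => ENNReal.ofReal (ζ x)) ∧
      (∀ τ, excess F τ = excess Z τ) ∧ ∫⁻ x, F x ^ 2 = ∫⁻ x, Z x ^ 2 := by
  obtain ⟨hζ0, hoff, hint, heq⟩ := hζ
  have hζm := hint.aestronglyMeasurable.aemeasurable
  have hmass : ∫⁻ x, ENNReal.ofReal (ζ x) ≤ m := by
    have h1 := lintegral_ofReal_sub_eq_of_equimeasurable hζm hm heq le_rfl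
    simp only [sub_zero] at h1
    rw [h1, ← lintegral_congr_ae hZζ]
    exact hZ.mass
  obtain ⟨F, hF, hFζ⟩ := exists_patch (s := s) hζm hoff
    (ae_le_of_equimeasurable heq (NNReal.coe_pos.2 hM) (hZ.ae_le_of_repr hZζ)) hmass
  exact ⟨F, hF, hFζ, excess_eq_of_equimeasurable hFζ hZζ hζm hm heq,
    lintegral_sq_eq_of_equimeasurable hFζ hZζ hζm hm hζ0 h0 heq⟩

theorem Patch.ofReal_toReal (hG : Patch s M m G) :
    G =ᵐ[volume] fun x => ENNReal.ofReal (G x).toReal :=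
  Eventually.of_forall fun x => (ENNReal.ofReal_toReal (hG.ne_top x)).symm

theorem toReal_mem_weakClosure (hZ : ∀ x ∉ domain s, Z x = 0)
    (hZζ : Z =ᵐ[volume] fun x => ENNReal.ofReal (ζ₀ x)) (hG : Patch s M m G)
    (h : ∀ τ, excess G τ ≤ excess Z τ) : (fun x => (G x).toReal) ∈ weakClosure s ζ₀ := by
  refine ⟨hG.meas.ennreal_toReal.aemeasurable,
    Eventually.of_forall fun x => ENNReal.toReal_nonneg,
    Eventually.of_forall fun x hx => by simp [hG.off x hx], fun α hα => ?_⟩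
  rw [← excess_eq_setLIntegral hG.off hG.ofReal_toReal hα.le,
    ← excess_eq_setLIntegral hZ hZζ hα.le]
  exact h _

/-- The zero function is a competitor of finite value, so a maximizer cannot have the value `⊥`. -/
theorem imp_ne_top_of_mem_maximizers (hs0 : 0 < s) (hs1 : s < 1) (hW : 0 < W)
    (hζ : ζ ∈ maximizers s W ζ₀) (hF : Patch s M m F)
    (hFζ : F =ᵐ[volume] fun x => ENNReal.ofReal (ζ x)) : imp F ≠ ⊤ := by
  refine imp_ne_top_of_energyImpulse hW hF.off hζ.1.2.1 hFζ fun hbot => ?_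
  have h0P : Patch s 0 0 (0 : Plane → ℝ≥0∞) :=
    ⟨measurable_const, fun x => by simp, fun x _ => rfl, by simp⟩
  have h0i : imp (0 : Plane → ℝ≥0∞) ≠ ⊤ := by simp [imp]
  have h0 : (0 : Plane → ℝ) ∈ weakClosure s ζ₀ := by
    refine ⟨aemeasurable_const, Eventually.of_forall fun x => le_rfl,
      Eventually.of_forall fun x _ => rfl, fun α hα => ?_⟩
    have : ∀ x : Plane, ENNReal.ofReal ((0 : Plane → ℝ) x - α) = 0 := fun x =>
      ENNReal.ofReal_of_nonpos (by simp [hα.le])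
    rw [lintegral_congr this, lintegral_zero]
    exact bot_le
  have h1 : energyImpulse s W 0 ≤ energyImpulse s W ζ := hζ.2 h0
  rw [hbot, energyImpulse_eq hs0 hs1 h0P (Eventually.of_forall fun x => le_rfl)
    (Eventually.of_forall fun x => by simp) h0i] at h1
  simp at h1

theorem penEnergy_le_of_mem_maximizers (hs0 : 0 < s) (hs1 : s < 1) (hW : 0 < W)
    (hζ : ζ ∈ maximizers s W ζ₀) (hF : Patch s M m F)
    (hFζ : F =ᵐ[volume] fun x => ENNReal.ofReal (ζ x)) (hZ : ∀ x ∉ domain s, Z x = 0)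
    (hZζ : Z =ᵐ[volume] fun x => ENNReal.ofReal (ζ₀ x)) {M' m' : ℝ≥0} (hG : Patch s M' m' G)
    (hGi : imp G ≠ ⊤) (h : ∀ τ, excess G τ ≤ excess Z τ) :
    penEnergy s W G ≤ penEnergy s W F := by
  have hFi := imp_ne_top_of_mem_maximizers hs0 hs1 hW hζ hF hFζ
  have h1 : energyImpulse s W (fun x => (G x).toReal) ≤ energyImpulse s W ζ :=
    hζ.2 (toReal_mem_weakClosure hZ hZζ hG h)
  rw [energyImpulse_eq hs0 hs1 hF hζ.1.2.1 hFζ hFi, energyImpulse_eq hs0 hs1 hG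
    (Eventually.of_forall fun x => ENNReal.toReal_nonneg) hG.ofReal_toReal hGi] at h1
  exact_mod_cast h1

theorem toReal_mem_maximizers (hs0 : 0 < s) (hs1 : s < 1) (hW : 0 < W)
    (hζ : ζ ∈ maximizers s W ζ₀) (hF : Patch s M m F)
    (hFζ : F =ᵐ[volume] fun x => ENNReal.ofReal (ζ x)) (hZ : ∀ x ∉ domain s, Z x = 0)
    (hZζ : Z =ᵐ[volume] fun x => ENNReal.ofReal (ζ₀ x)) {M' m' : ℝ≥0} (hG : Patch s M' m' G)
    (hGi : imp G ≠ ⊤) (h : ∀ τ, excess G τ ≤ excess Z τ)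
    (heq : penEnergy s W G = penEnergy s W F) : (fun x => (G x).toReal) ∈ maximizers s W ζ₀ := by
  have hFi := imp_ne_top_of_mem_maximizers hs0 hs1 hW hζ hF hFζ
  refine ⟨toReal_mem_weakClosure hZ hZζ hG h, fun ξ hξ => ?_⟩
  have h1 : energyImpulse s W ξ ≤ energyImpulse s W ζ := hζ.2 hξ
  rw [energyImpulse_eq hs0 hs1 hF hζ.1.2.1 hFζ hFi, ← heq, ← energyImpulse_eq hs0 hs1 hG
    (Eventually.of_forall fun x => ENNReal.toReal_nonneg) hG.ofReal_toReal hGi] at h1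
  exact h1

theorem ae_le_of_eLpNorm_top_le (hm : eLpNorm ζ ⊤ volume ≤ (M : ℝ≥0∞)) : ∀ᵐ x, ζ x ≤ M := by
  rw [eLpNorm_exponent_top] at hm
  filter_upwards [ae_le_eLpNormEssSup (f := ζ) (μ := volume)] with x hx
  have h1 : ‖ζ x‖ₑ ≤ (M : ℝ≥0∞) := hx.trans hm
  rw [← ofReal_norm, ← ENNReal.ofReal_coe_nnreal,
    ENNReal.ofReal_le_ofReal_iff M.coe_nonneg] at h1
  exact (le_abs_self _).trans h1

theorem excess_le_add_lintegral_absDiff (hF : Measurable F) (hG : Measurable G) (τ : ℝ≥0∞) :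
    excess F τ ≤ excess G τ + ∫⁻ x, absDiff F G x := by
  unfold excess
  rw [← lintegral_add_right _ (measurable_absDiff hF hG)]
  refine lintegral_mono fun x => ?_
  rw [add_comm]
  exact tsub_le_tsub_add_tsub.trans (add_le_add le_self_add le_rfl)

theorem lintegral_sq_le_add_lintegral_absDiff (hF : Patch s M m F) (hG : Patch s M m G) :
    ∫⁻ x, F x ^ 2 ≤ (∫⁻ x, G x ^ 2) + 2 * M * ∫⁻ x, absDiff F G x := by
  have hD := measurable_absDiff hF.meas hG.meas
  rw [← lintegral_const_mul _ hD, ← lintegral_add_right _ (hD.const_mul _)]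
  refine lintegral_mono fun x => ?_
  rcases le_total (F x) (G x) with h | h
  · exact le_add_right (by gcongr)
  · obtain ⟨d, hd⟩ := exists_add_of_le h
    have h1 : d ≤ absDiff F G x := by
      rw [absDiff, hd, ENNReal.add_sub_cancel_left (hG.ne_top x)]
      exact le_self_add
    calc F x ^ 2 = G x ^ 2 + (G x + F x) * d := by rw [hd]; ring
      _ ≤ G x ^ 2 + (M + M) * absDiff F G x := by
          gcongr
          · exact hG.le x
          · exact hF.le x
      _ = _ := by ring

theorem penEnergy_sub_le (hs0 : 0 < s) (hs1 : s < 1) (hW : 0 < W) (hF : Patch s M m F)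
    (hG : Patch s M m G) (hFi : imp F ≠ ⊤) {δ : ℝ} (hδ : 0 ≤ δ)
    (h1 : ∫⁻ x, absDiff F G x ≤ ENNReal.ofReal δ) (h2 : imp G ≤ imp F + ENNReal.ofReal δ) :
    penEnergy s W F - ((potBound s M m).toReal + W) * δ ≤ penEnergy s W G := by
  have hC := potBound_ne_top hs0 hs1 M m
  have hGG := hG.bil_ne_top hG hs0 hs1
  have hb : bil s F F ≤ bil s G G + 2 * (potBound s M m * ENNReal.ofReal δ) := by
    refine (bil_le_bil_add_lintegral_sub hs0 hs1 hF hG).trans ?_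
    gcongr
    exact (lintegral_mono fun x => le_self_add).trans h1
  have hb' := ENNReal.toReal_mono (by finiteness) hb
  rw [ENNReal.toReal_add hGG (by finiteness), ENNReal.toReal_mul, ENNReal.toReal_mul,
    ENNReal.toReal_ofReal hδ, ENNReal.toReal_ofNat] at hb'
  have hi' := ENNReal.toReal_mono (by finiteness) h2
  rw [ENNReal.toReal_add hFi (by finiteness), ENNReal.toReal_ofReal hδ] at hi'
  unfold penEnergy
  nlinarith

theorem absDiff_comm (F G : Plane → ℝ≥0∞) : absDiff F G = absDiff G F := by
  funext x; exact add_comm _ _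

/-- Regular solutions starting near the maximizers are represented by almost maximizing patches. -/
theorem IsRegularSolution.exists_patch (hs0 : 0 < s) (hs1 : s < 1) (hW : 0 < W) {m₀ : ℝ≥0}
    (hM : 0 < M) (hZ : Patch s M m₀ Z) (hZζ : Z =ᵐ[volume] fun x => ENNReal.ofReal (ζ₀ x))
    (hm : AEMeasurable ζ₀) (h0 : 0 ≤ᵐ[volume] ζ₀) {S : ℝ}
    (hS : ∀ ζ ∈ maximizers s W ζ₀, ∀ F, Patch s M m₀ F →
      F =ᵐ[volume] (fun x => ENNReal.ofReal (ζ x)) → penEnergy s W F = S)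
    (hsub : maximizers s W ζ₀ ⊆ rearrangements s ζ₀) {T : EReal} {ξ : ℝ → Plane → ℝ}
    (hξ : IsRegularSolution s T ξ₀ ξ) (hξM : eLpNorm ξ₀ ⊤ volume ≤ (M : ℝ≥0∞)) {δ : ℝ}
    (hδ : 0 < δ) (hδ1 : δ ≤ 1)
    (hinf : (⨅ ζ ∈ maximizers s W ζ₀, eLpNorm (ξ₀ - ζ) 1 volume + eLpNorm (ξ₀ - ζ) 2 volume
      + (impulse s (ξ₀ - ζ)).abs) < ENNReal.ofReal δ) {t : ℝ} (ht : 0 < t) (htT : (t : EReal) < T) :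
    ∃ F, Patch s M (m₀ + 1) F ∧ F =ᵐ[volume] (fun x => ENNReal.ofReal (ξ t x)) ∧
      0 ≤ᵐ[volume] ξ t ∧ imp F ≠ ⊤ ∧
      (∀ τ, excess F τ ≤ excess Z τ + ENNReal.ofReal δ) ∧
      ∫⁻ x, F x ^ 2 ≤ (∫⁻ x, Z x ^ 2) + ENNReal.ofReal (2 * M * δ) ∧
      S - ((potBound s M (m₀ + 1)).toReal + W) * δ ≤ penEnergy s W F := by
  obtain ⟨ζ, hζ'⟩ := iInf_lt_iff.1 hinf
  obtain ⟨hζ, hζδ⟩ := iInf_lt_iff.1 hζ'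
  have hζr := hsub hζ
  obtain ⟨P, hP, hPζ, hPe, hP2⟩ := exists_patch_of_mem_rearrangements hM hZ hZζ hm h0 hζr
  have hP1 : Patch s M (m₀ + 1) P := ⟨hP.meas, hP.le, hP.off, hP.mass.trans (by simp)⟩
  have hPi := imp_ne_top_of_mem_maximizers hs0 hs1 hW hζ hP hPζ
  have hT0 : ((0 : ℝ) : EReal) < T := lt_trans (by exact_mod_cast ht) htT
  -- Nonnegativity and support of the initial datum are read off from the rearrangement property at
  -- time zero.
  obtain ⟨hi0, hoff, hint, -⟩ := hξ.rearranged 0 le_rfl hT0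
  have hξ00 : 0 ≤ᵐ[volume] ξ₀ := by
    filter_upwards [hi0, hξ.initial] with x h1 h2
    rwa [← h2]
  have hξ0off : VanishesOff (domain s) ξ₀ := by
    filter_upwards [hoff, hξ.initial] with x h1 h2 hx
    rw [← h2, h1 hx]
  have hξ0m : AEMeasurable ξ₀ := hξ.data_one.1.aemeasurable
  -- a first representative, with a crude bound for the mass
  have hdist : eLpNorm (ξ₀ - ζ) 1 volume < ENNReal.ofReal δ :=
    lt_of_le_of_lt (le_self_add.trans le_self_add) hζδ
  have hmass : ∫⁻ x, ENNReal.ofReal (ξ₀ x) ≤ (m₀ + 1 : ℝ≥0) := by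
    rw [eLpNorm_one_eq_lintegral_enorm] at hdist
    calc ∫⁻ x, ENNReal.ofReal (ξ₀ x) ≤ ∫⁻ x, (P x + ‖(ξ₀ - ζ) x‖ₑ) := by
          refine lintegral_mono_ae ?_
          filter_upwards [hPζ] with x hx
          rw [hx, Pi.sub_apply, ← ofReal_norm, Real.norm_eq_abs]
          refine (ENNReal.ofReal_le_ofReal ?_).trans ENNReal.ofReal_add_le
          linarith [le_abs_self (ξ₀ x - ζ x)]
      _ = (∫⁻ x, P x) + ∫⁻ x, ‖(ξ₀ - ζ) x‖ₑ := lintegral_add_left hP.meas _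
      _ ≤ m₀ + ENNReal.ofReal δ := add_le_add hP.mass hdist.le
      _ ≤ (m₀ + 1 : ℝ≥0) := by
          rw [ENNReal.coe_add]
          gcongr
          simpa using ENNReal.ofReal_le_ofReal hδ1
  obtain ⟨F₀, hF₀, hF₀ξ⟩ := GSQG.exists_patch (s := s) hξ0m hξ0off
    (ae_le_of_eLpNorm_top_le hξM) hmass
  -- The patch `F₀` stands for the datum and `F` for the solution at time `t`. Conservation laws
  -- make all relevant quantities agree, so every estimate reduces to comparing `F₀` with `P`.
  obtain ⟨F, hF, hFξ, hFe, hF2⟩ := exists_patch_of_mem_rearrangements hM hF₀ hF₀ξ hξ0m hξ00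
    (hξ.rearranged t ht.le htT)
  have hξt0 := (hξ.rearranged t ht.le htT).1
  have hD : ∫⁻ x, absDiff F₀ P x ≤ ENNReal.ofReal δ := by
    rw [← eLpNorm_sub_one_eq hξ00 hζr.1 hF₀ξ hPζ]; exact hdist.le
  have hiF₀ : imp F₀ ≤ imp P + ENNReal.ofReal δ :=
    imp_le_add_of_impulse_sub hF₀ hP1 hξ00 hζr.1 hF₀ξ hPζ (le_add_self.trans hζδ.le)
  have hF₀i : imp F₀ ≠ ⊤ := ne_top_of_le_ne_top (by finiteness) hiF₀
  have himp : imp F = imp F₀ := by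
    have h1 := hξ.impulse_eq t ht.le htT
    rw [GSQG.impulse_eq hF.off hξt0 hFξ, GSQG.impulse_eq hF₀.off hξ00 hF₀ξ] at h1
    exact_mod_cast h1
  have hpen : penEnergy s W F = penEnergy s W F₀ := by
    have h1 := hξ.energy_eq t ht.le htT
    rw [GSQG.energy_eq hs0 hs1 hF hξt0 hFξ, GSQG.energy_eq hs0 hs1 hF₀ hξ00 hF₀ξ] at h1
    rw [penEnergy, penEnergy, h1, himp]
  refine ⟨F, hF, hFξ, hξt0, by rwa [himp], fun τ => ?_, ?_, ?_⟩
  · rw [hFe, ← hPe]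
    exact (excess_le_add_lintegral_absDiff hF₀.meas hP.meas τ).trans (by gcongr)
  · rw [hF2, ← hP2]
    refine (lintegral_sq_le_add_lintegral_absDiff hF₀ hP1).trans ?_
    rw [ENNReal.ofReal_mul (by positivity), ENNReal.ofReal_mul zero_le_two]
    simp only [ENNReal.ofReal_coe_nnreal, ENNReal.ofReal_ofNat]
    gcongr
  · rw [hpen, ← hS ζ hζ P hP hPζ]
    exact penEnergy_sub_le hs0 hs1 hW hP1 hF₀ hPi hδ.le (by rwa [absDiff_comm]) hiF₀

end

section

/-! ### Stability -/

variable {s W : ℝ} {M m : ℝ≥0} {F G Z : Plane → ℝ≥0∞} {ζ₀ ζ ξ₀ : Plane → ℝ}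

theorem Patch.mono {M' m' : ℝ≥0} (hF : Patch s M m F) (hM : M ≤ M') (hm : m ≤ m') :
    Patch s M' m' F :=
  ⟨hF.meas, fun x => (hF.le x).trans (by exact_mod_cast hM), hF.off,
    hF.mass.trans (by exact_mod_cast hm)⟩

/-- If all maximizers are rearrangements of a nontrivial function, the maximum is positive. -/
theorem penEnergy_pos_of_mem_maximizers (hs0 : 0 < s) (hs1 : s < 1) (hW : 0 < W)
    (hsub : maximizers s W ζ₀ ⊆ rearrangements s ζ₀) (h0 : 0 ≤ᵐ[volume] ζ₀)
    (hpos : 0 < volume (Function.support ζ₀))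
    (hZ : ∀ x ∉ domain s, Z x = 0) (hZζ : Z =ᵐ[volume] fun x => ENNReal.ofReal (ζ₀ x))
    (hζ : ζ ∈ maximizers s W ζ₀) (hF : Patch s M m F)
    (hFζ : F =ᵐ[volume] fun x => ENNReal.ofReal (ζ x)) : 0 < penEnergy s W F := by
  have h0P : Patch s 0 0 (0 : Plane → ℝ≥0∞) :=
    ⟨measurable_const, fun x => by simp, fun x _ => rfl, by simp⟩
  have h0i : imp (0 : Plane → ℝ≥0∞) ≠ ⊤ := by simp [imp]
  have h0e : ∀ τ, excess (0 : Plane → ℝ≥0∞) τ ≤ excess Z τ := fun τ => by simp [excess]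
  have h0E : penEnergy s W (0 : Plane → ℝ≥0∞) = 0 := by simp [penEnergy, bil, imp]
  refine lt_of_le_of_ne (h0E ▸ penEnergy_le_of_mem_maximizers hs0 hs1 hW hζ hF hFζ hZ hZζ h0P
    h0i h0e) fun heq => hpos.ne' ?_
  -- If the maximum were zero, the zero function would be a maximizer, hence a rearrangement of
  -- `ζ₀`, and `ζ₀` would vanish.
  have hmem := hsub (toReal_mem_maximizers hs0 hs1 hW hζ hF hFζ hZ hZζ h0P h0i h0e
    (h0E.trans heq))
  have h1 : ∀ n : ℕ, ∀ᵐ x, ζ₀ x ≤ 1 / ((n : ℝ) + 1) := fun n => by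
    have hn : (0 : ℝ) < 1 / ((n : ℝ) + 1) := by positivity
    refine ae_le_of_equimeasurable (fun τ hτ => (hmem.2.2.2 τ hτ).symm) hn
      (Eventually.of_forall fun x => ?_)
    simpa using hn.le
  have h2 : ζ₀ =ᵐ[volume] 0 := by
    filter_upwards [ae_all_iff.2 h1, h0] with x hx hx0
    exact le_antisymm (ge_of_tendsto' tendsto_one_div_add_atTop_nhds_zero_nat hx) hx0
  exact measure_mono_null (fun x hx => hx) (ae_iff.1 h2)

/-- Regular solutions starting near the maximizers stay near them, also in the impulse. -/
theorem exists_stability (hs0 : 0 < s) (hs1 : s < 1) (hW : 0 < W) {m₀ : ℝ≥0}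
    (hM : 0 < M) (hZ : Patch s M m₀ Z) (hZζ : Z =ᵐ[volume] fun x => ENNReal.ofReal (ζ₀ x))
    (hm : AEMeasurable ζ₀) (h0 : 0 ≤ᵐ[volume] ζ₀) (hpos : 0 < volume (Function.support ζ₀))
    (hne : (maximizers s W ζ₀).Nonempty) (hsub : maximizers s W ζ₀ ⊆ rearrangements s ζ₀)
    {η : ℝ≥0∞} (hη : η ≠ 0) :
    ∃ δ : ℝ, 0 < δ ∧ ∀ (T : EReal) (ξ₀ : Plane → ℝ) (ξ : ℝ → Plane → ℝ),
      IsRegularSolution s T ξ₀ ξ → eLpNorm ξ₀ ⊤ volume ≤ (M : ℝ≥0∞) →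
      (⨅ ζ ∈ maximizers s W ζ₀, eLpNorm (ξ₀ - ζ) 1 volume + eLpNorm (ξ₀ - ζ) 2 volume
        + (impulse s (ξ₀ - ζ)).abs) ≤ ENNReal.ofReal δ →
      ∀ t : ℝ, 0 < t → (t : EReal) < T →
        (⨅ ζ ∈ maximizers s W ζ₀, eLpNorm (ξ t - ζ) 1 volume + eLpNorm (ξ t - ζ) 2 volume
          + (impulse s fun x => |ξ t x - ζ x|).toENNReal) ≤ η := by
  obtain ⟨ζ, hζ⟩ := hne
  obtain ⟨P, hP, hPζ, hPe, -⟩ := exists_patch_of_mem_rearrangements hM hZ hZζ hm h0 (hsub hζ)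
  have hPi := imp_ne_top_of_mem_maximizers hs0 hs1 hW hζ hP hPζ
  have hSpos := penEnergy_pos_of_mem_maximizers hs0 hs1 hW hsub h0 hpos hZ.off hZζ hζ hP hPζ
  set S := penEnergy s W P with hSdef
  have hmax : ∀ m' G, Patch s M m' G → imp G ≠ ⊤ → (∀ τ, excess G τ ≤ excess Z τ) →
      penEnergy s W G ≤ S := fun m' G hG hGi hGe =>
    penEnergy_le_of_mem_maximizers hs0 hs1 hW hζ hP hPζ hZ.off hZζ hG hGi hGe
  have hS : ∀ ζ ∈ maximizers s W ζ₀, ∀ F, Patch s M m₀ F →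
      F =ᵐ[volume] (fun x => ENNReal.ofReal (ζ x)) → penEnergy s W F = S := by
    intro ζ' hζ' F hF hFζ
    obtain ⟨-, -, -, heq⟩ := hsub hζ'
    have hm' := (hsub hζ').2.2.1.aestronglyMeasurable.aemeasurable
    refine le_antisymm (hmax _ F hF (imp_ne_top_of_mem_maximizers hs0 hs1 hW hζ' hF hFζ)
      fun τ => (excess_eq_of_equimeasurable hFζ hZζ hm' hm heq τ).le) ?_
    exact penEnergy_le_of_mem_maximizers hs0 hs1 hW hζ' hF hFζ hZ.off hZζ hP hPi
      fun τ => (hPe τ).le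
  have hmem : ∀ G, Patch s M (m₀ + 1) G → imp G ≠ ⊤ → (∀ τ, excess G τ ≤ excess Z τ) →
      penEnergy s W G = S → (fun x => (G x).toReal) ∈ maximizers s W ζ₀ :=
    fun G hG hGi hGe hGS =>
      toReal_mem_maximizers hs0 hs1 hW hζ hP hPζ hZ.off hZζ hG hGi hGe hGS
  have hZeq : ∀ G, Patch s M (m₀ + 1) G → imp G ≠ ⊤ → (∀ τ, excess G τ ≤ excess Z τ) →
      penEnergy s W G = S →
      ∫⁻ x, Z x = ∫⁻ x, G x ∧ ∫⁻ x, Z x ^ 2 = ∫⁻ x, G x ^ 2 := by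
    intro G hG hGi hGe hGS
    obtain ⟨h1, -, h3, heq⟩ := hsub (hmem G hG hGi hGe hGS)
    have hm' := h3.aestronglyMeasurable.aemeasurable
    have he := excess_eq_of_equimeasurable hG.ofReal_toReal hZζ hm' hm heq 0
    rw [excess_zero, excess_zero] at he
    exact ⟨he.symm, (lintegral_sq_eq_of_equimeasurable hG.ofReal_toReal hZζ hm' hm h1 h0 heq).symm⟩
  -- Failure yields data approaching the maximizers and times at which the solutions are `η`-far
  -- from them. The solutions at these times form an almost maximizing sequence.
  by_contra hcon
  push Not at hcon
  set C := (potBound s M (m₀ + 1)).toReal with hC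
  have hC0 : 0 ≤ C := ENNReal.toReal_nonneg
  set d : ℕ → ℝ := fun n => 1 / ((n : ℝ) + 1) with hd
  have hd0 : ∀ n, 0 < d n := fun n => by positivity
  have hd1 : ∀ n, d n ≤ 1 := fun n => by
    rw [hd]; exact (div_le_one (by positivity)).2 (by linarith [n.cast_nonneg (α := ℝ)])
  have hdlim : Tendsto d atTop (𝓝 0) := tendsto_one_div_add_atTop_nhds_zero_nat
  -- The half turns the bound on the infimum into a strict one by `d n`, so that some maximizer
  -- realizes it.
  choose T ξ₀ ξ hξ hξM hinf t ht htT hfar using fun n => hcon (d n / 2) (half_pos (hd0 n))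
  have hpatch := fun n => (hξ n).exists_patch hs0 hs1 hW hM hZ hZζ hm h0 hS hsub (hξM n)
    (hd0 n) (hd1 n) ((hinf n).trans_lt
      ((ENNReal.ofReal_lt_ofReal_iff (hd0 n)).2 (half_lt_self (hd0 n)))) (ht n) (htT n)
  choose F hF hFξ hξ0 hFi hFe hF2 hFS using hpatch
  -- One constant for the errors in excess (`1`), squared `L²` norm (`2M`) and penalized energy (`C
  -- + W`).
  set c : ℝ := 1 + 2 * M + C + W with hc
  have hM0 : (0 : ℝ) ≤ M := M.coe_nonneg
  have he : Tendsto (fun n => c * d n) atTop (𝓝 0) := by simpa using hdlim.const_mul c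
  have hCm : potBound s M (m₀ + 1) ≠ ⊤ := potBound_ne_top hs0 hs1 M _
  -- Energies are bounded on patches and penalized energies are bounded below, as `S > 0`; the
  -- difference bounds `W` times the impulse.
  have hFK : ∀ n, imp (F n) ≤ ENNReal.ofReal ((C * (m₀ + 1 : ℝ≥0) / 2 + C + W) / W) := by
    intro n
    have h1 := ENNReal.toReal_mono (by finiteness) ((hF n).bil_le' (hF n) hs0 hs1)
    rw [ENNReal.toReal_mul, ENNReal.coe_toReal] at h1
    have h2 := hFS n
    rw [penEnergy] at h2
    have h3 : (C + W) * d n ≤ C + W := mul_le_of_le_one_right (by positivity) (hd1 n)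
    rw [← ENNReal.ofReal_toReal (hFi n)]
    refine ENNReal.ofReal_le_ofReal ?_
    rw [le_div_iff₀ hW]
    linarith
  obtain ⟨n, G, hG, hGi, hGe, hGS, hclose⟩ := exists_maximizer_near hs0 hs1 hW hSpos hmax hZeq hF
    ENNReal.ofReal_ne_top hFK he
    (fun n τ => (hFe n τ).trans (by
      gcongr; rw [hc]; exact le_mul_of_one_le_left (hd0 n).le (by linarith)))
    (fun n => (hF2 n).trans (by
      gcongr; rw [hc]; linarith))
    (fun n => le_trans (by
      gcongr; rw [hc]; linarith) (hFS n)) hη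
  refine (hfar n).not_ge ((iInf₂_le _ (hmem G hG hGi hGe hGS)).trans ?_)
  have hG0 : 0 ≤ᵐ[volume] fun x => (G x).toReal :=
    Eventually.of_forall fun x => ENNReal.toReal_nonneg
  rw [eLpNorm_sub_one_eq (hξ0 n) hG0 (hFξ n) hG.ofReal_toReal,
    eLpNorm_sub_two_eq (hξ0 n) hG0 (hFξ n) hG.ofReal_toReal,
    impulse_abs_sub_eq (hF n).off hG.off (hξ0 n) hG0 (hFξ n) hG.ofReal_toReal]
  exact hclose

/-- The profile of bounded maximizers is represented by a patch. -/
theorem exists_patch_of_maximizer_bounded (hm : AEMeasurable ζ₀)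
    (hoff : VanishesOff (domain s) ζ₀) (hζ : ζ ∈ rearrangements s ζ₀) (hb : MemLp ζ ⊤ volume) :
    ∃ M m Z, Patch s M m Z ∧ Z =ᵐ[volume] fun x => ENNReal.ofReal (ζ₀ x) := by
  obtain ⟨-, -, hint, heq⟩ := hζ
  set c := (eLpNorm ζ ⊤ volume).toNNReal
  have hc : eLpNorm ζ ⊤ volume ≤ (c : ℝ≥0∞) := (ENNReal.coe_toNNReal hb.2.ne).ge
  have h1 : ∀ᵐ x, ζ₀ x ≤ (c + 1 : ℝ≥0) :=
    ae_le_of_equimeasurable (fun τ hτ => (heq τ hτ).symm) (by positivity) (by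
      filter_upwards [ae_le_of_eLpNorm_top_le hc] with x hx
      push_cast; linarith)
  have h2 := lintegral_ofReal_sub_eq_of_equimeasurable
    hint.aestronglyMeasurable.aemeasurable hm heq le_rfl
  simp only [sub_zero] at h2
  have h3 : ∫⁻ x, ENNReal.ofReal (ζ x) ≠ ⊤ := hint.lintegral_lt_top.ne
  obtain ⟨Z, hZ, hZζ⟩ := exists_patch (s := s) (m := (∫⁻ x, ENNReal.ofReal (ζ x)).toNNReal) hm hoff
    h1 (by rw [ENNReal.coe_toNNReal h3, h2])
  exact ⟨_, _, Z, hZ, hZζ⟩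

end

end GSQG

end

/-! ### The stability theorem -/

theorem mainTheorem6 (s : ℝ) (hs0 : 0 < s) (hs1 : s < 1) (q : ℝ≥0∞)
    (hq : (s ≤ 1 / 2 → max 2 (ENNReal.ofReal (1 / s)) < q) ∧
      (1 / 2 < s → ENNReal.ofReal (2 / (2 * s - 1)) < q))
    (W : ℝ) (hW : 0 < W) (ζ₀ : GSQG.Plane → ℝ)
    (hζ_nonneg : 0 ≤ᵐ[volume] ζ₀) (hζ_off : GSQG.VanishesOff (GSQG.domain s) ζ₀)
    (hζ_mem : MemLp ζ₀ q volume)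
    (hζ_pos : 0 < volume (Function.support ζ₀)) (hζ_fin : volume (Function.support ζ₀) < ⊤)
    (hne : (GSQG.maximizers s W ζ₀).Nonempty)
    (hsub : GSQG.maximizers s W ζ₀ ⊆ GSQG.rearrangements s ζ₀)
    (hadm : ∀ ζ ∈ GSQG.maximizers s W ζ₀, GSQG.Admissible s ζ) :
    ∀ η M : ℝ, 0 < η → 0 < M → ∃ δ : ℝ, 0 < δ ∧
      ∀ (T : EReal) (ξ₀ : GSQG.Plane → ℝ) (ξ : ℝ → GSQG.Plane → ℝ),
        GSQG.IsRegularSolution s T ξ₀ ξ →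
        eLpNorm ξ₀ ⊤ volume ≤ ENNReal.ofReal M →
        (⨅ ζ ∈ GSQG.maximizers s W ζ₀,
          eLpNorm (ξ₀ - ζ) 1 volume + eLpNorm (ξ₀ - ζ) 2 volume
            + (GSQG.impulse s (ξ₀ - ζ)).abs) ≤ ENNReal.ofReal δ →
        ∀ t : ℝ, 0 < t → (t : EReal) < T →
          (⨅ ζ ∈ GSQG.maximizers s W ζ₀,
            eLpNorm (ξ t - ζ) 1 volume + eLpNorm (ξ t - ζ) 2 volume) ≤ ENNReal.ofReal η ∧
          ((∀ ζ₁ ∈ GSQG.maximizers s W ζ₀, ∀ ζ₂ ∈ GSQG.maximizers s W ζ₀,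
              GSQG.impulse s ζ₁ = GSQG.impulse s ζ₂) →
            (⨅ ζ ∈ GSQG.maximizers s W ζ₀,
              eLpNorm (ξ t - ζ) 1 volume + eLpNorm (ξ t - ζ) 2 volume
                + (GSQG.impulse s (fun x => |ξ t x - ζ x|)).toENNReal) ≤ ENNReal.ofReal η) := by
  intro η M hη hM
  have hm := hζ_mem.1.aemeasurable
  obtain ⟨ζ, hζ⟩ := hne
  -- The initial datum of a regular solution is bounded, so this maximizer is bounded, and so is
  -- `ζ₀`, which is equimeasurable with it.
  obtain ⟨ξ, hξ⟩ := (hadm ζ hζ).2.2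
  obtain ⟨M₁, m, Z, hZ, hZζ⟩ :=
    GSQG.exists_patch_of_maximizer_bounded hm hζ_off (hsub hζ) hξ.data_top
  -- A common height bound for the profile and for the perturbed initial data.
  have hM' : 0 < max M₁ M.toNNReal := lt_max_of_lt_right (Real.toNNReal_pos.2 hM)
  obtain ⟨δ, hδ, hstab⟩ := GSQG.exists_stability hs0 hs1 hW hM' (hZ.mono (le_max_left _ _) le_rfl)
    hZζ hm hζ_nonneg hζ_pos ⟨ζ, hζ⟩ hsub (ENNReal.ofReal_pos.2 hη).ne'
  refine ⟨δ, hδ, fun T ξ₀ ξ hξ hξM hinf t ht htT => ?_⟩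
  have h := hstab T ξ₀ ξ hξ
    (hξM.trans (ENNReal.coe_le_coe.2 (le_max_right _ _))) hinf t ht htT
  exact ⟨(iInf₂_mono fun ζ _ => le_self_add).trans h, fun _ => h⟩
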